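/- For each integer $n\ge 1$ let $X_n$ be a stationary and isotropic Poisson hyperplane process in $\mathbb R^n$ with intensity $\gamma_n\in(0,\infty)$; that is, $X_n$ is a Poisson process on the space of affine hyperplanes of $\mathbb R^n$ whose distribution is invariant under translations and rotations, with intensity measure $\Theta_n=\mathbb E[X_n(\cdot)]$ satisfying $$\int f\,d\Theta_n = 2\gamma_n\int_{S^{n-1}}\int_0^\infty f\big(\{x:\langle x,u\rangle=\tau\}\big)\,d\tau\,\phi_n(du)$$ for all nonnegative measurable $f$ and some even probability measure $\phi_n$ on $S^{n-1}$. Let $\hat X_n$ be the set of cells of the induced tessellation (the closures of the connected components of the complement of the union of the hyperplanes). Let $c_n$ be a center function, i.e. a measurable map from convex bodies to $\mathbb R^n$ with $c_n(K+t)=c_n(K)+t$, and let $B_n\subset\mathbb R^n$ be a bounded Borel set of positive volume. The typical cell $Z_n$ of $X_n$ is a random convex body with distribution $$\mathbb P(Z_n\in A)=\frac{1}{\lambda_n|B_n|}\,\mathbb E\sum_{K\in\hat X_n}\mathbf 1_A(K-c_n(K))\,\mathbf 1_{B_n}(c_n(K)),$$ where the cell intensity $\lambda_n$ is the mean number of cells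 with center in $[0,1]^n$. The inradius $r_{in}(K)$ is the radius of the largest ball contained in $K$. If $\gamma_n\to\infty$ as $n\to\infty$, then for every fixed $r>0$, $$\lim_{n\to\infty}\mathbb P\big(r_{in}(Z_n)>r\big)=0 .$$ -/

import Mathlib

open MeasureTheory Filter Topology

namespace HyperplaneTess

/-- Euclidean space of dimension `n`. -/
abbrev E (n : ℕ) : Type := EuclideanSpace ℝ (Fin n)

/-- The set `H(u, τ) = {x : ⟨x, u⟩ = τ}`. -/
def planeSet {n : ℕ} (u : E n) (τ : ℝ) : Set (E n) := {x | inner ℝ x u = τ}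

/-- The space of affine hyperplanes of `ℝⁿ`, i.e. the sets `H(u, τ)` with `u` a unit vector. -/
def Hyperplane (n : ℕ) : Type :=
  {S : Set (E n) // ∃ (u : Metric.sphere (0 : E n) 1) (τ : ℝ), S = planeSet (u : E n) τ}

namespace Hyperplane

/-- The hyperplane with unit normal `u` at signed distance `τ` from the origin. -/
def mk' {n : ℕ} (u : Metric.sphere (0 : E n) 1) (τ : ℝ) : Hyperplane n :=
  ⟨planeSet (u : E n) τ, u, τ, rfl⟩

/-- The hyperplanes that meet the set `C`. -/
def hitting {n : ℕ} (C : Set (E n)) : Set (Hyperplane n) := {H | (H.1 ∩ C).Nonempty}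

/-- The Borel sigma-algebra of the space of hyperplanes, as a subspace of the space of closed
sets: it is generated by the sets of hyperplanes that meet a given compact set. -/
instance (n : ℕ) : MeasurableSpace (Hyperplane n) :=
  MeasurableSpace.generateFrom {A | ∃ C : Set (E n), IsCompact C ∧ A = hitting C}

/-- The translate `H + t`. -/
def translate {n : ℕ} (t : E n) (H : Hyperplane n) : Hyperplane n :=
  ⟨(fun x => x + t) '' H.1, by
    obtain ⟨S, u, τ, rfl⟩ := H
    refine ⟨u, τ + inner ℝ t (u : E n), ?_⟩
    ext x
    constructor
    · rintro ⟨y, hy, rfl⟩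
      have hy' : inner ℝ y (u : E n) = τ := hy
      change inner ℝ (y + t) (u : E n) = _
      rw [inner_add_left, hy']
    · intro hx
      have hx' : inner ℝ x (u : E n) = τ + inner ℝ t (u : E n) := hx
      refine ⟨x - t, ?_, sub_add_cancel x t⟩
      change inner ℝ (x - t) (u : E n) = _
      rw [inner_sub_left, hx', add_sub_cancel_right]⟩

/-- The image of `H` under a linear isometry. -/
def rotate {n : ℕ} (R : E n ≃ₗᵢ[ℝ] E n) (H : Hyperplane n) : Hyperplane n :=
  ⟨R '' H.1, by
    obtain ⟨S, u, τ, rfl⟩ := H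
    refine ⟨⟨R u, by simp⟩, τ, ?_⟩
    ext x
    constructor
    · rintro ⟨y, hy, rfl⟩
      have hy' : inner ℝ y (u : E n) = τ := hy
      change inner ℝ (R y) (R u) = _
      rw [R.inner_map_map, hy']
    · intro hx
      have hx' : inner ℝ x (R u) = τ := hx
      refine ⟨R.symm x, ?_, R.apply_symm_apply x⟩
      change inner ℝ (R.symm x) (u : E n) = _
      rw [← hx', ← R.inner_map_map, R.apply_symm_apply]⟩

theorem measurable_translate {n : ℕ} (t : E n) : Measurable (translate t) := by
  refine measurable_generateFrom ?_
  rintro _ ⟨C, hC, rfl⟩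
  refine MeasurableSpace.measurableSet_generateFrom
    ⟨(fun x => x + -t) '' C, hC.image (by fun_prop), ?_⟩
  ext H
  constructor
  · rintro ⟨_, ⟨y, hy, rfl⟩, hyC⟩
    exact ⟨y, hy, y + t, hyC, by simp⟩
  · rintro ⟨_, hy, x, hx, rfl⟩
    exact ⟨x, ⟨_, hy, by simp⟩, hx⟩

theorem measurable_rotate {n : ℕ} (R : E n ≃ₗᵢ[ℝ] E n) : Measurable (rotate R) := by
  refine measurable_generateFrom ?_
  rintro _ ⟨C, hC, rfl⟩
  refine MeasurableSpace.measurableSet_generateFrom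
    ⟨R.symm '' C, hC.image R.symm.continuous, ?_⟩
  ext H
  constructor
  · rintro ⟨_, ⟨y, hy, rfl⟩, hyC⟩
    exact ⟨y, hy, R y, hyC, by simp⟩
  · rintro ⟨_, hy, x, hx, rfl⟩
    exact ⟨x, ⟨_, hy, by simp⟩, hx⟩

end Hyperplane

/-! ### Poisson hyperplane processes -/

/-- Locally finite counting measures on the space of hyperplanes: countable sums of point masses,
with finitely many of them on hyperplanes meeting any given compact set. -/
def IsCountingMeasure {n : ℕ} (μ : Measure (Hyperplane n)) : Prop :=
  (∃ (ι : Type) (_ : Countable ι) (h : ι → Hyperplane n),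
    μ = Measure.sum fun i => Measure.dirac (h i)) ∧
  ∀ C : Set (E n), IsCompact C → μ (Hyperplane.hitting C) < ⊤

/-- A hyperplane process: a random locally finite counting measure on the space of hyperplanes. -/
structure IsHyperplaneProcess {n : ℕ} {Ω : Type*} [MeasurableSpace Ω]
    (X : Ω → Measure (Hyperplane n)) : Prop where
  measurable : Measurable X
  counting : ∀ ω, IsCountingMeasure (X ω)

/-- The intensity measure `Θ(A) = 𝔼[X(A)]`. -/
noncomputable def intensityMeasure {n : ℕ} {Ω : Type*} [MeasurableSpace Ω] (P : Measure Ω)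
    (X : Ω → Measure (Hyperplane n)) : Measure (Hyperplane n) :=
  P.bind X

/-- Invariance of the distribution of `X` under translations. -/
def IsStationary {n : ℕ} {Ω : Type*} [MeasurableSpace Ω] (P : Measure Ω)
    (X : Ω → Measure (Hyperplane n)) : Prop :=
  ∀ t : E n, P.map (fun ω => (X ω).map (Hyperplane.translate t)) = P.map X

/-- Invariance of the distribution of `X` under rotations about the origin. -/
def IsIsotropic {n : ℕ} {Ω : Type*} [MeasurableSpace Ω] (P : Measure Ω)
    (X : Ω → Measure (Hyperplane n)) : Prop :=
  ∀ R : E n ≃ₗᵢ[ℝ] E n, LinearMap.det (R.toLinearEquiv : E n →ₗ[ℝ] E n) = 1 →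
    P.map (fun ω => (X ω).map (Hyperplane.rotate R)) = P.map X

/-- The Poisson property with respect to the intensity measure `Θ`. -/
def IsPoisson {n : ℕ} {Ω : Type*} [MeasurableSpace Ω] (P : Measure Ω)
    (X : Ω → Measure (Hyperplane n)) : Prop :=
  ∀ (k : ℕ) (A : Fin k → Set (Hyperplane n)) (m : Fin k → ℕ),
    (∀ i, MeasurableSet (A i)) → Pairwise (fun i j => Disjoint (A i) (A j)) →
    (∀ i, intensityMeasure P X (A i) < ⊤) →
    P {ω | ∀ i, X ω (A i) = (m i : ENNReal)} =
      ∏ i, ENNReal.ofReal ((intensityMeasure P X (A i)).toReal ^ m i / (Nat.factorial (m i) : ℝ) *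
        Real.exp (-(intensityMeasure P X (A i)).toReal))

/-- `X` has intensity `γ`: there is an even probability measure `φ` on the unit sphere (the
spherical directional distribution) with
`∫ f dΘ = 2 γ ∫_{S^{n-1}} ∫_0^∞ f(H(u, τ)) dτ φ(du)` for all nonnegative measurable `f`. -/
def HasIntensity {n : ℕ} {Ω : Type*} [MeasurableSpace Ω] (P : Measure Ω)
    (X : Ω → Measure (Hyperplane n)) (γ : ℝ) : Prop :=
  0 < γ ∧ ∃ φ : Measure (Metric.sphere (0 : E n) 1),
    IsProbabilityMeasure φ ∧ φ.map (fun u => -u) = φ ∧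
    ∀ f : Hyperplane n → ENNReal, Measurable f →
      ∫⁻ H, f H ∂(intensityMeasure P X) =
        ENNReal.ofReal (2 * γ) *
          ∫⁻ u, (∫⁻ τ in Set.Ioi (0 : ℝ), f (Hyperplane.mk' u τ)) ∂φ

/-- A stationary and isotropic Poisson hyperplane process of intensity `γ`. -/
structure IsStationaryIsotropicPoisson {n : ℕ} {Ω : Type*} [MeasurableSpace Ω] (P : Measure Ω)
    (X : Ω → Measure (Hyperplane n)) (γ : ℝ) : Prop where
  process : IsHyperplaneProcess X
  stationary : IsStationary P X
  isotropic : IsIsotropic P X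
  poisson : IsPoisson P X
  intensity : HasIntensity P X γ

/-! ### The induced tessellation and its typical cell -/

/-- The union of the hyperplanes (atoms) of a counting measure. -/
def skeleton {n : ℕ} (μ : Measure (Hyperplane n)) : Set (E n) :=
  ⋃ H ∈ {H : Hyperplane n | μ {H} ≠ 0}, H.1

/-- The (bounded) cells of the tessellation: the convex bodies that are the closure of a connected
component of the complement of the union of the hyperplanes. -/
def cells {n : ℕ} (μ : Measure (Hyperplane n)) : Set (ConvexBody (E n)) :=
  {K | ∃ x ∈ (skeleton μ)ᶜ, (K : Set (E n)) = closure (connectedComponentIn (skeleton μ)ᶜ x)}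

/-- The translate `K + t` of a convex body. -/
def translateBody {n : ℕ} (t : E n) (K : ConvexBody (E n)) : ConvexBody (E n) where
  carrier := (fun x => x + t) '' (K : Set (E n))
  convex' := by simpa [add_comm] using K.convex.translate t
  isCompact' := K.isCompact.image (by fun_prop)
  nonempty' := K.nonempty.image _

/-- Borel sigma-algebra of the Hausdorff metric on convex bodies. -/
noncomputable instance (n : ℕ) : MeasurableSpace (ConvexBody (E n)) := borel _

/-- Center functions: measurable maps compatible with translations. -/
structure IsCenterFunction {n : ℕ} (c : ConvexBody (E n) → E n) : Prop where
  measurable : Measurable c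
  translate : ∀ (K : ConvexBody (E n)) (t : E n), c (translateBody t K) = c K + t

/-- `𝔼 ∑_K 1_A(K - c(K)) 1_B(c(K))`, where the sum runs over the cells of the tessellation. -/
noncomputable def expectedCells {n : ℕ} {Ω : Type*} [MeasurableSpace Ω] (P : Measure Ω)
    (X : Ω → Measure (Hyperplane n)) (c : ConvexBody (E n) → E n)
    (A : Set (ConvexBody (E n))) (B : Set (E n)) : ENNReal :=
  ∫⁻ ω, (∑' K : cells (X ω),
    A.indicator 1 (translateBody (-(c K.1)) K.1) * B.indicator 1 (c K.1)) ∂P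

/-- The unit cube `[0, 1]ⁿ`. -/
def unitCube (n : ℕ) : Set (E n) := {x | ∀ i, x i ∈ Set.Icc (0 : ℝ) 1}

/-- The cell intensity: the mean number of cells with center in the unit cube. -/
noncomputable def cellIntensity {n : ℕ} {Ω : Type*} [MeasurableSpace Ω] (P : Measure Ω)
    (X : Ω → Measure (Hyperplane n)) (c : ConvexBody (E n) → E n) : ENNReal :=
  expectedCells P X c Set.univ (unitCube n)

/-- `Z` is a random convex body with the distribution of the typical cell of `X`, formed with the
center function `c` and the observation window `B`:
`ℙ(Z ∈ A) = (λ |B|)⁻¹ 𝔼 ∑_K 1_A(K - c(K)) 1_B(c(K))`. -/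
structure IsTypicalCell {n : ℕ} {Ω Ω' : Type*} [MeasurableSpace Ω] [MeasurableSpace Ω']
    (P : Measure Ω) (X : Ω → Measure (Hyperplane n)) (c : ConvexBody (E n) → E n) (B : Set (E n))
    (P' : Measure Ω') (Z : Ω' → ConvexBody (E n)) : Prop where
  measurable : Measurable Z
  law : ∀ A : Set (ConvexBody (E n)), MeasurableSet A →
    P' (Z ⁻¹' A) = (cellIntensity P X c * volume B)⁻¹ * expectedCells P X c A B

/-- The inradius: the radius of the largest ball contained in `K`. -/
noncomputable def inradius {n : ℕ} (K : ConvexBody (E n)) : ℝ :=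
  sSup {ρ : ℝ | 0 ≤ ρ ∧ ∃ x : E n, Metric.closedBall x ρ ⊆ (K : Set (E n))}

end HyperplaneTess

/-! The limit follows from a bound valid in each dimension `n ≥ 1`: the typical cell has inradius
greater than `r` with probability at most `exp (-γ r)` (`IsTypicalCell.prob_lt_inradius_le`). No
cell intensity is computed; cells of large inradius are compared with all cells.

Fix a generic direction `v`. The centers of the balls of radius `r` inside a bounded cell form a
compact set, and by linear programming duality it has a unique lowest point `x` in direction `v`:
the ball about `x` touches exactly `n` hyperplanes, their normals `u i` form a basis, and `x` has
signed distance `sign (a i) * r` to them, where `v = ∑ a i • u i` (`exists_isVertex`). Conversely,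
for `r = 0` the common point of such an `n`-tuple is the lowest vertex of some cell
(`IsVertex.exists_cell`). So, up to the `n!` orderings, cells are counted by `n`-tuples of
hyperplanes.

For a Poisson process the mean number of tuples in a set `D` of injective tuples is the product of
the intensity measures on `D`; restricting to the event that no hyperplane lies in a set `V` avoided
by these tuples only multiplies by `exp (-Θ V)` (`IsPoissonProcess.exists_tuple_count`). Two facts
then give the comparison. Shifting the `i`-th hyperplane by `sign (a i) * r` turns tuples tangent to
a ball centered in `B` into tuples with vertex in `B`, and preserves the product measure
(`pi_intensity_vertexTuples`). And a cell containing the ball of radius `r` about `x` leaves the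
ball of radius `r / 2` about any point within `r / 2` of `x` free of hyperplanes, an event of
probability `exp (-γ r)`. A ball about a fixed nearby point is used because `x` is random; the
resulting loss in the exponent is harmless.

By stationarity, a mass transport argument (`mass_transport`) replaces the given center function by
the lowest center for thick cells and by the lowest vertex for all cells. The normalization of the
typical cell then cancels. General position, simplicity of the process and boundedness of the cells
hold almost surely. -/

namespace HyperplaneTess

/-! ### Measurable structure and coordinates on the space of hyperplanes -/

namespace Hyperplane

/-- The parameters of the hyperplanes that meet a compact `C` are the projection along `C` of a
closed incidence relation, hence closed. -/
theorem measurable_mk' {n : ℕ} :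
    Measurable fun p : Metric.sphere (0 : E n) 1 × ℝ => mk' p.1 p.2 := by
  refine measurable_generateFrom ?_
  rintro _ ⟨C, hC, rfl⟩
  have : IsClosed {p : Metric.sphere (0 : E n) 1 × ℝ | ∃ x : C, inner ℝ (x : E n) (p.1 : E n) = p.2} := by
    have : CompactSpace C := isCompact_iff_compactSpace.mp hC
    have h1 : IsClosed {q : C × (Metric.sphere (0 : E n) 1 × ℝ) |
        inner ℝ (q.1 : E n) (q.2.1 : E n) = q.2.2} :=
      isClosed_eq (by fun_prop) (by fun_prop)
    have := isClosedMap_snd_of_compactSpace _ h1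
    convert this using 1
    ext p
    simp
  convert this.measurableSet using 1
  ext p
  constructor
  · rintro ⟨x, hx, hxC⟩
    exact ⟨⟨x, hxC⟩, hx⟩
  · rintro ⟨x, hx⟩
    exact ⟨x, hx, x.2⟩

theorem surjective_mk' {n : ℕ} :
    Function.Surjective fun p : Metric.sphere (0 : E n) 1 × ℝ => mk' p.1 p.2 := by
  rintro ⟨S, u, τ, rfl⟩
  exact ⟨(u, τ), rfl⟩

theorem isClosed_coe {n : ℕ} (H : Hyperplane n) : IsClosed H.1 := by
  obtain ⟨S, u, τ, rfl⟩ := H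
  exact isClosed_eq (by fun_prop) (by fun_prop)

theorem measurableSet_hitting {n : ℕ} {C : Set (E n)} (hC : IsCompact C) :
    MeasurableSet (hitting C) :=
  MeasurableSpace.measurableSet_generateFrom ⟨C, hC, rfl⟩

theorem eq_of_subset_of_hitting {n : ℕ} {H H' : Hyperplane n}
    (h : ∀ (i : ℕ) (k : ℕ), H ∈ hitting (Metric.closedBall (TopologicalSpace.denseSeq (E n) i) (1 / (k + 1))) →
      H' ∈ hitting (Metric.closedBall (TopologicalSpace.denseSeq (E n) i) (1 / (k + 1)))) :
    H.1 ⊆ H'.1 := by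
  intro x hx
  rw [← H'.isClosed_coe.closure_eq, Metric.mem_closure_iff]
  intro ε hε
  obtain ⟨k, hk⟩ := exists_nat_one_div_lt (half_pos hε)
  obtain ⟨i, hi⟩ := Metric.denseRange_iff.mp (TopologicalSpace.denseRange_denseSeq (E n)) x (1 / (k + 1))
    (by positivity)
  obtain ⟨y, hy, hyi⟩ := h i k ⟨x, hx, by simpa [Metric.mem_closedBall] using hi.le⟩
  refine ⟨y, hy, ?_⟩
  rw [Metric.mem_closedBall, dist_comm] at hyi
  calc dist x y ≤ dist x _ + dist _ y := dist_triangle _ _ _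
    _ < ε := by linarith

/-- A closed set is determined by which balls of radius `1 / (k + 1)` about dense points it meets.
Countable separation makes points measurable, so that atoms make sense, and later provides binary
codes that separate the entries of a tuple. -/
instance (n : ℕ) : MeasurableSpace.CountablySeparated (Hyperplane n) := by
  refine ⟨⟨Set.range (fun p : ℕ × ℕ =>
    hitting (Metric.closedBall (TopologicalSpace.denseSeq (E n) p.1) (1 / (p.2 + 1)))),
    Set.countable_range _, ?_, ?_⟩⟩
  · rintro _ ⟨p, rfl⟩
    exact measurableSet_hitting (isCompact_closedBall _ _)
  · intro H _ H' _ h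
    apply Subtype.ext
    apply Set.Subset.antisymm
    · exact eq_of_subset_of_hitting fun i k => (h _ ⟨(i, k), rfl⟩).1
    · exact eq_of_subset_of_hitting fun i k => (h _ ⟨(i, k), rfl⟩).2

instance (n : ℕ) : MeasurableSingletonClass (Hyperplane n) :=
  MeasurableSpace.measurableSingletonClass_of_countablySeparated

theorem mk'_neg {n : ℕ} (u : Metric.sphere (0 : E n) 1) (τ : ℝ) : mk' (-u) (-τ) = mk' u τ := by
  apply Subtype.ext
  ext x
  change inner ℝ x (-(u : E n)) = -τ ↔ inner ℝ x (u : E n) = τ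
  rw [inner_neg_right, neg_inj]

/-- Two representations of a hyperplane differ by a sign. -/
theorem mk'_eq_mk' {n : ℕ} {u u' : Metric.sphere (0 : E n) 1} {τ τ' : ℝ}
    (h : mk' u τ = mk' u' τ') : (u' = u ∧ τ' = τ) ∨ (u' = -u ∧ τ' = -τ) := by
  have hs : planeSet (u : E n) τ = planeSet (u' : E n) τ' := congrArg Subtype.val h
  have hu : inner ℝ (u : E n) (u : E n) = 1 := by
    rw [real_inner_self_eq_norm_sq, norm_eq_of_mem_sphere, one_pow]
  have hu' : inner ℝ (u' : E n) (u' : E n) = 1 := by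
    rw [real_inner_self_eq_norm_sq, norm_eq_of_mem_sphere, one_pow]
  -- A vector orthogonal to `u` is a difference of two points of the common hyperplane, so it is
  -- orthogonal to `u'` as well. This makes `u'` a multiple of `u`.
  have key : ∀ w : E n, inner ℝ w (u : E n) = 0 → inner ℝ w (u' : E n) = 0 := by
    intro w hw
    have h1 : τ • (u : E n) ∈ planeSet (u : E n) τ := by
      change inner ℝ _ _ = _
      rw [inner_smul_left, hu]; simp
    have h2 : τ • (u : E n) + w ∈ planeSet (u : E n) τ := by
      change inner ℝ _ _ = _
      rw [inner_add_left, inner_smul_left, hu, hw]; simp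
    rw [hs] at h1 h2
    have h1' : inner ℝ (τ • (u : E n)) (u' : E n) = τ' := h1
    have h2' : inner ℝ (τ • (u : E n) + w) (u' : E n) = τ' := h2
    rw [inner_add_left, h1'] at h2'
    linarith
  set c : ℝ := inner ℝ (u' : E n) (u : E n) with hc
  have hcu : (u' : E n) = c • (u : E n) := by
    have h0 : inner ℝ ((u' : E n) - c • (u : E n)) (u : E n) = 0 := by
      rw [inner_sub_left, inner_smul_left, hu]; simp [hc]
    have h1 := key _ h0
    have : inner ℝ ((u' : E n) - c • (u : E n)) ((u' : E n) - c • (u : E n)) = 0 := by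
      rw [inner_sub_right, h1, inner_smul_right, h0]; simp
    exact sub_eq_zero.mp (inner_self_eq_zero.mp this)
  have hc2 : c * c = 1 := by
    have := hu'
    rw [hcu, inner_smul_left, inner_smul_right, hu] at this
    simpa using this
  have hτ : τ' = c * τ := by
    have h1 : τ • (u : E n) ∈ planeSet (u : E n) τ := by
      change inner ℝ _ _ = _
      rw [inner_smul_left, hu]; simp
    rw [hs] at h1
    have h1' : inner ℝ (τ • (u : E n)) (u' : E n) = τ' := h1
    rw [hcu, inner_smul_left, inner_smul_right, hu] at h1'
    simp at h1'
    linarith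
  rcases mul_self_eq_one_iff.mp hc2 with h1 | h1
  · left
    exact ⟨Subtype.ext (by rw [hcu, h1, one_smul]), by rw [hτ, h1, one_mul]⟩
  · right
    exact ⟨Subtype.ext (by rw [hcu, h1, neg_one_smul]; rfl), by rw [hτ, h1, neg_one_mul]⟩

/-- The first nonzero coordinate of the vector is positive. -/
def LexPos {n : ℕ} (x : E n) : Prop := ∃ i, 0 < x i ∧ ∀ j < i, x j = 0

theorem lexPos_or_neg {n : ℕ} {x : E n} (hx : x ≠ 0) : LexPos x ∨ LexPos (-x) := by
  have : ∃ i, x i ≠ 0 := by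
    by_contra! h
    exact hx (by ext i; simpa using h i)
  obtain ⟨i, hi, hmin⟩ := WellFounded.has_min (wellFounded_lt (α := Fin n)) {i | x i ≠ 0} this
  have hj : ∀ j < i, x j = 0 := fun j hji => by
    by_contra h
    exact hmin j h hji
  rcases lt_or_gt_of_ne (show x i ≠ 0 from hi) with h | h
  · right
    exact ⟨i, by simpa using h, fun j hji => by simpa using hj j hji⟩
  · left
    exact ⟨i, h, hj⟩

theorem not_lexPos_neg {n : ℕ} {x : E n} (hx : LexPos x) : ¬ LexPos (-x) := by
  rintro ⟨j, hj, hj'⟩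
  obtain ⟨i, hi, hi'⟩ := hx
  simp only [PiLp.neg_apply, neg_eq_zero, Left.neg_pos_iff] at hj hj'
  rcases lt_trichotomy i j with h | h | h
  · linarith [hj' i h]
  · subst h; linarith
  · linarith [hi' j h]

theorem measurableSet_lexPos {n : ℕ} : MeasurableSet {x : E n | LexPos x} := by
  have : {x : E n | LexPos x} = ⋃ i, ({x : E n | 0 < x i} ∩ ⋂ j, ⋂ (_ : j < i), {x : E n | x j = 0}) := by
    ext x; simp [LexPos]
  rw [this]
  refine MeasurableSet.iUnion fun i => MeasurableSet.inter ?_ ?_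
  · exact measurableSet_lt (by fun_prop) (by fun_prop)
  · exact MeasurableSet.iInter fun j => MeasurableSet.iInter fun _ =>
      measurableSet_eq_fun (by fun_prop) (by fun_prop)

open Classical in
/-- The unit vector `±u` whose first nonzero coordinate is positive, with `τ` changed accordingly. -/
noncomputable def canon {n : ℕ} (p : Metric.sphere (0 : E n) 1 × ℝ) : Metric.sphere (0 : E n) 1 × ℝ :=
  if LexPos (p.1 : E n) then p else (-p.1, -p.2)

theorem measurable_canon {n : ℕ} : Measurable (canon (n := n)) := by
  classical
  unfold canon
  refine Measurable.ite ?_ measurable_id ?_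
  · exact (measurable_subtype_coe.comp measurable_fst) measurableSet_lexPos
  · exact ((continuous_neg.comp continuous_fst).measurable).prodMk measurable_snd.neg

theorem sphere_ne_zero {n : ℕ} (u : Metric.sphere (0 : E n) 1) : (u : E n) ≠ 0 :=
  ne_zero_of_mem_unit_sphere u

theorem canon_neg {n : ℕ} (u : Metric.sphere (0 : E n) 1) (τ : ℝ) :
    canon (-u, -τ) = canon (u, τ) := by
  unfold canon
  by_cases h : LexPos (u : E n)
  · have := not_lexPos_neg h
    simp [h, this]
  · have := (lexPos_or_neg (sphere_ne_zero u)).resolve_left h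
    simp [h, this]

theorem mk'_canon {n : ℕ} (p : Metric.sphere (0 : E n) 1 × ℝ) :
    mk' (canon p).1 (canon p).2 = mk' p.1 p.2 := by
  unfold canon
  split_ifs
  · rfl
  · exact mk'_neg _ _

/-- The canonical unit normal and signed distance of a hyperplane. -/
noncomputable def param {n : ℕ} (H : Hyperplane n) : Metric.sphere (0 : E n) 1 × ℝ :=
  canon (surjective_mk' H).choose

theorem param_mk' {n : ℕ} (u : Metric.sphere (0 : E n) 1) (τ : ℝ) :
    param (mk' u τ) = canon (u, τ) := by
  have h := (surjective_mk' (mk' u τ)).choose_spec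
  unfold param
  generalize (surjective_mk' (mk' u τ)).choose = p at h
  obtain ⟨u', τ'⟩ := p
  rcases mk'_eq_mk' h with ⟨rfl, rfl⟩ | ⟨rfl, rfl⟩
  · rfl
  · rw [canon_neg]

theorem mk'_param {n : ℕ} (H : Hyperplane n) : mk' (param H).1 (param H).2 = H := by
  obtain ⟨p, rfl⟩ := surjective_mk' H
  dsimp only
  rw [param_mk', mk'_canon]

theorem measurable_param {n : ℕ} : Measurable (param (n := n)) := by
  intro s hs
  -- By the Lusin–Suslin theory, a set is measurable as soon as its preimage under a measurable
  -- surjection from a standard Borel space onto a countably separated space is. Measurability of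
  -- the chosen inverse is thus checked on the explicit map `canon`.
  rw [← measurable_mk'.measurableSet_preimage_iff_of_surjective surjective_mk']
  have : (fun p : Metric.sphere (0 : E n) 1 × ℝ => mk' p.1 p.2) ⁻¹' (param ⁻¹' s) = canon ⁻¹' s := by
    ext p
    simp [param_mk']
  rw [this]
  exact measurable_canon hs

theorem injective_param {n : ℕ} : Function.Injective (param (n := n)) := fun H H' h => by
  rw [← mk'_param H, h, mk'_param]

/-- The canonical unit normal of a hyperplane. -/
noncomputable def normal {n : ℕ} (H : Hyperplane n) : E n := (param H).1

/-- The signed distance of a point to a hyperplane. -/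
noncomputable def height {n : ℕ} (H : Hyperplane n) (x : E n) : ℝ := inner ℝ x (normal H) - (param H).2

theorem norm_normal {n : ℕ} (H : Hyperplane n) : ‖normal H‖ = 1 := norm_eq_of_mem_sphere _

theorem mem_iff_height {n : ℕ} (H : Hyperplane n) (x : E n) : x ∈ H.1 ↔ height H x = 0 := by
  conv_lhs => rw [← mk'_param H]
  rw [height, sub_eq_zero]
  rfl

theorem lintegral_canon {n : ℕ} (f : Metric.sphere (0 : E n) 1 × ℝ → ENNReal)
    (u : Metric.sphere (0 : E n) 1) :
    ∫⁻ τ, f (canon (u, τ)) = ∫⁻ τ, f ((canon (u, 0)).1, τ) := by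
  unfold canon
  split_ifs
  · rfl
  · exact lintegral_neg_eq_self (μ := (volume : Measure ℝ)) (fun τ => f (-u, τ))

theorem measurable_canon_zero {n : ℕ} :
    Measurable fun u : Metric.sphere (0 : E n) 1 => (canon (u, 0)).1 :=
  (measurable_canon.comp (measurable_id.prodMk measurable_const)).fst

theorem height_lipschitz {n : ℕ} (H : Hyperplane n) (x y : E n) :
    |height H x - height H y| ≤ dist x y := by
  have : height H x - height H y = inner ℝ (x - y) (normal H) := by
    rw [inner_sub_left]; unfold height; ring
  rw [this, dist_eq_norm]
  simpa [norm_normal] using abs_real_inner_le_norm (x - y) (normal H)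

theorem mem_hitting_closedBall {n : ℕ} (H : Hyperplane n) (q : E n) {ρ : ℝ} :
    H ∈ hitting (Metric.closedBall q ρ) ↔ |height H q| ≤ ρ := by
  constructor
  · rintro ⟨x, hx, hxq⟩
    rw [mem_iff_height] at hx
    have := height_lipschitz H x q
    rw [hx, zero_sub, abs_neg] at this
    exact this.trans hxq
  · intro h
    -- The foot of the perpendicular from `q`.
    refine ⟨q - height H q • normal H, ?_, ?_⟩
    · rw [mem_iff_height]
      have : inner ℝ (normal H) (normal H) = 1 := by
        rw [real_inner_self_eq_norm_sq, norm_normal, one_pow]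
      have h2 : height H (q - height H q • normal H)
          = height H q - height H q * inner ℝ (normal H) (normal H) := by
        conv_lhs => unfold height
        rw [inner_sub_left, real_inner_smul_left]; unfold height; ring
      rw [h2, this]; ring
    · simpa [Metric.mem_closedBall, dist_eq_norm, norm_smul, norm_normal] using h

end Hyperplane

open Hyperplane

/-! ### The intensity measure in coordinates -/

/-- Since the directional distribution is even, flipping `(u, τ)` shows that the two half-lines
contribute equally. The factor `2 γ` on the half-line becomes `γ` on the whole line, and the
directions are folded onto the canonical half of the sphere. All later computations use this product
form. -/
theorem HasIntensity.exists_map_param {n : ℕ} {Ω : Type*} [MeasurableSpace Ω] {P : Measure Ω}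
    {X : Ω → Measure (Hyperplane n)} {γ : ℝ} (h : HasIntensity P X γ) :
    ∃ φ : Measure (Metric.sphere (0 : E n) 1), IsProbabilityMeasure φ ∧
      (intensityMeasure P X).map param = φ.prod (ENNReal.ofReal γ • volume) := by
  obtain ⟨hγ, φ, hφ, heven, hint⟩ := h
  refine ⟨φ.map fun u => (canon (u, 0)).1,
    Measure.isProbabilityMeasure_map measurable_canon_zero.aemeasurable, ?_⟩
  refine Measure.ext_of_lintegral _ fun f hf => ?_
  have hm : Measurable fun p : Metric.sphere (0 : E n) 1 × ℝ => f (canon p) := hf.comp measurable_canon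
  rw [lintegral_map hf measurable_param, hint (fun H => f (param H)) (hf.comp measurable_param)]
  have e1 : ∀ u : Metric.sphere (0 : E n) 1, ∀ τ, f (param (mk' u τ)) = f (canon (u, τ)) :=
    fun u τ => by rw [param_mk']
  simp_rw [e1]
  have hI : Measurable fun u : Metric.sphere (0 : E n) 1 => ∫⁻ τ in Set.Ioi 0, f (canon (u, τ)) :=
    hm.lintegral_prod_right'
  have e2 : ∫⁻ u, (∫⁻ τ in Set.Iio 0, f (canon (u, τ))) ∂φ
      = ∫⁻ u, (∫⁻ τ in Set.Ioi 0, f (canon (u, τ))) ∂φ := by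
    conv_rhs => rw [← heven, lintegral_map hI continuous_neg.measurable]
    refine lintegral_congr fun u => ?_
    rw [← lintegral_indicator measurableSet_Iio, ← lintegral_indicator measurableSet_Ioi,
      ← lintegral_neg_eq_self]
    refine lintegral_congr fun τ => ?_
    simp only [Set.indicator_apply, Set.mem_Iio, Set.mem_Ioi, Left.neg_neg_iff]
    split_ifs
    · rw [← canon_neg, neg_neg]
    · rfl
  have e3 : ∀ u : Metric.sphere (0 : E n) 1, ∫⁻ τ, f (canon (u, τ))
      = (∫⁻ τ in Set.Ioi 0, f (canon (u, τ))) + ∫⁻ τ in Set.Iio 0, f (canon (u, τ)) := fun u => by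
    rw [← lintegral_add_compl _ (measurableSet_Ioi (a := (0 : ℝ))), Set.compl_Ioi,
      setLIntegral_congr Iio_ae_eq_Iic]
  have e4 : ∫⁻ u, (∫⁻ τ, f (canon (u, τ))) ∂φ
      = 2 * ∫⁻ u, (∫⁻ τ in Set.Ioi 0, f (canon (u, τ))) ∂φ := by
    simp_rw [e3]
    rw [lintegral_add_left hI, e2, two_mul]
  have hφ' : IsProbabilityMeasure (φ.map fun u => (canon (u, 0)).1) :=
    Measure.isProbabilityMeasure_map measurable_canon_zero.aemeasurable
  rw [Measure.prod_smul_right, lintegral_smul_measure, lintegral_prod _ hf.aemeasurable,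
    lintegral_map hf.lintegral_prod_right' measurable_canon_zero]
  simp_rw [← lintegral_canon]
  rw [e4, ENNReal.ofReal_mul zero_le_two, ENNReal.ofReal_ofNat, smul_eq_mul]
  ring

section
variable {n : ℕ} {Θ : Measure (Hyperplane n)} {φ : Measure (Metric.sphere (0 : E n) 1)} {γ : ℝ}

/-- For each fixed normal, `τ ↦ ⟨q, u⟩ - τ` preserves Lebesgue measure, so neither `q` nor the
directional distribution matters. -/
theorem intensity_height_preimage [IsProbabilityMeasure φ]
    (hΘ : Θ.map param = φ.prod (ENNReal.ofReal γ • volume)) (q : E n) {s : Set ℝ}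
    (hs : MeasurableSet s) :
    Θ {H | height H q ∈ s} = ENNReal.ofReal γ * volume (-s) := by
  have hmeas : MeasurableSet {p : Metric.sphere (0 : E n) 1 × ℝ | inner ℝ q (p.1 : E n) - p.2 ∈ s} :=
    (show Measurable fun p : Metric.sphere (0 : E n) 1 × ℝ => inner ℝ q (p.1 : E n) - p.2 by fun_prop) hs
  have h1 : {H | height H q ∈ s} = param ⁻¹' {p | inner ℝ q (p.1 : E n) - p.2 ∈ s} := rfl
  rw [h1, ← Measure.map_apply measurable_param hmeas, hΘ, Measure.prod_apply hmeas]
  have : ∀ u : Metric.sphere (0 : E n) 1,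
      (ENNReal.ofReal γ • (volume : Measure ℝ)) (Prod.mk u ⁻¹' {p | inner ℝ q (p.1 : E n) - p.2 ∈ s})
        = ENNReal.ofReal γ * volume (-s) := fun u => by
    have h2 : Prod.mk u ⁻¹' {p : Metric.sphere (0 : E n) 1 × ℝ | inner ℝ q (p.1 : E n) - p.2 ∈ s}
        = (fun τ => τ + -(inner ℝ q (u : E n))) ⁻¹' (-s) := by
      ext τ; simp [sub_eq_add_neg, add_comm]
    rw [Measure.smul_apply, smul_eq_mul, h2, measure_preimage_add_right]
  simp_rw [this]
  simp

theorem intensity_hitting_closedBall [IsProbabilityMeasure φ]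
    (hΘ : Θ.map param = φ.prod (ENNReal.ofReal γ • volume)) (q : E n) (ρ : ℝ) :
    Θ (hitting (Metric.closedBall q ρ)) = ENNReal.ofReal γ * ENNReal.ofReal (2 * ρ) := by
  have : hitting (Metric.closedBall q ρ) = {H | height H q ∈ Set.Icc (-ρ) ρ} := by
    ext H
    rw [mem_hitting_closedBall, abs_le]; rfl
  rw [this, intensity_height_preimage hΘ q measurableSet_Icc]
  simp only [Set.neg_Icc, neg_neg, Real.volume_Icc]
  congr 2; ring

end

/-! ### Counting tuples of atoms by product measures -/

section Atoms
variable {T : Type*} [MeasurableSpace T]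

/-- The atoms of a measure. -/
def atoms (μ : Measure T) : Set T := {t | μ {t} ≠ 0}

/-- The tuples in `D` all of whose entries are atoms. -/
def tuples {m : ℕ} (μ : Measure T) (D : Set (Fin m → T)) : Set (Fin m → T) :=
  {h | h ∈ D ∧ ∀ i, h i ∈ atoms μ}

/-- Countable sums of point masses. -/
def IsSumDirac (μ : Measure T) : Prop :=
  ∃ (ι : Type) (_ : Countable ι) (h : ι → T), μ = Measure.sum fun i => Measure.dirac (h i)

theorem sum_dirac_eq_zero {ι : Type} (h : ι → T) {A : Set T} (hA : MeasurableSet A) :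
    (Measure.sum fun i => Measure.dirac (h i)) A = 0 ↔ ∀ i, h i ∉ A := by
  rw [Measure.sum_apply_eq_zero' hA]
  refine forall_congr' fun i => ?_
  rw [Measure.dirac_apply' _ hA]
  by_cases hi : h i ∈ A <;> simp [hi]

theorem atoms_sum_dirac [MeasurableSingletonClass T] {ι : Type} (h : ι → T) :
    atoms (Measure.sum fun i => Measure.dirac (h i)) = Set.range h := by
  ext t
  rw [atoms, Set.mem_ofPred_eq, Ne, sum_dirac_eq_zero h (MeasurableSet.singleton t)]
  simp

theorem IsSumDirac.countable_atoms [MeasurableSingletonClass T] {μ : Measure T} (hμ : IsSumDirac μ) :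
    (atoms μ).Countable := by
  obtain ⟨ι, _, h, rfl⟩ := hμ
  rw [atoms_sum_dirac]
  exact Set.countable_range h

theorem IsSumDirac.eq_zero_iff [MeasurableSingletonClass T] {μ : Measure T} (hμ : IsSumDirac μ)
    {A : Set T} (hA : MeasurableSet A) : μ A = 0 ↔ ∀ t ∈ atoms μ, t ∉ A := by
  obtain ⟨ι, _, h, rfl⟩ := hμ
  rw [atoms_sum_dirac, sum_dirac_eq_zero h hA]
  simp

theorem IsSumDirac.exists_nat {μ : Measure T} (hμ : IsSumDirac μ) {A : Set T}
    (hA : MeasurableSet A) (h : μ A < ⊤) : ∃ k : ℕ, μ A = k := by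
  obtain ⟨ι, _, g, rfl⟩ := hμ
  rw [Measure.sum_apply _ hA] at h ⊢
  simp only [Measure.dirac_apply' _ hA] at h ⊢
  have : ∑' i, A.indicator (1 : T → ENNReal) (g i) = (g ⁻¹' A).encard := by
    rw [← ENNReal.tsum_set_one, tsum_subtype (g ⁻¹' A) fun _ => (1 : ENNReal)]
    rfl
  rw [this] at h ⊢
  have h' : (g ⁻¹' A).encard ≠ ⊤ := by
    intro hh
    simp [hh] at h
  lift (g ⁻¹' A).encard to ℕ using h' with k
  exact ⟨k, rfl⟩

theorem IsSumDirac.one_le [MeasurableSingletonClass T] {μ : Measure T} (hμ : IsSumDirac μ) {t : T}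
    (ht : t ∈ atoms μ) : 1 ≤ μ {t} := by
  by_cases h : μ {t} < ⊤
  · obtain ⟨k, hk⟩ := hμ.exists_nat (MeasurableSet.singleton t) h
    have h0 : μ {t} ≠ 0 := ht
    rw [hk] at h0 ⊢
    exact_mod_cast Nat.one_le_iff_ne_zero.mpr (by exact_mod_cast h0)
  · simp [not_lt_top_iff.mp h]

theorem IsSumDirac.measure_compl_atoms [MeasurableSingletonClass T] {μ : Measure T}
    (hμ : IsSumDirac μ) : μ (atoms μ)ᶜ = 0 := by
  rw [hμ.eq_zero_iff hμ.countable_atoms.measurableSet.compl]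
  simp

/-- The non-atoms are a null set in each coordinate, so only the countably many tuples of atoms
carry mass. The restrictions to sets of finite measure keep the product measure well behaved. -/
theorem pi_restrict_eq_tsum [MeasurableSingletonClass T] {μ : Measure T} (hμ : IsSumDirac μ)
    {m : ℕ} {U : Fin m → Set T} (hfin : ∀ i, μ (U i) < ⊤)
    {D : Set (Fin m → T)} (hDU : D ⊆ Set.univ.pi U) :
    Measure.pi (fun i => μ.restrict (U i)) D = ∑' h : tuples μ D, ∏ i, μ {h.1 i} := by
  have hf : ∀ i, IsFiniteMeasure (μ.restrict (U i)) := fun i => ⟨by simpa using hfin i⟩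
  have hc : (tuples μ D).Countable :=
    (Set.countable_univ_pi (fun _ : Fin m => hμ.countable_atoms)).mono fun _ hh => Set.mem_univ_pi.mpr hh.2
  have h1 : Measure.pi (fun i => μ.restrict (U i)) D
      = Measure.pi (fun i => μ.restrict (U i)) (tuples μ D) := by
    refine le_antisymm ?_ (measure_mono fun h hh => hh.1)
    have : D ⊆ tuples μ D ∪ ⋃ i, Function.eval i ⁻¹' (atoms μ)ᶜ := by
      intro h hh
      by_cases hat : ∀ i, h i ∈ atoms μ
      · exact Or.inl ⟨hh, hat⟩
      · push Not at hat
        exact Or.inr (Set.mem_iUnion.mpr hat)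
    refine (measure_mono this).trans ((measure_union_le _ _).trans ?_)
    rw [measure_iUnion_null fun i => Measure.pi_eval_preimage_null _ ?_, add_zero]
    exact le_antisymm ((Measure.restrict_apply_le _ _).trans hμ.measure_compl_atoms.le) zero_le
  rw [h1]
  have h2 : tuples μ D = ⋃ h ∈ tuples μ D, {h} := by simp
  conv_lhs => rw [h2]
  rw [measure_biUnion hc]
  · refine tsum_congr fun h => ?_
    rw [Measure.pi_singleton]
    refine Finset.prod_congr rfl fun i _ => ?_
    rw [Measure.restrict_apply (MeasurableSet.singleton _), Set.inter_eq_left.mpr]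
    simpa using hDU h.2.1 i (Set.mem_univ i)
  · intro a _ b _ hab
    simpa [Function.onFun] using hab
  · intro h _
    exact MeasurableSet.singleton h

/-- Each atom has mass at least one, so multiplicities can only enlarge the product measure. The
reverse inequality, `pi_le_encard_tuples`, needs simplicity. -/
theorem encard_tuples_le_pi [MeasurableSingletonClass T] {μ : Measure T} (hμ : IsSumDirac μ)
    {m : ℕ} {U : Fin m → Set T} (hfin : ∀ i, μ (U i) < ⊤)
    {D : Set (Fin m → T)} (hDU : D ⊆ Set.univ.pi U) :
    ((tuples μ D).encard : ENNReal) ≤ Measure.pi (fun i => μ.restrict (U i)) D := by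
  rw [pi_restrict_eq_tsum hμ hfin hDU, ← ENNReal.tsum_set_one]
  exact ENNReal.tsum_le_tsum fun h => Finset.one_le_prod' fun i _ => hμ.one_le (h.2.2 i)

theorem pi_le_encard_tuples [MeasurableSingletonClass T] {μ : Measure T} (hμ : IsSumDirac μ)
    (hs : ∀ t, μ {t} ≤ 1)
    {m : ℕ} {U : Fin m → Set T} (hfin : ∀ i, μ (U i) < ⊤)
    {D : Set (Fin m → T)} (hDU : D ⊆ Set.univ.pi U) :
    Measure.pi (fun i => μ.restrict (U i)) D ≤ ((tuples μ D).encard : ENNReal) := by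
  rw [pi_restrict_eq_tsum hμ hfin hDU, ← ENNReal.tsum_set_one]
  exact ENNReal.tsum_le_tsum fun h => Finset.prod_le_one' fun i _ => hs _

theorem tsum_encard_of_partition {α : Type*} {s : Set α} {t : ℕ → Set α} (h : s = ⋃ c, t c)
    (hd : Pairwise (Function.onFun Disjoint t)) :
    ∑' c, ((t c).encard : ENNReal) = s.encard := by
  subst h
  simp_rw [← ENNReal.tsum_set_one]
  exact (ENNReal.tsum_biUnion (f := fun _ => 1) (fun a _ b _ hab => hd hab)).symm

theorem ENNReal_tsum_pi {m : ℕ} (g : Fin m → ℕ → ENNReal) :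
    ∑' k : Fin m → ℕ, ∏ i, g i (k i) = ∏ i, ∑' j, g i j := by
  induction m with
  | zero => simp [tsum_fintype]
  | succ m ih =>
    rw [← (Fin.consEquiv fun _ => ℕ).tsum_eq, ENNReal.tsum_prod', Fin.prod_univ_succ, ← ih,
      ← ENNReal.tsum_mul_right]
    refine tsum_congr fun j => ?_
    rw [← ENNReal.tsum_mul_left]
    refine tsum_congr fun k => ?_
    simp [Fin.consEquiv, Fin.prod_univ_succ]

theorem tsum_poisson_mean {θ : ℝ} (hθ : 0 ≤ θ) :
    ∑' k : ℕ, (k : ENNReal) * ENNReal.ofReal (θ ^ k / (k.factorial : ℝ) * Real.exp (-θ))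
      = ENNReal.ofReal θ := by
  rw [tsum_eq_zero_add' ENNReal.summable]
  simp only [Nat.cast_zero, zero_mul, zero_add]
  have : ∀ k : ℕ, ((k + 1 : ℕ) : ENNReal) *
      ENNReal.ofReal (θ ^ (k + 1) / ((k + 1).factorial : ℝ) * Real.exp (-θ))
      = ENNReal.ofReal ((θ * Real.exp (-θ)) * (θ ^ k / (k.factorial : ℝ))) := fun k => by
    rw [← ENNReal.ofReal_natCast, ← ENNReal.ofReal_mul (by positivity)]
    congr 1
    rw [Nat.factorial_succ]
    push_cast
    field_simp
    ring
  simp_rw [this]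
  have hs := (NormedSpace.expSeries_div_hasSum_exp (𝔸 := ℝ) θ).mul_left (θ * Real.exp (-θ))
  rw [← ENNReal.ofReal_tsum_of_nonneg (fun k => by positivity) hs.summable, hs.tsum_eq,
    ← Real.exp_eq_exp_ℝ, mul_assoc, ← Real.exp_add]
  simp

end Atoms

/-! ### Moment formulas and simplicity for Poisson processes -/

section Poisson
variable {Ω T : Type*} [MeasurableSpace Ω] [MeasurableSpace T]

/-- A Poisson process `Y` with intensity measure `Λ` that is finite on the sets of the countable
cover `S`. -/
structure IsPoissonProcess (P : Measure Ω) (Y : Ω → Measure T) (Λ : Measure T) (S : ℕ → Set T) :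
    Prop where
  measurable : Measurable Y
  counting : ∀ ω, IsSumDirac (Y ω)
  joint : ∀ (k : ℕ) (A : Fin k → Set T) (m : Fin k → ℕ), (∀ i, MeasurableSet (A i)) →
    Pairwise (fun i j => Disjoint (A i) (A j)) → (∀ i, Λ (A i) < ⊤) →
    P {ω | ∀ i, Y ω (A i) = (m i : ENNReal)} =
      ∏ i, ENNReal.ofReal ((Λ (A i)).toReal ^ m i / (Nat.factorial (m i) : ℝ) *
        Real.exp (-(Λ (A i)).toReal))
  cover : ⋃ k, S k = Set.univ
  measurableSet : ∀ k, MeasurableSet (S k)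
  finite : ∀ ω k, Y ω (S k) < ⊤
  finite_intensity : ∀ k, Λ (S k) < ⊤

variable {P : Measure Ω} {Y : Ω → Measure T} {Λ : Measure T} {S : ℕ → Set T}

theorem IsPoissonProcess.sigmaFinite (hY : IsPoissonProcess P Y Λ S) : SigmaFinite Λ :=
  ⟨⟨⟨S, fun _ => trivial, hY.finite_intensity, hY.cover⟩⟩⟩

theorem IsPoissonProcess.measurable_apply (hY : IsPoissonProcess P Y Λ S) {A : Set T}
    (hA : MeasurableSet A) : Measurable fun ω => Y ω A :=
  (Measure.measurable_coe hA).comp hY.measurable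

theorem IsPoissonProcess.prob_eq (hY : IsPoissonProcess P Y Λ S) {A : Set T}
    (hA : MeasurableSet A) (hfin : Λ A < ⊤) (k : ℕ) :
    P {ω | Y ω A = k} = ENNReal.ofReal ((Λ A).toReal ^ k / (k.factorial : ℝ) * Real.exp (-(Λ A).toReal)) := by
  have := hY.joint 1 (fun _ => A) (fun _ => k) (fun _ => hA)
    (fun i j hij => (hij (Subsingleton.elim i j)).elim) (fun _ => hfin)
  simpa using this

/-- The void event is split according to the values of the counts `Y (A i)`. On each part the joint
law is a product of Poisson weights, and the sum over the values is a product of Poisson means. -/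
theorem IsPoissonProcess.lintegral_prod (hY : IsPoissonProcess P Y Λ S) {m : ℕ}
    {A : Fin m → Set T} (hA : ∀ i, MeasurableSet (A i)) (hd : Pairwise fun i j => Disjoint (A i) (A j))
    (hAfin : ∀ i, Λ (A i) < ⊤) (hYfin : ∀ ω i, Y ω (A i) < ⊤) {V : Set T} (hV : MeasurableSet V)
    (hVfin : Λ V < ⊤) (hVA : ∀ i, Disjoint V (A i)) :
    ∫⁻ ω in {ω | Y ω V = 0}, ∏ i, Y ω (A i) ∂P
      = ENNReal.ofReal (Real.exp (-(Λ V).toReal)) * ∏ i, Λ (A i) := by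
  set F : (Fin m → ℕ) → Set Ω := fun k => {ω | Y ω V = 0 ∧ ∀ i, Y ω (A i) = k i} with hF
  have hFm : ∀ k, MeasurableSet (F k) := fun k => by
    have : F k = {ω | Y ω V = 0} ∩ ⋂ i, {ω | Y ω (A i) = k i} := by ext; simp [hF]
    rw [this]
    exact (hY.measurable_apply hV (measurableSet_singleton _)).inter
      (MeasurableSet.iInter fun i => hY.measurable_apply (hA i) (measurableSet_singleton _))
  have hFU : {ω | Y ω V = 0} = ⋃ k, F k := by
    ext ω
    simp only [Set.mem_ofPred_eq, Set.mem_iUnion, hF]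
    constructor
    · intro h
      choose k hk using fun i => (hY.counting ω).exists_nat (hA i) (hYfin ω i)
      exact ⟨k, h, hk⟩
    · rintro ⟨k, h, _⟩; exact h
  have hFd : Pairwise (Function.onFun Disjoint F) := by
    intro k k' hkk
    refine Set.disjoint_left.mpr fun ω h h' => hkk ?_
    funext i
    have := (h.2 i).symm.trans (h'.2 i)
    exact_mod_cast this
  have hP : ∀ k, P (F k) = ENNReal.ofReal (Real.exp (-(Λ V).toReal)) * ∏ i, ENNReal.ofReal
      ((Λ (A i)).toReal ^ k i / ((k i).factorial : ℝ) * Real.exp (-(Λ (A i)).toReal)) := fun k => by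
    -- The void set enters the joint law as one more disjoint set, with count `0`.
    have := hY.joint (m + 1) (Fin.cons V A) (Fin.cons 0 k)
      (fun i => by refine Fin.cases ?_ (fun i => ?_) i <;> simp [hV, hA])
      (fun i j => by
        refine Fin.cases ?_ (fun i => ?_) i <;> refine Fin.cases ?_ (fun j => ?_) j
        · simp
        · intro _; simpa using hVA j
        · intro _; simpa using (hVA i).symm
        · intro hij; simpa using hd fun h => hij (congrArg _ h))
      (fun i => by refine Fin.cases ?_ (fun i => ?_) i <;> simp [hVfin, hAfin])
    rw [Fin.prod_univ_succ] at this
    simpa [Fin.forall_fin_succ, hF] using this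
  rw [hFU, lintegral_iUnion hFm hFd]
  have hc : ∀ k, ∫⁻ ω in F k, ∏ i, Y ω (A i) ∂P
      = ENNReal.ofReal (Real.exp (-(Λ V).toReal)) * ∏ i, ((k i : ENNReal) * ENNReal.ofReal
      ((Λ (A i)).toReal ^ k i / ((k i).factorial : ℝ) * Real.exp (-(Λ (A i)).toReal))) := fun k => by
    rw [setLIntegral_congr_fun (g := fun _ => ∏ i, (k i : ENNReal)) (hFm k)
      (fun ω hω => Finset.prod_congr rfl fun i _ => hω.2 i), setLIntegral_const, hP,
      Finset.prod_mul_distrib]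
    ring
  simp_rw [hc]
  rw [ENNReal.tsum_mul_left, ENNReal_tsum_pi fun i (k : ℕ) => (k : ENNReal) * ENNReal.ofReal
      ((Λ (A i)).toReal ^ k / (k.factorial : ℝ) * Real.exp (-(Λ (A i)).toReal))]
  congr 1
  refine Finset.prod_congr rfl fun i _ => ?_
  rw [tsum_poisson_mean ENNReal.toReal_nonneg, ENNReal.ofReal_toReal (hAfin i).ne]

theorem IsPoissonProcess.measurable_pi (hY : IsPoissonProcess P Y Λ S) {m : ℕ} {U : Fin m → Set T}
    (hU : ∀ i, MeasurableSet (U i)) (hYfin : ∀ ω i, Y ω (U i) < ⊤) :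
    Measurable fun ω => Measure.pi fun i => (Y ω).restrict (U i) := by
  have hf : ∀ ω i, IsFiniteMeasure ((Y ω).restrict (U i)) := fun ω i => ⟨by simpa using hYfin ω i⟩
  have hb : ∀ s : Fin m → Set T, (∀ i, MeasurableSet (s i)) →
      Measurable fun ω => Measure.pi (fun i => (Y ω).restrict (U i)) (Set.univ.pi s) := fun s hs => by
    simp_rw [Measure.pi_pi]
    refine Finset.measurable_prod _ fun i _ => ?_
    simp_rw [Measure.restrict_apply (hs i)]
    exact hY.measurable_apply ((hs i).inter (hU i))
  refine Measurable.measure_of_isPiSystem generateFrom_pi.symm isPiSystem_pi ?_ ?_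
  · rintro _ ⟨s, hs, rfl⟩
    exact hb s fun i => hs i trivial
  · simpa using hb (fun _ => Set.univ) fun _ => MeasurableSet.univ

/-- After division by the void probability, the left side is a measure in `D` that agrees with the
product of the restricted intensities on rectangles, by `lintegral_prod`; such a measure is the
product measure. -/
theorem IsPoissonProcess.setLIntegral_pi (hY : IsPoissonProcess P Y Λ S) {m : ℕ}
    {U : Fin m → Set T} (hU : ∀ i, MeasurableSet (U i)) (hd : Pairwise fun i j => Disjoint (U i) (U j))
    (hUfin : ∀ i, Λ (U i) < ⊤) (hYfin : ∀ ω i, Y ω (U i) < ⊤) {V : Set T} (hV : MeasurableSet V)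
    (hVfin : Λ V < ⊤) (hVU : ∀ i, Disjoint V (U i)) {D : Set (Fin m → T)} (hD : MeasurableSet D)
    (hDU : D ⊆ Set.univ.pi U) :
    ∫⁻ ω in {ω | Y ω V = 0}, Measure.pi (fun i => (Y ω).restrict (U i)) D ∂P
      = ENNReal.ofReal (Real.exp (-(Λ V).toReal)) * Measure.pi (fun _ => Λ) D := by
  have := hY.sigmaFinite
  have hf : ∀ i, IsFiniteMeasure (Λ.restrict (U i)) := fun i => ⟨by simpa using hUfin i⟩
  have hf' : ∀ ω i, IsFiniteMeasure ((Y ω).restrict (U i)) := fun ω i => ⟨by simpa using hYfin ω i⟩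
  set e := ENNReal.ofReal (Real.exp (-(Λ V).toReal)) with he
  have he0 : e ≠ 0 := by rw [he]; simp [Real.exp_pos]
  have het : e ≠ ⊤ := ENNReal.ofReal_ne_top
  have hκ := hY.measurable_pi hU hYfin
  have key : Measure.pi (fun i => Λ.restrict (U i))
      = e⁻¹ • (P.restrict {ω | Y ω V = 0}).bind fun ω => Measure.pi fun i => (Y ω).restrict (U i) := by
    refine Measure.pi_eq fun s hs => ?_
    rw [Measure.smul_apply, Measure.bind_apply (MeasurableSet.univ_pi hs) hκ.aemeasurable]
    simp_rw [Measure.pi_pi, Measure.restrict_apply (hs _)]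
    rw [hY.lintegral_prod (fun i => (hs i).inter (hU i))
      (fun i j hij => (hd hij).mono Set.inter_subset_right Set.inter_subset_right)
      (fun i => (measure_mono Set.inter_subset_right).trans_lt (hUfin i))
      (fun ω i => (measure_mono Set.inter_subset_right).trans_lt (hYfin ω i)) hV hVfin
      (fun i => (hVU i).mono_right Set.inter_subset_right), smul_eq_mul, ← mul_assoc,
      ENNReal.inv_mul_cancel he0 het, one_mul]
  have h2 := congrArg (fun μ => μ D) key
  rw [← Measure.restrict_pi_pi, Measure.restrict_apply hD, Set.inter_eq_left.mpr hDU,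
    Measure.smul_apply, Measure.bind_apply hD hκ.aemeasurable, smul_eq_mul] at h2
  rw [h2, ← mul_assoc, ENNReal.mul_inv_cancel he0 het, one_mul]

/-- The moment formula for rectangles needs disjoint sides. Coding the points of `T` by binary
sequences, an injective tuple is separated by prefixes of some finite length, so countably many
boxes with disjoint sides cover all injective tuples that avoid `V`. -/
theorem IsPoissonProcess.exists_boxes [MeasurableSpace.CountablySeparated T]
    (hY : IsPoissonProcess P Y Λ S) (m : ℕ) {V : Set T} (hV : MeasurableSet V) :
    ∃ U : ℕ → Fin m → Set T, (∀ c i, MeasurableSet (U c i)) ∧ (∀ c i, ∃ k, U c i ⊆ S k) ∧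
      (∀ c i, Disjoint V (U c i)) ∧ (∀ c, Pairwise fun i j => Disjoint (U c i) (U c j)) ∧
      ∀ h : Fin m → T, Function.Injective h → (∀ i, h i ∉ V) → ∃ c, h ∈ Set.univ.pi (U c) := by
  obtain ⟨f, hf, hfi⟩ := MeasurableSpace.measurable_injection_nat_bool_of_countablySeparated T
  -- An index is a prefix length, distinct prefixes for the entries, and a member of the cover for
  -- each entry. The summand `Unit` stands for the empty box and guarantees that there is an index
  -- at all.
  let J := Σ L : ℕ, ({p : Fin m → Fin L → Bool // Function.Injective p} ⊕ Unit) × (Fin m → ℕ)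
  let W : J → Fin m → Set T := fun c i => match c with
    | ⟨L, Sum.inl p, k⟩ => {t | t ∈ S (k i) ∧ t ∉ V ∧ ∀ l : Fin L, f t l = p.1 i l}
    | ⟨_, Sum.inr _, _⟩ => ∅
  have : Nonempty J := ⟨⟨0, Sum.inr (), fun _ => 0⟩⟩
  obtain ⟨e, he⟩ := exists_surjective_nat J
  refine ⟨fun c => W (e c), fun c i => ?_, fun c i => ?_, fun c i => ?_, fun c i j hij => ?_, ?_⟩
  · dsimp only
    rcases e c with ⟨L, p | _, k⟩
    · have : W ⟨L, Sum.inl p, k⟩ i = S (k i) ∩ (Vᶜ ∩ ⋂ l : Fin L, {t | f t l = p.1 i l}) := by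
        ext t; simp [W]; tauto
      rw [this]
      refine (hY.measurableSet _).inter (hV.compl.inter (MeasurableSet.iInter fun l => ?_))
      exact ((measurable_pi_apply (l : ℕ)).comp hf) (measurableSet_singleton _)
    · exact MeasurableSet.empty
  · dsimp only
    rcases e c with ⟨L, p | _, k⟩
    · exact ⟨k i, fun t ht => ht.1⟩
    · exact ⟨0, Set.empty_subset _⟩
  · dsimp only
    rcases e c with ⟨L, p | _, k⟩
    · exact Set.disjoint_left.mpr fun t ht ht' => ht'.2.1 ht
    · exact Set.disjoint_empty _
  · dsimp only
    rcases e c with ⟨L, p | _, k⟩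
    · refine Set.disjoint_left.mpr fun t ht ht' => hij (p.2 ?_)
      funext l
      exact (ht.2.2 l).symm.trans (ht'.2.2 l)
    · exact Set.disjoint_empty _
  · intro h hh hhV
    have hL : ∃ L : ℕ, Function.Injective fun i (l : Fin L) => f (h i) l := by
      have : ∀ p : Fin m × Fin m, ∃ l : ℕ, p.1 ≠ p.2 → f (h p.1) l ≠ f (h p.2) l := fun p => by
        by_cases hp : p.1 = p.2
        · exact ⟨0, fun h => (h hp).elim⟩
        · have : f (h p.1) ≠ f (h p.2) := fun hq => hp (hh (hfi hq))
          obtain ⟨l, hl⟩ := Function.ne_iff.mp this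
          exact ⟨l, fun _ => hl⟩
      choose l hl using this
      refine ⟨(Finset.univ.sup l) + 1, fun i j hij => ?_⟩
      by_contra hne
      exact hl (i, j) hne (congrFun hij
        ⟨l (i, j), Nat.lt_succ_of_le (Finset.le_sup (f := l) (Finset.mem_univ (i, j)))⟩)
    obtain ⟨L, hL⟩ := hL
    have hk : ∀ i, ∃ k, h i ∈ S k := fun i => by
      have : h i ∈ ⋃ k, S k := by rw [hY.cover]; trivial
      simpa using this
    choose k hk using hk
    obtain ⟨c, hc⟩ := he ⟨L, Sum.inl ⟨_, hL⟩, k⟩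
    refine ⟨c, fun i _ => ?_⟩
    dsimp only
    rw [hc]
    exact ⟨hk i, hhV i, fun l => rfl⟩

/-- Factorial moment measures of a Poisson process on the event that a given set is void. -/
theorem IsPoissonProcess.exists_tuple_count [MeasurableSpace.CountablySeparated T]
    (hY : IsPoissonProcess P Y Λ S) {m : ℕ} {D : Set (Fin m → T)} (hD : MeasurableSet D)
    (hinj : ∀ h ∈ D, Function.Injective h) {V : Set T} (hV : MeasurableSet V) (hVfin : Λ V < ⊤)
    (hDV : ∀ h ∈ D, ∀ i, h i ∉ V) :
    ∃ F : Ω → ENNReal, Measurable F ∧ (∀ ω, ((tuples (Y ω) D).encard : ENNReal) ≤ F ω) ∧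
      (∀ ω, (∀ t, Y ω {t} ≤ 1) → F ω ≤ (tuples (Y ω) D).encard) ∧
      ∫⁻ ω in {ω | Y ω V = 0}, F ω ∂P
        = ENNReal.ofReal (Real.exp (-(Λ V).toReal)) * Measure.pi (fun _ => Λ) D := by
  have := hY.sigmaFinite
  have := MeasurableSpace.measurableSingletonClass_of_countablySeparated (α := T)
  obtain ⟨U, hU, hUS, hUV, hUd, hUc⟩ := hY.exists_boxes m hV
  have hUfin : ∀ c i, Λ (U c i) < ⊤ := fun c i => by
    obtain ⟨k, hk⟩ := hUS c i
    exact (measure_mono hk).trans_lt (hY.finite_intensity k)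
  have hYfin : ∀ c ω i, Y ω (U c i) < ⊤ := fun c ω i => by
    obtain ⟨k, hk⟩ := hUS c i
    exact (measure_mono hk).trans_lt (hY.finite ω k)
  -- Disjoint pieces of `D`, each inside one box, so that both the counts and the product measures
  -- add up. The sum of the product measures over the pieces is the measurable function `F`; it
  -- counts tuples with multiplicity.
  set G : ℕ → Set (Fin m → T) := fun c => D ∩ disjointed (fun c => Set.univ.pi (U c)) c with hG
  have hGm : ∀ c, MeasurableSet (G c) := fun c =>
    hD.inter (MeasurableSet.disjointed (fun c => MeasurableSet.univ_pi (hU c)) c)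
  have hGU : ∀ c, G c ⊆ Set.univ.pi (U c) := fun c =>
    Set.inter_subset_right.trans (disjointed_subset _ c)
  have hGd : Pairwise (Function.onFun Disjoint G) := fun c c' hcc =>
    (disjoint_disjointed _ hcc).mono Set.inter_subset_right Set.inter_subset_right
  have hGD : D = ⋃ c, G c := by
    rw [hG, ← Set.inter_iUnion, iUnion_disjointed, eq_comm, Set.inter_eq_left]
    intro h hh
    simpa using hUc h (hinj h hh) (hDV h hh)
  have hcount : ∀ ω, ∑' c, ((tuples (Y ω) (G c)).encard : ENNReal) = (tuples (Y ω) D).encard := fun ω => by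
    refine tsum_encard_of_partition ?_ fun c c' hcc => (hGd hcc).mono (fun h hh => hh.1) fun h hh => hh.1
    conv_lhs => rw [hGD]
    ext h
    simp [tuples]
  have hκ : ∀ c, Measurable fun ω => Measure.pi (fun i => (Y ω).restrict (U c i)) (G c) := fun c =>
    (Measure.measurable_coe (hGm c)).comp (hY.measurable_pi (hU c) (hYfin c))
  refine ⟨fun ω => ∑' c, Measure.pi (fun i => (Y ω).restrict (U c i)) (G c),
    Measurable.tsum hκ, ?_, ?_, ?_⟩
  · intro ω
    rw [← hcount]
    exact ENNReal.tsum_le_tsum fun c => encard_tuples_le_pi (hY.counting ω) (hYfin c ω) (hGU c)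
  · intro ω hs
    rw [← hcount]
    exact ENNReal.tsum_le_tsum fun c => pi_le_encard_tuples (hY.counting ω) hs (hYfin c ω) (hGU c)
  · dsimp only
    rw [lintegral_tsum fun c => (hκ c).aemeasurable]
    simp_rw [fun c => hY.setLIntegral_pi (hU c) (hUd c) (hUfin c) (hYfin c) hV hVfin (hUV c) (hGm c) (hGU c)]
    rw [ENNReal.tsum_mul_left, ← measure_iUnion hGd hGm, ← hGD]

/-- The mean number of such tuples is the product measure, here zero; the void set is empty. All
general position statements come from this. -/
theorem IsPoissonProcess.ae_tuples_eq_empty [MeasurableSpace.CountablySeparated T]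
    (hY : IsPoissonProcess P Y Λ S) {m : ℕ} {D : Set (Fin m → T)} (hD : MeasurableSet D)
    (hinj : ∀ h ∈ D, Function.Injective h) (hnull : Measure.pi (fun _ => Λ) D = 0) :
    ∀ᵐ ω ∂P, tuples (Y ω) D = ∅ := by
  obtain ⟨F, hF, hle, -, hint⟩ := hY.exists_tuple_count hD hinj MeasurableSet.empty (by simp)
    (fun _ _ _ => id)
  rw [hnull, mul_zero] at hint
  simp only [measure_empty, Set.ofPred_true, Measure.restrict_univ] at hint
  rw [lintegral_eq_zero_iff hF] at hint
  filter_upwards [hint] with ω hω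
  have := hle ω
  rw [hω] at this
  simpa using this

theorem IsPoissonProcess.prob_two_le [IsProbabilityMeasure P] (hY : IsPoissonProcess P Y Λ S)
    {A : Set T} (hA : MeasurableSet A) (hfin : Λ A < ⊤) :
    P {ω | 2 ≤ Y ω A} ≤ Λ A ^ 2 := by
  set θ := (Λ A).toReal with hθ
  have hθ0 : 0 ≤ θ := ENNReal.toReal_nonneg
  have hsub : {ω | 2 ≤ Y ω A} ⊆ ({ω | Y ω A = (0 : ℕ)} ∪ {ω | Y ω A = (1 : ℕ)})ᶜ := by
    intro ω h h'
    rcases h' with h' | h' <;> simp only [Set.mem_ofPred_eq] at h h' <;> rw [h'] at h <;>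
      norm_num at h
  have hm : ∀ k : ℕ, MeasurableSet {ω | Y ω A = (k : ENNReal)} := fun k =>
    hY.measurable_apply hA (measurableSet_singleton _)
  refine (measure_mono hsub).trans ?_
  rw [prob_compl_eq_one_sub ((hm 0).union (hm 1)), measure_union ?_ (hm 1), hY.prob_eq hA hfin,
    hY.prob_eq hA hfin]
  · have : Λ A ^ 2 = ENNReal.ofReal (θ ^ 2) := by
      rw [ENNReal.ofReal_pow hθ0, ENNReal.ofReal_toReal hfin.ne]
    rw [this, ← ENNReal.ofReal_add (by positivity) (by positivity), ← ENNReal.ofReal_one,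
      ← ENNReal.ofReal_sub _ (by positivity)]
    refine ENNReal.ofReal_le_ofReal ?_
    simp only [pow_zero, pow_one, Nat.factorial_zero, Nat.factorial_one, Nat.cast_one, div_one, one_mul]
    -- The probability of at least two points is at most `1 - (1 + θ) e^{-θ}`, and `e^{-θ} ≥ 1 - θ`
    -- bounds this by `θ²`.
    have := Real.add_one_le_exp (-θ)
    nlinarith
  · refine Set.disjoint_left.mpr fun ω h h' => ?_
    simp only [Set.mem_ofPred_eq] at h h'
    rw [h] at h'
    norm_num at h'

/-- A Poisson process whose intensity can be cut into small pieces has no multiple points. -/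
theorem IsPoissonProcess.ae_simple [MeasurableSingletonClass T] [IsProbabilityMeasure P]
    (hY : IsPoissonProcess P Y Λ S)
    (hdiff : ∀ k, ∃ C : ENNReal, C < ⊤ ∧ ∀ M : ℕ, ∃ A : Fin (M + 1) → Set T,
      (∀ i, MeasurableSet (A i)) ∧ S k ⊆ ⋃ i, A i ∧ ∀ i, Λ (A i) ≤ C / (M + 1 : ℕ)) :
    ∀ᵐ ω ∂P, ∀ t, Y ω {t} ≤ 1 := by
  have key : ∀ k, ∀ᵐ ω ∂P, ∀ t ∈ S k, Y ω {t} ≤ 1 := by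
    intro k
    obtain ⟨C, hC, hA⟩ := hdiff k
    rw [ae_iff]
    -- A multiple point puts two points into one of `M + 1` pieces, each with probability at most
    -- `(C / (M + 1))²`.
    have hbound : ∀ M : ℕ, P {ω | ¬ ∀ t ∈ S k, Y ω {t} ≤ 1} ≤ C ^ 2 / (M + 1 : ℕ) := by
      intro M
      obtain ⟨A, hAm, hAc, hAΛ⟩ := hA M
      have hsub : {ω | ¬ ∀ t ∈ S k, Y ω {t} ≤ 1} ⊆ ⋃ i, {ω | 2 ≤ Y ω (A i)} := by
        intro ω hω
        simp only [Set.mem_ofPred_eq, not_forall, not_le] at hω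
        obtain ⟨t, htk, ht⟩ := hω
        obtain ⟨i, hi⟩ := Set.mem_iUnion.mp (hAc htk)
        refine Set.mem_iUnion.mpr ⟨i, ?_⟩
        have h1 : Y ω {t} ≤ Y ω (A i) := measure_mono (Set.singleton_subset_iff.mpr hi)
        obtain ⟨j, hj⟩ := (hY.counting ω).exists_nat (MeasurableSet.singleton t)
          ((measure_mono (Set.singleton_subset_iff.mpr htk)).trans_lt (hY.finite ω k))
        rw [hj] at ht h1
        refine le_trans ?_ h1
        have : 1 < j := by exact_mod_cast ht
        exact_mod_cast this
      refine (measure_mono hsub).trans ((measure_iUnion_fintype_le _ _).trans ?_)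
      have hfin : ∀ i, Λ (A i) < ⊤ := fun i => (hAΛ i).trans_lt
        (ENNReal.div_lt_top hC.ne (by simp))
      calc ∑ i, P {ω | 2 ≤ Y ω (A i)} ≤ ∑ _i : Fin (M + 1), (C / (M + 1 : ℕ)) ^ 2 :=
            Finset.sum_le_sum fun i _ => (hY.prob_two_le (hAm i) (hfin i)).trans (by gcongr; exact hAΛ i)
        _ = C ^ 2 / (M + 1 : ℕ) := by
            rw [Finset.sum_const, Finset.card_univ, Fintype.card_fin, nsmul_eq_mul, ENNReal.div_eq_inv_mul,
              mul_pow, ENNReal.div_eq_inv_mul, ← mul_assoc, pow_two, ← mul_assoc,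
              ENNReal.mul_inv_cancel (by simp) (by simp), one_mul]
    have hlim : Tendsto (fun M : ℕ => C ^ 2 / ((M + 1 : ℕ) : ENNReal)) atTop (𝓝 0) := by
      have := (ENNReal.tendsto_inv_nat_nhds_zero.comp (tendsto_add_atTop_nat 1))
      have := ENNReal.Tendsto.const_mul (a := C ^ 2) this (Or.inr (ENNReal.pow_ne_top hC.ne))
      simpa [div_eq_mul_inv] using this
    exact le_antisymm (ge_of_tendsto' hlim hbound) zero_le
  filter_upwards [ae_all_iff.mpr key] with ω hω t
  have : t ∈ ⋃ k, S k := by rw [hY.cover]; trivial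
  obtain ⟨k, hk⟩ := Set.mem_iUnion.mp this
  exact hω k t hk

end Poisson

/-! ### Deterministic geometry of hyperplane arrangements -/

section Arrangement
variable {n : ℕ}

theorem height_add (H : Hyperplane n) (x d : E n) :
    height H (x + d) = height H x + inner ℝ d (normal H) := by
  unfold height; rw [inner_add_left]; ring

theorem continuous_height (H : Hyperplane n) : Continuous (height H) := by
  unfold height; fun_prop

/-- The union of a set of hyperplanes. -/
def unionOf (A : Set (Hyperplane n)) : Set (E n) := ⋃ H ∈ A, H.1

theorem mem_unionOf {A : Set (Hyperplane n)} {x : E n} :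
    x ∈ unionOf A ↔ ∃ H ∈ A, height H x = 0 := by
  simp [unionOf, mem_iff_height]

theorem skeleton_eq (μ : Measure (Hyperplane n)) : skeleton μ = unionOf (atoms μ) := rfl

/-- The points strictly on the same side as `x₀` of each hyperplane of `A`. -/
def openCell (A : Set (Hyperplane n)) (x₀ : E n) : Set (E n) :=
  {y | ∀ H ∈ A, 0 < height H x₀ * height H y}

/-- The points weakly on the same side as `x₀` of each hyperplane of `A`. -/
def closedCell (A : Set (Hyperplane n)) (x₀ : E n) : Set (E n) :=
  {y | ∀ H ∈ A, 0 ≤ height H x₀ * height H y}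

theorem height_lineMap (H : Hyperplane n) (x y : E n) (t : ℝ) :
    height H (x + t • (y - x)) = (1 - t) * height H x + t * height H y := by
  unfold height
  rw [inner_add_left, real_inner_smul_left, inner_sub_left]
  ring

theorem height_combo (H : Hyperplane n) (x y : E n) {a b : ℝ} (h : a + b = 1) :
    height H (a • x + b • y) = a * height H x + b * height H y := by
  unfold height
  rw [inner_add_left, real_inner_smul_left, real_inner_smul_left]
  linear_combination (param H).2 * h

theorem convex_openCell (A : Set (Hyperplane n)) (x₀ : E n) : Convex ℝ (openCell A x₀) := by
  intro y hy z hz a b ha hb hab H hH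
  rw [height_combo H y z hab, mul_add]
  have h1 := hy H hH
  have h2 := hz H hH
  rcases ha.eq_or_lt with rfl | ha'
  · have : b = 1 := by linarith
    subst this; linarith
  · nlinarith [mul_pos ha' h1, mul_nonneg hb h2.le]

theorem convex_closedCell (A : Set (Hyperplane n)) (x₀ : E n) : Convex ℝ (closedCell A x₀) := by
  intro y hy z hz a b ha hb hab H hH
  rw [height_combo H y z hab, mul_add]
  have h1 := hy H hH
  have h2 := hz H hH
  nlinarith [mul_nonneg ha h1, mul_nonneg hb h2]

theorem isClosed_closedCell (A : Set (Hyperplane n)) (x₀ : E n) : IsClosed (closedCell A x₀) := by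
  have : closedCell A x₀ = ⋂ H ∈ A, {y | 0 ≤ height H x₀ * height H y} := by
    ext; simp [closedCell]
  rw [this]
  exact isClosed_biInter fun H _ => isClosed_le continuous_const ((continuous_height H).const_mul _)

theorem mem_openCell_self {A : Set (Hyperplane n)} {x₀ : E n} (h : x₀ ∉ unionOf A) :
    x₀ ∈ openCell A x₀ := fun H hH =>
  mul_self_pos.mpr fun h0 => h (mem_unionOf.mpr ⟨H, hH, h0⟩)

theorem openCell_subset_compl {A : Set (Hyperplane n)} {x₀ : E n} :
    openCell A x₀ ⊆ (unionOf A)ᶜ := fun y hy h => by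
  obtain ⟨H, hH, h0⟩ := mem_unionOf.mp h
  have := hy H hH
  rw [h0, mul_zero] at this
  exact lt_irrefl _ this

/-- On a connected set that avoids the hyperplanes no height changes sign, by the intermediate value
theorem. Conversely the set given by the signs is convex, hence connected. -/
theorem connectedComponentIn_eq {A : Set (Hyperplane n)} {x₀ : E n} (h : x₀ ∉ unionOf A) :
    connectedComponentIn (unionOf A)ᶜ x₀ = openCell A x₀ := by
  apply Set.Subset.antisymm
  · intro y hy H hH
    by_contra! hle
    have hne : ∀ z ∈ connectedComponentIn (unionOf A)ᶜ x₀, height H z ≠ 0 := fun z hz h0 =>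
      connectedComponentIn_subset _ _ hz (mem_unionOf.mpr ⟨H, hH, h0⟩)
    have hx := mem_connectedComponentIn (F := (unionOf A)ᶜ) h
    have hpre : IsPreconnected (connectedComponentIn (unionOf A)ᶜ x₀) :=
      isPreconnected_connectedComponentIn
    have hx0 := hne _ hx
    have hy0 := hne _ hy
    have : (0 : ℝ) ∈ height H '' connectedComponentIn (unionOf A)ᶜ x₀ := by
      rcases lt_or_gt_of_ne hx0 with hx' | hx'
      · have : 0 ≤ height H y := by
          by_contra! hc
          nlinarith [mul_pos_of_neg_of_neg hx' hc]
        exact hpre.intermediate_value hx hy (continuous_height H).continuousOn ⟨hx'.le, this⟩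
      · have : height H y ≤ 0 := by
          by_contra! hc
          nlinarith [mul_pos hx' hc]
        exact hpre.intermediate_value hy hx (continuous_height H).continuousOn ⟨this, hx'.le⟩
    obtain ⟨z, hz, hz0⟩ := this
    exact hne z hz hz0
  · exact (convex_openCell A x₀).isPreconnected.subset_connectedComponentIn
      (mem_openCell_self h) openCell_subset_compl

/-- Moving a point of the closed cell slightly towards `x₀` makes all the weak inequalities strict
at once. -/
theorem closure_openCell {A : Set (Hyperplane n)} {x₀ : E n} (h : x₀ ∉ unionOf A) :
    closure (openCell A x₀) = closedCell A x₀ := by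
  apply Set.Subset.antisymm
  · exact closure_minimal (fun y hy H hH => (hy H hH).le) (isClosed_closedCell A x₀)
  · intro y hy
    have hc : Tendsto (fun t : ℝ => y + t • (x₀ - y)) (𝓝[>] 0) (𝓝 y) := by
      have : Continuous fun t : ℝ => y + t • (x₀ - y) := by fun_prop
      have h0 := this.tendsto 0
      simp only [zero_smul, add_zero] at h0
      exact h0.mono_left nhdsWithin_le_nhds
    refine mem_closure_of_tendsto hc ?_
    filter_upwards [Ioo_mem_nhdsGT (show (0 : ℝ) < 1 by norm_num)] with t ht H hH
    rw [height_lineMap, mul_add]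
    have h1 := hy H hH
    have h2 := mem_openCell_self h H hH
    nlinarith [mul_pos ht.1 h2, mul_nonneg (sub_nonneg.mpr ht.2.le) h1]

theorem sign_mul_self (a : ℝ) : Real.sign a * a = |a| := by
  rcases lt_trichotomy a 0 with h | h | h
  · rw [Real.sign_of_neg h, abs_of_neg h]; ring
  · simp [h]
  · rw [Real.sign_of_pos h, abs_of_pos h]; ring

theorem sign_sq {a : ℝ} (h : a ≠ 0) : Real.sign a * Real.sign a = 1 := by
  rcases lt_or_gt_of_ne h with h | h
  · rw [Real.sign_of_neg h]; ring
  · rw [Real.sign_of_pos h]; ring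

theorem abs_sign {a : ℝ} (h : a ≠ 0) : |Real.sign a| = 1 := by
  rcases lt_or_gt_of_ne h with h | h
  · rw [Real.sign_of_neg h]; simp
  · rw [Real.sign_of_pos h]; simp

theorem mul_nonneg_iff_sign {a b : ℝ} : 0 ≤ a * b ↔ 0 ≤ Real.sign a * b := by
  rcases lt_trichotomy a 0 with h | h | h
  · rw [Real.sign_of_neg h]
    constructor <;> intro h' <;> nlinarith
  · simp [h]
  · rw [Real.sign_of_pos h, one_mul, mul_nonneg_iff_of_pos_left h]

theorem sign_eq_of_mul_pos {a b : ℝ} (h : 0 < a * b) : Real.sign a = Real.sign b := by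
  rcases pos_and_pos_or_neg_and_neg_of_mul_pos h with ⟨h1, h2⟩ | ⟨h1, h2⟩
  · rw [Real.sign_of_pos h1, Real.sign_of_pos h2]
  · rw [Real.sign_of_neg h1, Real.sign_of_neg h2]

theorem closedBall_subset_closedCell_iff {A : Set (Hyperplane n)} {x₀ : E n} (h : x₀ ∉ unionOf A)
    {r : ℝ} (hr : 0 ≤ r) {y : E n} :
    Metric.closedBall y r ⊆ closedCell A x₀ ↔
      ∀ H ∈ A, r ≤ Real.sign (height H x₀) * height H y := by
  constructor
  · intro hsub H hH
    have hx : height H x₀ ≠ 0 := fun h0 => h (mem_unionOf.mpr ⟨H, hH, h0⟩)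
    set s := Real.sign (height H x₀) with hs
    -- The point of the ball that goes farthest towards the wrong side of `H`.
    have hz : y + (-(r * s)) • normal H ∈ Metric.closedBall y r := by
      rw [Metric.mem_closedBall, dist_eq_norm, add_sub_cancel_left, norm_smul, norm_normal,
        Real.norm_eq_abs, abs_neg, abs_mul, abs_sign hx, abs_of_nonneg hr]
      simp
    have := mul_nonneg_iff_sign.mp (hsub hz H hH)
    rw [height_add, real_inner_smul_left, real_inner_self_eq_norm_sq, norm_normal, ← hs] at this
    have h2 := sign_sq hx
    rw [← hs] at h2
    nlinarith
  · intro hH z hz H hHA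
    have hx : height H x₀ ≠ 0 := fun h0 => h (mem_unionOf.mpr ⟨H, hHA, h0⟩)
    rw [mul_nonneg_iff_sign]
    have h1 := hH H hHA
    have h2 := (height_lipschitz H y z).trans (by simpa [dist_comm] using hz : dist y z ≤ r)
    have h3 : |Real.sign (height H x₀) * (height H y - height H z)| ≤ r := by
      rw [abs_mul, abs_sign hx, one_mul]; exact h2
    have := (abs_le.mp h3).2
    nlinarith

/-- Only finitely many hyperplanes of the set come close to the origin. -/
def LocFin (A : Set (Hyperplane n)) : Prop := ∀ R : ℝ, {H ∈ A | |height H 0| ≤ R}.Finite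

theorem LocFin.finite {A : Set (Hyperplane n)} (hA : LocFin A) (x : E n) (R : ℝ) :
    {H ∈ A | |height H x| ≤ R}.Finite := by
  refine (hA (R + dist x 0)).subset fun H hH => ⟨hH.1, ?_⟩
  have h1 := height_lipschitz H 0 x
  rw [dist_comm] at h1
  have h2 := abs_sub_abs_le_abs_sub (height H 0) (height H x)
  linarith [hH.2]

/-- Only finitely many hyperplanes have distance at most `r + 1` from `x`, so those farther than `r`
are farther by a uniform margin. This margin is the room for all small displacements below. -/
theorem LocFin.exists_gap {A : Set (Hyperplane n)} (hA : LocFin A) (x : E n) (r : ℝ) :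
    ∃ η > 0, ∀ H ∈ A, r < |height H x| → r + η ≤ |height H x| := by
  have h1 : ∀ᶠ η in 𝓝[>] (0 : ℝ), ∀ H ∈ {H ∈ A | |height H x| ≤ r + 1},
      r < |height H x| → r + η ≤ |height H x| := by
    rw [Filter.eventually_all_finite (hA.finite x (r + 1))]
    intro H _
    by_cases h : r < |height H x|
    · filter_upwards [Ioo_mem_nhdsGT (sub_pos.mpr h)] with η hη _
      linarith [hη.2]
    · exact Eventually.of_forall fun _ h' => (h h').elim
  have h2 : ∀ᶠ η in 𝓝[>] (0 : ℝ), η ∈ Set.Ioo (0 : ℝ) 1 := Ioo_mem_nhdsGT one_pos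
  obtain ⟨η, hη, hη0, hη1⟩ := (h1.and h2).exists
  refine ⟨η, hη0, fun H hH hr => ?_⟩
  by_cases h : |height H x| ≤ r + 1
  · exact hη H ⟨hH, h⟩ hr
  · push Not at h
    linarith

theorem LocFin.isOpen_openCell {A : Set (Hyperplane n)} (hA : LocFin A) (x₀ : E n) :
    IsOpen (openCell A x₀) := by
  rw [Metric.isOpen_iff]
  intro y hy
  obtain ⟨η, hη, h⟩ := hA.exists_gap y 0
  refine ⟨η, hη, fun z hz H hH => ?_⟩
  have hy' := hy H hH
  have hpos : 0 < |height H y| := abs_pos.mpr fun h0 => by rw [h0, mul_zero] at hy'; exact lt_irrefl _ hy'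
  have h1 := h H hH hpos
  have h2 : |height H z - height H y| < η := (height_lipschitz H z y).trans_lt hz
  rw [abs_lt] at h2
  rcases pos_and_pos_or_neg_and_neg_of_mul_pos hy' with ⟨ha, hb⟩ | ⟨ha, hb⟩
  · rw [abs_of_pos hb] at h1
    exact mul_pos ha (by linarith)
  · rw [abs_of_neg hb] at h1
    exact mul_pos_of_neg_of_neg ha (by linarith)

/-- The points of lowest height in direction `v` among the centers of the balls of radius `r`
contained in `K`. -/
def lowSet (v : E n) (r : ℝ) (K : Set (E n)) : Set (E n) :=
  {x | Metric.closedBall x r ⊆ K ∧ ∀ y, Metric.closedBall y r ⊆ K → inner ℝ x v ≤ inner ℝ y v}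

/-- The ball of radius `r` about `x` touches the hyperplanes `h i`, whose normals form a basis, on
the sides that make `x` the lowest center in direction `v`. -/
def IsVertex (v : E n) (r : ℝ) (h : Fin n → Hyperplane n) (x : E n) : Prop :=
  LinearIndependent ℝ (fun i => normal (h i)) ∧ ∃ a : Fin n → ℝ, (∀ i, a i ≠ 0) ∧
    v = ∑ i, a i • normal (h i) ∧ ∀ i, height (h i) x = Real.sign (a i) * r

theorem exists_dual {u : Fin n → E n} (hu : LinearIndependent ℝ u) :
    ∃ d : Fin n → E n, ∀ i j, inner ℝ (d i) (u j) = if i = j then 1 else 0 := by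
  have hcard : Fintype.card (Fin n) = Module.finrank ℝ (E n) := by simp
  rcases n with _ | n
  · exact ⟨fun _ => 0, fun i => i.elim0⟩
  let b := basisOfLinearIndependentOfCardEqFinrank hu hcard
  refine ⟨fun i => (InnerProductSpace.toDual ℝ (E (n + 1))).symm
    (LinearMap.toContinuousLinearMap (b.coord i)), fun i j => ?_⟩
  rw [InnerProductSpace.toDual_symm_apply]
  have : u j = b j := by simp [b]
  rw [this]
  change b.coord i (b j) = _
  simp [Finsupp.single_apply, eq_comm]

theorem eq_zero_of_inner_eq_zero {u : Fin n → E n} (hu : LinearIndependent ℝ u) {w : E n}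
    (hw : ∀ i, inner ℝ w (u i) = 0) : w = 0 := by
  have hspan : Submodule.span ℝ (Set.range u) = ⊤ :=
    hu.span_eq_top_of_card_eq_finrank' (by simp)
  have : w ∈ (Submodule.span ℝ (Set.range u))ᗮ := by
    rw [Submodule.mem_orthogonal']
    intro y hy
    induction hy using Submodule.span_induction with
    | mem x hx => obtain ⟨i, rfl⟩ := hx; exact hw i
    | zero => simp
    | add x y _ _ hx hy => rw [inner_add_right, hx, hy, add_zero]
    | smul a x _ hx => rw [inner_smul_right, hx, mul_zero]
  rw [hspan, Submodule.top_orthogonal_eq_bot] at this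
  exact (Submodule.mem_bot ℝ).mp this

theorem IsVertex.injective {v : E n} {r : ℝ} {h : Fin n → Hyperplane n} {x : E n}
    (hx : IsVertex v r h x) : Function.Injective h := fun _ _ hij =>
  hx.1.injective (congrArg normal hij)

/-- The coefficients of `v` in the basis of normals are unique, and they prescribe the `n`
independent heights of the point. -/
theorem IsVertex.unique {v : E n} {r : ℝ} {h : Fin n → Hyperplane n} {x y : E n}
    (hx : IsVertex v r h x) (hy : IsVertex v r h y) : x = y := by
  obtain ⟨hu, a, -, hva, hxa⟩ := hx
  obtain ⟨-, b, -, hvb, hyb⟩ := hy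
  have hab : a = b := by
    have : ∑ i, (a i - b i) • normal (h i) = 0 := by
      simp_rw [sub_smul, Finset.sum_sub_distrib, ← hva, ← hvb, sub_self]
    have := Fintype.linearIndependent_iff.mp hu _ this
    exact funext fun i => sub_eq_zero.mp (this i)
  subst hab
  refine sub_eq_zero.mp (eq_zero_of_inner_eq_zero hu fun i => ?_)
  have := (hxa i).trans (hyb i).symm
  unfold height at this
  rw [inner_sub_left]
  linarith

theorem IsVertex.abs_height {v : E n} {r : ℝ} (hr : 0 ≤ r) {h : Fin n → Hyperplane n} {x : E n}
    (hx : IsVertex v r h x) (i : Fin n) : |height (h i) x| = r := by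
  obtain ⟨-, a, ha, -, hxa⟩ := hx
  rw [hxa, abs_mul, abs_sign (ha i), one_mul, abs_of_nonneg hr]

theorem IsVertex.comp_perm {v : E n} {r : ℝ} {h : Fin n → Hyperplane n} {x : E n}
    (hx : IsVertex v r h x) (σ : Equiv.Perm (Fin n)) : IsVertex v r (h ∘ σ) x := by
  obtain ⟨hu, a, ha, hva, hxa⟩ := hx
  refine ⟨hu.comp σ σ.injective, a ∘ σ, fun i => ha _, ?_, fun i => hxa _⟩
  rw [hva]
  exact (Equiv.sum_comp σ fun i => a i • normal (h i)).symm

/-- Complementary slackness: expanding `v` in the normals writes `⟨y, v⟩ - ⟨x, v⟩` as a sum of terms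
`|a i| * (distance to h i - r)`, nonnegative for admissible centers `y`. Equality forces `y` to
touch every `h i`, and then `y = x`. -/
theorem lowSet_eq_singleton {A : Set (Hyperplane n)} {x₀ : E n} (hx₀ : x₀ ∉ unionOf A) {r : ℝ}
    (hr : 0 ≤ r) {v x : E n} (hx : Metric.closedBall x r ⊆ closedCell A x₀)
    {h : Fin n → Hyperplane n} (hA : ∀ i, h i ∈ A) (hu : LinearIndependent ℝ fun i => normal (h i))
    {a : Fin n → ℝ} (ha : ∀ i, a i ≠ 0) (hva : v = ∑ i, a i • normal (h i))
    (hxa : ∀ i, height (h i) x = Real.sign (a i) * r)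
    (hs : ∀ i, Real.sign (height (h i) x₀) = Real.sign (a i)) :
    lowSet v r (closedCell A x₀) = {x} := by
  have key : ∀ y, inner ℝ y v - inner ℝ x v
      = ∑ i, |a i| * (Real.sign (a i) * height (h i) y - r) := fun y => by
    rw [hva, inner_sum, inner_sum, ← Finset.sum_sub_distrib]
    refine Finset.sum_congr rfl fun i _ => ?_
    have h1 := hxa i
    have h2 := sign_sq (ha i)
    rw [← sign_mul_self, inner_smul_right, inner_smul_right]
    unfold height at h1 ⊢
    linear_combination (-a i) * h1 - a i * (inner ℝ y (normal (h i)) - (param (h i)).2) * h2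
  have hnn : ∀ y, Metric.closedBall y r ⊆ closedCell A x₀ → ∀ i,
      0 ≤ |a i| * (Real.sign (a i) * height (h i) y - r) := fun y hy i => by
    refine mul_nonneg (abs_nonneg _) (sub_nonneg.mpr ?_)
    rw [← hs]
    exact (closedBall_subset_closedCell_iff hx₀ hr).mp hy _ (hA i)
  ext y
  constructor
  · rintro ⟨hy, hlow⟩
    have h0 : ∑ i, |a i| * (Real.sign (a i) * height (h i) y - r) = 0 := by
      refine le_antisymm ?_ (Finset.sum_nonneg fun i _ => hnn y hy i)
      rw [← key]
      linarith [hlow x hx]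
    rw [Finset.sum_eq_zero_iff_of_nonneg fun i _ => hnn y hy i] at h0
    refine sub_eq_zero.mp (eq_zero_of_inner_eq_zero hu fun i => ?_)
    have h1 := (mul_eq_zero.mp (h0 i (Finset.mem_univ i))).resolve_left (abs_pos.mpr (ha i)).ne'
    have h2 := sign_sq (ha i)
    have h3 := hxa i
    rw [inner_sub_left]
    unfold height at h1 h3
    linear_combination Real.sign (a i) * h1 - h3
      - (inner ℝ y (normal (h i)) - (param (h i)).2) * h2
  · rintro rfl
    refine ⟨hx, fun y hy => ?_⟩
    have := Finset.sum_nonneg fun i (_ : i ∈ Finset.univ) => hnn y hy i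
    rw [← key] at this
    linarith

/-- No `n + 1` hyperplanes of the set touch a common ball of radius `r`. -/
def NoCommonTangent (r : ℝ) (A : Set (Hyperplane n)) : Prop :=
  ∀ h : Fin (n + 1) → Hyperplane n, Function.Injective h → (∀ i, h i ∈ A) →
    ∀ x, ¬ ∀ i, |height (h i) x| = r

/-- The vector `v` is not in the span of fewer than `n` normals. -/
def GenericDirection (v : E n) (A : Set (Hyperplane n)) : Prop :=
  ∀ m < n, ∀ h : Fin m → Hyperplane n, Function.Injective h → (∀ i, h i ∈ A) →
    v ∉ Submodule.span ℝ (Set.range fun i => normal (h i))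

theorem NoCommonTangent.mem_range {r : ℝ} {A : Set (Hyperplane n)} (hA : NoCommonTangent r A)
    {h : Fin n → Hyperplane n} (hinj : Function.Injective h) (hhA : ∀ i, h i ∈ A) {x : E n}
    (hx : ∀ i, |height (h i) x| = r) {H : Hyperplane n} (hH : H ∈ A) (hHx : |height H x| = r) :
    H ∈ Set.range h := by
  by_contra hn
  refine hA (Fin.cons H h) (Fin.cons_injective_iff.mpr ⟨hn, hinj⟩) ?_ x ?_
  · intro i
    refine Fin.cases hH (fun i => ?_) i
    simpa using hhA i
  · intro i
    refine Fin.cases hHx (fun i => ?_) i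
    simpa using hx i

/-- A linear dependence or a vanishing coefficient would place `v` in the span of `n - 1` of the
normals. -/
theorem GenericDirection.exists_coeff {v : E n} {A : Set (Hyperplane n)} (hA : GenericDirection v A)
    {h : Fin n → Hyperplane n} (hinj : Function.Injective h) (hhA : ∀ i, h i ∈ A)
    (hv : v ∈ Submodule.span ℝ (Set.range fun i => normal (h i))) :
    LinearIndependent ℝ (fun i => normal (h i)) ∧ ∃ a : Fin n → ℝ, (∀ i, a i ≠ 0) ∧
      v = ∑ i, a i • normal (h i) := by
  rcases n with _ | n
  · exact ⟨linearIndependent_empty_type, fun i => i.elim0, fun i => i.elim0, Subsingleton.elim _ _⟩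
  have hnot : ∀ i, v ∉ Submodule.span ℝ (Set.range fun j => normal (h (Fin.succAbove i j))) :=
    fun i => hA n n.lt_succ_self (fun j => h (i.succAbove j))
      (hinj.comp Fin.succAbove_right_injective) fun j => hhA _
  constructor
  · rw [linearIndependent_iff_notMem_span]
    intro i hi
    refine hnot i ?_
    have hle : Submodule.span ℝ (Set.range fun i => normal (h i))
        ≤ Submodule.span ℝ (Set.range fun j => normal (h (Fin.succAbove i j))) := by
      have hle' : Submodule.span ℝ ((fun i => normal (h i)) '' (Set.univ \ {i}))
          ≤ Submodule.span ℝ (Set.range fun j => normal (h (Fin.succAbove i j))) := by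
        refine Submodule.span_mono ?_
        rintro _ ⟨j, hj, rfl⟩
        obtain ⟨k, rfl⟩ := Fin.exists_succAbove_eq (show j ≠ i by simpa using hj)
        exact ⟨k, rfl⟩
      rw [Submodule.span_le]
      rintro _ ⟨j, rfl⟩
      by_cases hj : j = i
      · subst hj; exact hle' hi
      · obtain ⟨k, rfl⟩ := Fin.exists_succAbove_eq hj
        exact Submodule.subset_span ⟨k, rfl⟩
    exact hle hv
  · obtain ⟨a, ha⟩ := (Submodule.mem_span_range_iff_exists_fun ℝ).mp hv
    refine ⟨a, fun i hi => hnot i ?_, ha.symm⟩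
    rw [← ha, Fin.sum_univ_succAbove _ i, hi, zero_smul, zero_add]
    exact Submodule.sum_mem _ fun j _ => Submodule.smul_mem _ _ (Submodule.subset_span ⟨j, rfl⟩)

/-- A lowest center exists by compactness. First-order optimality puts `v` into the span of the
normals of the hyperplanes touched by its ball. Genericity of `v` makes these at least `n`, absence
of common tangents at most `n`. Testing optimality on the dual basis fixes the signs of the
coefficients. -/
theorem exists_isVertex {A : Set (Hyperplane n)} (hA : LocFin A) {x₀ : E n}
    (hx₀ : x₀ ∉ unionOf A) {r : ℝ} (hr : 0 ≤ r) {v : E n} (hT : NoCommonTangent r A)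
    (hG : GenericDirection v A) (hK : IsCompact (closedCell A x₀))
    (hne : ∃ y, Metric.closedBall y r ⊆ closedCell A x₀) :
    ∃ (x : E n) (h : Fin n → Hyperplane n), (∀ i, h i ∈ A) ∧ IsVertex v r h x ∧
      lowSet v r (closedCell A x₀) = {x} := by
  have hsub : {y | Metric.closedBall y r ⊆ closedCell A x₀} ⊆ closedCell A x₀ := fun y hy =>
    hy (Metric.mem_closedBall_self hr)
  have hcl : IsClosed {y | Metric.closedBall y r ⊆ closedCell A x₀} := by
    have : {y | Metric.closedBall y r ⊆ closedCell A x₀}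
        = ⋂ H ∈ A, {y | r ≤ Real.sign (height H x₀) * height H y} := by
      ext y
      simp [closedBall_subset_closedCell_iff hx₀ hr]
    rw [this]
    exact isClosed_biInter fun H _ => isClosed_le continuous_const ((continuous_height H).const_mul _)
  obtain ⟨x, hxE, hxmin⟩ := (hK.of_isClosed_subset hcl hsub).exists_isMinOn hne
    (f := fun y => inner ℝ y v) (by fun_prop)
  have hxr := (closedBall_subset_closedCell_iff hx₀ hr).mp hxE
  have hs0 : ∀ H ∈ A, height H x₀ ≠ 0 := fun H hH h0 => hx₀ (mem_unionOf.mpr ⟨H, hH, h0⟩)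
  have habs : ∀ H ∈ A, Real.sign (height H x₀) * height H x = |height H x| := fun H hH => by
    have h1 := hxr H hH
    rw [← abs_of_nonneg (hr.trans h1), abs_mul, abs_sign (hs0 H hH), one_mul]
  set T : Set (Hyperplane n) := {H ∈ A | |height H x| = r} with hTdef
  have hTfin : T.Finite := (hA.finite x r).subset fun H hH => ⟨hH.1, hH.2.le⟩
  obtain ⟨η, hη, hgap⟩ := hA.exists_gap x r
  -- A direction that does not approach the touched hyperplanes can be followed for a short time:
  -- the step has length at most the gap `η`, so the other hyperplanes remain at distance at least
  -- `r`. Minimality of `x` then applies.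
  have hfeas : ∀ d : E n, (∀ H ∈ T, 0 ≤ Real.sign (height H x₀) * inner ℝ d (normal H)) →
      0 ≤ inner ℝ d v := by
    intro d hd
    have hd1 : 0 < ‖d‖ + 1 := by positivity
    set t := η / (‖d‖ + 1) with ht
    have ht0 : 0 < t := by positivity
    have htd : t * ‖d‖ ≤ η := by
      rw [ht, div_mul_eq_mul_div, div_le_iff₀ hd1]
      nlinarith [norm_nonneg d]
    have hmem : Metric.closedBall (x + t • d) r ⊆ closedCell A x₀ := by
      rw [closedBall_subset_closedCell_iff hx₀ hr]
      intro H hH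
      rw [height_add, real_inner_smul_left, mul_add, habs H hH]
      have h1 := hxr H hH
      rw [habs H hH] at h1
      rcases h1.eq_or_lt with h2 | h2
      · have := hd H ⟨hH, h2.symm⟩
        nlinarith
      · have h3 := hgap H hH h2
        have h4 : |Real.sign (height H x₀) * (t * inner ℝ d (normal H))| ≤ η := by
          rw [abs_mul, abs_sign (hs0 H hH), one_mul, abs_mul, abs_of_pos ht0]
          have := abs_real_inner_le_norm d (normal H)
          rw [norm_normal, mul_one] at this
          nlinarith
        linarith [(abs_le.mp h4).1]
    have := hxmin hmem
    simp only [Set.mem_ofPred_eq] at this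
    rw [inner_add_left, real_inner_smul_left] at this
    by_contra! hneg
    nlinarith
  have hspan : v ∈ Submodule.span ℝ (normal '' T) := by
    -- If `d` is orthogonal to all the touched normals, both `d` and `-d` are feasible, so `d` is
    -- orthogonal to `v`.
    rw [← Submodule.orthogonal_orthogonal (Submodule.span ℝ (normal '' T)), Submodule.mem_orthogonal]
    intro d hd
    have hdH : ∀ H ∈ T, inner ℝ d (normal H) = 0 := fun H hH =>
      (Submodule.mem_orthogonal' _ _).mp hd _ (Submodule.subset_span ⟨H, hH, rfl⟩)
    refine le_antisymm ?_ (hfeas d fun H hH => by simp [hdH H hH])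
    have := hfeas (-d) fun H hH => by simp [inner_neg_left, hdH H hH]
    rw [inner_neg_left] at this
    linarith
  have hcard : hTfin.toFinset.card = n := by
    apply le_antisymm
    · by_contra! hlt
      obtain ⟨e⟩ : Nonempty (Fin (n + 1) ↪ hTfin.toFinset) :=
        Function.Embedding.nonempty_of_card_le (by simpa using hlt)
      have he : ∀ i, (e i : Hyperplane n) ∈ T := fun i => hTfin.mem_toFinset.mp (e i).2
      exact hT (fun i => e i) (fun i j hij => e.injective (Subtype.ext hij)) (fun i => (he i).1) x
        fun i => (he i).2
    · by_contra! hlt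
      have he : ∀ i, ((hTfin.toFinset.equivFin.symm i : hTfin.toFinset) : Hyperplane n) ∈ T :=
        fun i => hTfin.mem_toFinset.mp (hTfin.toFinset.equivFin.symm i).2
      refine hG _ hlt (fun i => (hTfin.toFinset.equivFin.symm i : hTfin.toFinset))
        (fun i j hij => hTfin.toFinset.equivFin.symm.injective (Subtype.ext hij))
        (fun i => (he i).1) ?_
      refine Submodule.span_mono ?_ hspan
      rintro _ ⟨H, hH, rfl⟩
      exact ⟨hTfin.toFinset.equivFin ⟨H, hTfin.mem_toFinset.mpr hH⟩, by simp⟩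
  let e := hTfin.toFinset.equivFinOfCardEq hcard
  set h : Fin n → Hyperplane n := fun i => (e.symm i : hTfin.toFinset) with hh
  have hhT : ∀ i, h i ∈ T := fun i => hTfin.mem_toFinset.mp (e.symm i).2
  have hinj : Function.Injective h := fun i j hij => e.symm.injective (Subtype.ext hij)
  have hrange : normal '' T ⊆ Set.range fun i => normal (h i) := by
    rintro _ ⟨H, hH, rfl⟩
    exact ⟨e ⟨H, hTfin.mem_toFinset.mpr hH⟩, by simp [hh]⟩
  obtain ⟨hu, a, ha, hva⟩ := hG.exists_coeff hinj (fun i => (hhT i).1) (Submodule.span_mono hrange hspan)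
  have hsign : ∀ i, Real.sign (height (h i) x₀) = Real.sign (a i) := by
    intro i
    obtain ⟨d, hd⟩ := exists_dual hu
    have h1 := hfeas (Real.sign (height (h i) x₀) • d i) fun H hH => by
      obtain ⟨j, hj⟩ := hrange ⟨H, hH, rfl⟩
      have hHj : H = h (e ⟨H, hTfin.mem_toFinset.mpr hH⟩) := by simp [hh]
      generalize e ⟨H, hTfin.mem_toFinset.mpr hH⟩ = k at hHj
      rw [hHj, real_inner_smul_left, hd]
      by_cases hik : i = k
      · subst hik; simp [mul_self_nonneg]
      · simp [hik]
    have h2 : inner ℝ (d i) v = a i := by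
      rw [hva, inner_sum]
      simp [inner_smul_right, hd]
    rw [real_inner_smul_left, h2, ← mul_nonneg_iff_sign] at h1
    exact sign_eq_of_mul_pos (lt_of_le_of_ne h1 (mul_ne_zero (hs0 _ (hhT i).1) (ha i)).symm)
  have hxa : ∀ i, height (h i) x = Real.sign (a i) * r := fun i => by
    have h1 := habs _ (hhT i).1
    rw [(hhT i).2, hsign] at h1
    have h2 := sign_sq (ha i)
    linear_combination Real.sign (a i) * h1 - height (h i) x * h2
  exact ⟨x, h, fun i => (hhT i).1, ⟨hu, a, ha, hva, hxa⟩,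
    lowSet_eq_singleton hx₀ hr hxE (fun i => (hhT i).1) hu ha hva hxa hsign⟩

/-- At a simple vertex every combination of sides of the `n` hyperplanes is realized by a cell. The
sides given by the signs of the coefficients of `v` make the vertex the lowest point of that cell.
-/
theorem IsVertex.exists_cell {A : Set (Hyperplane n)} (hA : LocFin A) (hT : NoCommonTangent 0 A)
    {v x : E n} {h : Fin n → Hyperplane n} (hx : IsVertex v 0 h x) (hhA : ∀ i, h i ∈ A) :
    ∃ x₀, x₀ ∉ unionOf A ∧ lowSet v 0 (closedCell A x₀) = {x} := by
  have hinj := hx.injective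
  have habs := hx.abs_height le_rfl
  obtain ⟨hu, a, ha, hva, hxa⟩ := hx
  obtain ⟨d, hd⟩ := exists_dual hu
  obtain ⟨η, hη, hgap⟩ := hA.exists_gap x 0
  -- In the dual basis this direction enters the prescribed side of each `h i`. A step shorter than
  -- the gap crosses no other hyperplane.
  set w : E n := ∑ i, Real.sign (a i) • d i with hw
  have hwi : ∀ i, inner ℝ w (normal (h i)) = Real.sign (a i) := fun i => by
    rw [hw, sum_inner]
    simp [real_inner_smul_left, hd]
  have hd1 : 0 < ‖w‖ + 1 := by positivity
  set t := η / (‖w‖ + 1) with ht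
  have ht0 : 0 < t := by positivity
  have htd : t * ‖w‖ < η := by
    rw [ht, div_mul_eq_mul_div, div_lt_iff₀ hd1]
    nlinarith [norm_nonneg w]
  have hin : ∀ i, height (h i) (x + t • w) = t * Real.sign (a i) := fun i => by
    rw [height_add, real_inner_smul_left, hwi, hxa]; ring
  have hout : ∀ H ∈ A, H ∉ Set.range h → 0 < height H (x + t • w) * height H x := fun H hH hHr => by
    have h1 : 0 < |height H x| := abs_pos.mpr fun h0 =>
      hHr (hT.mem_range hinj hhA habs hH (by rw [h0, abs_zero]))
    have h2 := hgap H hH h1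
    have h3 : |t * inner ℝ w (normal H)| < η := by
      rw [abs_mul, abs_of_pos ht0]
      have := abs_real_inner_le_norm w (normal H)
      rw [norm_normal, mul_one] at this
      nlinarith
    rw [abs_lt] at h3
    rw [height_add, real_inner_smul_left]
    rcases lt_or_gt_of_ne (abs_pos.mp h1) with h4 | h4
    · rw [abs_of_neg h4] at h2
      exact mul_pos_of_neg_of_neg (by linarith) h4
    · rw [abs_of_pos h4] at h2
      exact mul_pos (by linarith) h4
  have hsa : ∀ i, Real.sign (a i) ≠ 0 := fun i h0 => by
    have := sign_sq (ha i); rw [h0] at this; norm_num at this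
  have hx₀ : x + t • w ∉ unionOf A := fun hmem => by
    obtain ⟨H, hH, h0⟩ := mem_unionOf.mp hmem
    by_cases hr : H ∈ Set.range h
    · obtain ⟨i, rfl⟩ := hr
      rw [hin] at h0
      exact mul_ne_zero ht0.ne' (hsa i) h0
    · have := hout H hH hr
      rw [h0, zero_mul] at this
      exact lt_irrefl _ this
  refine ⟨x + t • w, hx₀, lowSet_eq_singleton hx₀ le_rfl ?_ hhA hu ha hva hxa fun i => ?_⟩
  · rw [Metric.closedBall_zero, Set.singleton_subset_iff]
    intro H hH
    by_cases hr : H ∈ Set.range h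
    · obtain ⟨i, rfl⟩ := hr
      rw [hxa]; simp
    · exact (hout H hH hr).le
  · rw [hin]
    rcases lt_or_gt_of_ne (ha i) with h1 | h1
    · rw [Real.sign_of_neg h1, Real.sign_of_neg (by linarith)]
    · rw [Real.sign_of_pos h1, Real.sign_of_pos (by linarith)]

theorem closedCell_eq_of_mem {A : Set (Hyperplane n)} {x₀ x : E n} (hx : x ∈ openCell A x₀) :
    closedCell A x = closedCell A x₀ := by
  ext y
  refine forall₂_congr fun H hH => ?_
  rw [mul_nonneg_iff_sign, ← sign_eq_of_mul_pos (hx H hH), ← mul_nonneg_iff_sign]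

/-- With `r > 0` the center lies off the hyperplanes, so it determines its cell. For `r = 0` this
fails, since a vertex belongs to several cells. -/
theorem mem_openCell_of_ball {A : Set (Hyperplane n)} {x₀ : E n} (hx₀ : x₀ ∉ unionOf A) {r : ℝ}
    (hr : 0 < r) {x : E n} (hx : Metric.closedBall x r ⊆ closedCell A x₀) : x ∈ openCell A x₀ := by
  intro H hH
  have h0 : height H x₀ ≠ 0 := fun h0 => hx₀ (mem_unionOf.mpr ⟨H, hH, h0⟩)
  have h1 := (closedBall_subset_closedCell_iff hx₀ hr.le).mp hx H hH
  have h2 := hx (Metric.mem_closedBall_self hr.le) H hH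
  refine lt_of_le_of_ne h2 (mul_ne_zero h0 fun h3 => ?_).symm
  rw [h3, mul_zero] at h1
  linarith

theorem le_abs_height_of_ball {A : Set (Hyperplane n)} {x₀ : E n} (hx₀ : x₀ ∉ unionOf A) {r : ℝ}
    (hr : 0 ≤ r) {x : E n} (hx : Metric.closedBall x r ⊆ closedCell A x₀) {H : Hyperplane n}
    (hH : H ∈ A) : r ≤ |height H x| := by
  have h0 : height H x₀ ≠ 0 := fun h0 => hx₀ (mem_unionOf.mpr ⟨H, hH, h0⟩)
  have h1 := (closedBall_subset_closedCell_iff hx₀ hr).mp hx H hH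
  calc r ≤ |Real.sign (height H x₀) * height H x| := h1.trans (le_abs_self _)
    _ = |height H x| := by rw [abs_mul, abs_sign h0, one_mul]

end Arrangement

/-! ### Measurability and equivariance of the lowest center of a convex body -/

section Bodies
variable {n : ℕ}

instance (n : ℕ) : BorelSpace (ConvexBody (E n)) := ⟨rfl⟩

theorem mem_of_tendsto {K : ℕ → ConvexBody (E n)} {L : ConvexBody (E n)} (hK : Tendsto K atTop (𝓝 L))
    {x : ℕ → E n} {y : E n} (hx : Tendsto x atTop (𝓝 y)) (hmem : ∀ k, x k ∈ (K k : Set (E n))) :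
    y ∈ (L : Set (E n)) := by
  rw [L.isClosed.mem_iff_infDist_zero L.nonempty]
  have h1 : Tendsto (fun k => Metric.infDist (x k) L) atTop (𝓝 (Metric.infDist y L)) :=
    (Metric.continuous_infDist_pt (L : Set (E n))).continuousAt.tendsto.comp hx
  have h2 : Tendsto (fun k => dist (K k) L) atTop (𝓝 0) := tendsto_iff_dist_tendsto_zero.mp hK
  refine le_antisymm (le_of_tendsto_of_tendsto' h1 h2 fun k => ?_) Metric.infDist_nonneg
  rw [← ConvexBody.hausdorffDist_coe]
  exact Metric.infDist_le_hausdorffDist_of_mem (hmem k) ConvexBody.hausdorffEDist_ne_top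

/-- Along a convergent sequence of bodies the centers stay in a compact neighborhood of the limit,
so a subsequence converges. Each point of the limit ball is a limit of points of the translated
balls. -/
theorem isClosed_exists_ball {r : ℝ} (hr : 0 ≤ r) {F : Set (E n)} (hF : IsClosed F) :
    IsClosed {K : ConvexBody (E n) | ∃ x ∈ F, Metric.closedBall x r ⊆ (K : Set (E n))} := by
  refine IsSeqClosed.isClosed fun K L hK hL => ?_
  choose x hxF hx using hK
  have hxK : ∀ k, x k ∈ (K k : Set (E n)) := fun k => hx k (Metric.mem_closedBall_self hr)
  have hev : ∀ᶠ k in atTop, x k ∈ Metric.cthickening 1 (L : Set (E n)) := by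
    have h2 : Tendsto (fun k => dist (K k) L) atTop (𝓝 0) := tendsto_iff_dist_tendsto_zero.mp hL
    filter_upwards [h2.eventually_lt_const one_pos] with k hk
    rw [Metric.cthickening_eq_preimage_infEDist, Set.mem_preimage, ENNReal.ofReal_one]
    have h3 := Metric.infDist_le_hausdorffDist_of_mem (hxK k)
      (ConvexBody.hausdorffEDist_ne_top (K := K k) (L := L))
    rw [ConvexBody.hausdorffDist_coe] at h3
    have h4 : Metric.infEDist (x k) L ≠ ⊤ := Metric.infEDist_ne_top L.nonempty
    rw [← ENNReal.ofReal_toReal h4, ← ENNReal.ofReal_one]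
    exact ENNReal.ofReal_le_ofReal (h3.trans hk.le)
  obtain ⟨y, -, φ, hφ, hy⟩ := (L.isCompact.cthickening (r := 1)).tendsto_subseq' hev.frequently
  refine ⟨y, hF.mem_of_tendsto hy (Eventually.of_forall fun k => hxF _), fun z hz => ?_⟩
  have h5 : Tendsto (fun k => x (φ k) + (z - y)) atTop (𝓝 z) := by
    have := hy.add_const (z - y)
    simpa using this
  refine mem_of_tendsto (hL.comp hφ.tendsto_atTop) h5 fun k => hx _ ?_
  rw [Metric.mem_closedBall, dist_eq_norm, add_sub_cancel_left, ← dist_eq_norm]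
  exact hz

/-- The convex bodies containing a ball of radius `r`. -/
def thick (n : ℕ) (r : ℝ) : Set (ConvexBody (E n)) :=
  {K | ∃ x, Metric.closedBall x r ⊆ (K : Set (E n))}

theorem measurableSet_thick {r : ℝ} (hr : 0 ≤ r) : MeasurableSet (thick n r) := by
  have := (isClosed_exists_ball (n := n) hr isClosed_univ).measurableSet
  simpa [thick] using this

theorem isCompact_centers (K : ConvexBody (E n)) {r : ℝ} (hr : 0 ≤ r) :
    IsCompact {x | Metric.closedBall x r ⊆ (K : Set (E n))} := by
  refine K.isCompact.of_isClosed_subset ?_ fun x hx => hx (Metric.mem_closedBall_self hr)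
  refine IsSeqClosed.isClosed fun x y hx hy z hz => ?_
  have h5 : Tendsto (fun k => x k + (z - y)) atTop (𝓝 z) := by
    have := hy.add_const (z - y)
    simpa using this
  refine K.isClosed.mem_of_tendsto h5 (Eventually.of_forall fun k => hx k ?_)
  rw [Metric.mem_closedBall, dist_eq_norm, add_sub_cancel_left, ← dist_eq_norm]
  exact hz

theorem lowSet_nonempty (v : E n) {r : ℝ} (hr : 0 ≤ r) {K : ConvexBody (E n)} (hK : K ∈ thick n r) :
    (lowSet v r (K : Set (E n))).Nonempty := by
  obtain ⟨x, hx, hmin⟩ := (isCompact_centers K hr).exists_isMinOn hK (f := fun y => inner ℝ y v)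
    (by fun_prop)
  exact ⟨x, hx, fun y hy => hmin hy⟩

theorem isCompact_lowSet (v : E n) {r : ℝ} (hr : 0 ≤ r) (K : ConvexBody (E n)) :
    IsCompact (lowSet v r (K : Set (E n))) := by
  have : lowSet v r (K : Set (E n)) = {x | Metric.closedBall x r ⊆ (K : Set (E n))} ∩
      ⋂ y ∈ {y | Metric.closedBall y r ⊆ (K : Set (E n))}, {x | inner ℝ x v ≤ inner ℝ y v} := by
    ext x; simp [lowSet]
  rw [this]
  exact (isCompact_centers K hr).inter_right
    (isClosed_biInter fun y _ => isClosed_le (by fun_prop) continuous_const)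

/-- The point whose coordinates are minimal among the points of lowest height; it is the lowest
point itself if this is unique. -/
noncomputable def lowPoint (v : E n) (r : ℝ) (K : ConvexBody (E n)) : E n :=
  WithLp.toLp 2 fun i => sInf ((fun x : E n => x i) '' lowSet v r (K : Set (E n)))

theorem lowPoint_eq {v x : E n} {r : ℝ} {K : ConvexBody (E n)}
    (h : lowSet v r (K : Set (E n)) = {x}) : lowPoint v r K = x := by
  ext i
  simp [lowPoint, h]

/-- This expresses a sublevel set of a coordinate by countably many conditions on existence of
balls, each closed in `K`: every rational level reached by some center is reached by one with `i`-th
coordinate at most `s`. Compactness turns this into a statement about the lowest centers themselves.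
-/
theorem lowPoint_le_iff (v : E n) {r : ℝ} (hr : 0 ≤ r) {K : ConvexBody (E n)} (hK : K ∈ thick n r)
    (i : Fin n) (s : ℝ) : lowPoint v r K i ≤ s ↔
      ∀ q : ℚ, (∃ x ∈ {x : E n | inner ℝ x v ≤ (q : ℝ)}, Metric.closedBall x r ⊆ (K : Set (E n))) →
        ∃ x ∈ {x : E n | x i ≤ s ∧ inner ℝ x v ≤ (q : ℝ)}, Metric.closedBall x r ⊆ (K : Set (E n)) := by
  have hcont : Continuous fun x : E n => x i := by fun_prop
  constructor
  · intro h q ⟨y, hyq, hy⟩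
    obtain ⟨x, hx, hxi⟩ := ((isCompact_lowSet v hr K).image hcont).sInf_mem
      ((lowSet_nonempty v hr hK).image _)
    refine ⟨x, ⟨?_, (hx.2 y hy).trans hyq⟩, hx.1⟩
    exact hxi.le.trans h
  · intro h
    obtain ⟨y, hy, hymin⟩ := lowSet_nonempty v hr hK
    have hne : ({x | Metric.closedBall x r ⊆ (K : Set (E n))} ∩ {x : E n | x i ≤ s}).Nonempty := by
      obtain ⟨q, hq⟩ := exists_rat_gt (inner ℝ y v)
      obtain ⟨x, hx, hxK⟩ := h q ⟨y, hq.le, hy⟩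
      exact ⟨x, hxK, hx.1⟩
    obtain ⟨x, hx, hxmin⟩ := ((isCompact_centers K hr).inter_right
      (isClosed_le hcont continuous_const)).exists_isMinOn hne (f := fun y => inner ℝ y v) (by fun_prop)
    have hxy : inner ℝ x v ≤ inner ℝ y v := by
      by_contra! hlt
      obtain ⟨q, hq1, hq2⟩ := exists_rat_btwn hlt
      obtain ⟨z, hz, hzK⟩ := h q ⟨y, hq1.le, hy⟩
      have := hxmin (show z ∈ _ from ⟨hzK, hz.1⟩)
      simp only [Set.mem_ofPred_eq] at this
      linarith [hz.2]
    have hxlow : x ∈ lowSet v r (K : Set (E n)) := ⟨hx.1, fun z hz => hxy.trans (hymin z hz)⟩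
    exact (csInf_le ((isCompact_lowSet v hr K).image hcont).bddBelow ⟨x, hxlow, rfl⟩).trans hx.2

theorem measurable_lowPoint (v : E n) {r : ℝ} (hr : 0 ≤ r) : Measurable (lowPoint (n := n) v r) := by
  have : Measurable fun K => (fun i => lowPoint v r K i : Fin n → ℝ) := by
    refine measurable_pi_lambda _ fun i => measurable_of_Iic fun s => ?_
    have hset : (fun K => lowPoint v r K i) ⁻¹' Set.Iic s
        = (thick n r ∩ ⋂ q : ℚ,
          ({K : ConvexBody (E n) | ∃ x ∈ {x : E n | inner ℝ x v ≤ (q : ℝ)}, Metric.closedBall x r ⊆ (K : Set (E n))}ᶜ ∪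
          {K : ConvexBody (E n) | ∃ x ∈ {x : E n | x i ≤ s ∧ inner ℝ x v ≤ (q : ℝ)}, Metric.closedBall x r ⊆ (K : Set (E n))}))
        -- A body without a ball of radius `r` has no lowest center, and the infimum of the empty
        -- set is `0` by convention.
        ∪ ((thick n r)ᶜ ∩ {_K | 0 ≤ s}) := by
      ext K
      by_cases hK : K ∈ thick n r
      · have h1 := lowPoint_le_iff v hr hK i s
        simp only [Set.mem_preimage, Set.mem_Iic, Set.mem_union, Set.mem_inter_iff, hK, true_and,
          Set.mem_compl_iff, not_true, false_and, or_false, Set.mem_iInter, h1]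
        exact forall_congr' fun q => imp_iff_not_or
      · have h0 : lowSet v r (K : Set (E n)) = ∅ := by
          by_contra hne
          obtain ⟨x, hx⟩ := Set.nonempty_iff_ne_empty.mpr hne
          exact hK ⟨x, hx.1⟩
        have h1 : lowPoint v r K i = 0 := by simp [lowPoint, h0]
        simp [hK, h1]
    have hv : ∀ q : ℚ, IsClosed {x : E n | inner ℝ x v ≤ (q : ℝ)} := fun q =>
      isClosed_le (by fun_prop) continuous_const
    rw [hset]
    refine ((measurableSet_thick hr).inter (MeasurableSet.iInter fun q => ?_)).union
      ((measurableSet_thick hr).compl.inter (MeasurableSet.const _))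
    refine (isClosed_exists_ball hr ?_).measurableSet.compl.union
      (isClosed_exists_ball hr ?_).measurableSet
    · exact hv q
    · exact IsClosed.inter (isClosed_le (by fun_prop) continuous_const : IsClosed {x : E n | x i ≤ s}) (hv q)
  exact (WithLp.measurable_toLp 2 (Fin n → ℝ)).comp this

theorem coe_translateBody (t : E n) (K : ConvexBody (E n)) :
    (translateBody t K : Set (E n)) = (fun x => x + t) '' (K : Set (E n)) := rfl

theorem closedBall_subset_translateBody {t : E n} {K : ConvexBody (E n)} {r : ℝ} {x : E n} :
    Metric.closedBall (x + t) r ⊆ (translateBody t K : Set (E n)) ↔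
      Metric.closedBall x r ⊆ (K : Set (E n)) := by
  have : Metric.closedBall (x + t) r = (fun x => x + t) '' Metric.closedBall x r := by simp
  rw [this, coe_translateBody, Set.image_subset_image_iff (add_left_injective t)]

theorem translateBody_mem_thick {t : E n} {K : ConvexBody (E n)} {r : ℝ} :
    translateBody t K ∈ thick n r ↔ K ∈ thick n r := by
  constructor
  · rintro ⟨x, hx⟩
    refine ⟨x - t, closedBall_subset_translateBody (t := t).mp ?_⟩
    rwa [sub_add_cancel]
  · rintro ⟨x, hx⟩
    exact ⟨x + t, closedBall_subset_translateBody.mpr hx⟩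

theorem lowSet_translateBody (v t : E n) (r : ℝ) (K : ConvexBody (E n)) :
    lowSet v r (translateBody t K : Set (E n)) = (fun x => x + t) '' lowSet v r (K : Set (E n)) := by
  ext x
  constructor
  · rintro ⟨hx, hlow⟩
    refine ⟨x - t, ⟨closedBall_subset_translateBody (t := t).mp (by rwa [sub_add_cancel]),
      fun y hy => ?_⟩, sub_add_cancel x t⟩
    have := hlow (y + t) (closedBall_subset_translateBody.mpr hy)
    rw [inner_add_left] at this
    rw [inner_sub_left]
    linarith
  · rintro ⟨x, ⟨hx, hlow⟩, rfl⟩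
    refine ⟨closedBall_subset_translateBody.mpr hx, fun y hy => ?_⟩
    have := hlow (y - t) (closedBall_subset_translateBody (t := t).mp (by rwa [sub_add_cancel]))
    rw [inner_sub_left] at this
    simp only [inner_add_left]
    linarith

theorem lowPoint_translateBody (v : E n) {r : ℝ} (hr : 0 ≤ r) {K : ConvexBody (E n)}
    (hK : K ∈ thick n r) (t : E n) : lowPoint v r (translateBody t K) = lowPoint v r K + t := by
  ext i
  have hcont : Continuous fun x : E n => x i := by fun_prop
  have h1 : (fun x : E n => x i) '' lowSet v r (translateBody t K : Set (E n))
      = OrderIso.addRight (t i) '' ((fun x : E n => x i) '' lowSet v r (K : Set (E n))) := by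
    rw [lowSet_translateBody, Set.image_image, Set.image_image]
    rfl
  have h2 := (OrderIso.addRight (t i)).map_csInf' ((lowSet_nonempty v hr hK).image fun x : E n => x i)
    ((isCompact_lowSet v hr K).image hcont).bddBelow
  change sInf _ = sInf _ + t i
  rw [h1, ← h2]
  rfl

end Bodies

/-! ### A measurable enumeration of the cells -/

section Enumeration
variable {n : ℕ}

/-- A dense sequence of points. -/
noncomputable def dpt (n : ℕ) (i : ℕ) : E n := TopologicalSpace.denseSeq (E n) i

theorem dense_range_dpt : Dense (Set.range (dpt n)) := TopologicalSpace.denseRange_denseSeq (E n)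

/-- The segment between two of the dense points meets no hyperplane. -/
def Joined (μ : Measure (Hyperplane n)) (j i : ℕ) : Prop :=
  μ (hitting (segment ℝ (dpt n j) (dpt n i))) = 0

theorem measurableSet_joined (j i : ℕ) : MeasurableSet {μ : Measure (Hyperplane n) | Joined μ j i} :=
  Measure.measurable_coe (measurableSet_hitting (by
    rw [← convexHull_pair]; exact (Set.toFinite _).isCompact_convexHull ℝ)) (measurableSet_singleton 0)

/-- The convex hull of finitely many of the dense points. -/
noncomputable def hullBody (n : ℕ) (j : ℕ) (s : Finset ℕ) : ConvexBody (E n) where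
  carrier := convexHull ℝ (insert (dpt n j) (dpt n '' s))
  convex' := convex_convexHull ℝ _
  isCompact' := ((s.finite_toSet.image _).insert _).isCompact_convexHull ℝ
  nonempty' := ⟨dpt n j, subset_convexHull ℝ _ (Set.mem_insert _ _)⟩

open Classical in
/-- The closed convex hull of the dense points with indices in `I`, if this is bounded. -/
noncomputable def limitBody (n : ℕ) (j : ℕ) (I : Set ℕ) : ConvexBody (E n) :=
  if h : Bornology.IsBounded (dpt n '' I) then
  { carrier := closure (convexHull ℝ (insert (dpt n j) (dpt n '' I)))
    convex' := (convex_convexHull ℝ _).closure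
    isCompact' := (isBounded_convexHull.mpr (h.insert _)).isCompact_closure
    nonempty' := ⟨dpt n j, subset_closure (subset_convexHull ℝ _ (Set.mem_insert _ _))⟩ }
  else hullBody n j ∅

theorem coe_limitBody {j : ℕ} {I : Set ℕ} (h : Bornology.IsBounded (dpt n '' I)) :
    (limitBody n j I : Set (E n)) = closure (convexHull ℝ (insert (dpt n j) (dpt n '' I))) := by
  rw [limitBody, dif_pos h]; rfl

-- The hulls of finitely many points increase and their union is dense in the compact limit body, so
-- one of them is already `ε`-close. This exhibits `cellBody` as a limit of maps with countably many
-- values.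
open Classical in
theorem tendsto_hullBody {j : ℕ} {I : Set ℕ} (h : Bornology.IsBounded (dpt n '' I)) :
    Tendsto (fun N => hullBody n j ((Finset.range N).filter (· ∈ I))) atTop (𝓝 (limitBody n j I)) := by
  set s : ℕ → Finset ℕ := fun N => (Finset.range N).filter (· ∈ I) with hs
  have hmono : Monotone fun N => (hullBody n j (s N) : Set (E n)) := fun N M hNM => by
    refine convexHull_mono (Set.insert_subset_insert (Set.image_mono ?_))
    intro i hi
    simp only [hs, Finset.coe_filter, Finset.mem_range, Set.mem_ofPred_eq] at hi ⊢
    exact ⟨hi.1.trans_le hNM, hi.2⟩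
  have hsub : ∀ N, (hullBody n j (s N) : Set (E n)) ⊆ limitBody n j I := fun N => by
    rw [coe_limitBody h]
    refine (convexHull_mono (Set.insert_subset_insert (Set.image_mono ?_))).trans subset_closure
    intro i hi
    simp only [hs, Finset.coe_filter, Finset.mem_range, Set.mem_ofPred_eq] at hi
    exact hi.2
  have hU : convexHull ℝ (insert (dpt n j) (dpt n '' I)) ⊆ ⋃ N, (hullBody n j (s N) : Set (E n)) := by
    refine convexHull_min ?_ (hmono.directed_le.convex_iUnion fun N => (hullBody n j (s N)).convex)
    intro x hx
    rcases hx with rfl | ⟨i, hi, rfl⟩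
    · exact Set.mem_iUnion.mpr ⟨0, subset_convexHull ℝ _ (Set.mem_insert _ _)⟩
    · refine Set.mem_iUnion.mpr ⟨i + 1, subset_convexHull ℝ _ (Set.mem_insert_of_mem _ ⟨i, ?_, rfl⟩)⟩
      simp [hs, hi]
  rw [Metric.tendsto_atTop]
  intro ε hε
  have hε2 : 0 < ε / 2 := half_pos hε
  have hcov : (limitBody n j I : Set (E n)) ⊆ ⋃ N, Metric.thickening (ε / 2) (hullBody n j (s N) : Set (E n)) := by
    intro x hx
    rw [coe_limitBody h] at hx
    obtain ⟨y, hy, hxy⟩ := Metric.mem_closure_iff.mp hx (ε / 2) hε2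
    obtain ⟨N, hN⟩ := Set.mem_iUnion.mp (hU hy)
    exact Set.mem_iUnion.mpr ⟨N, Metric.mem_thickening_iff.mpr ⟨y, hN, hxy⟩⟩
  obtain ⟨N, hN⟩ := (limitBody n j I).isCompact.elim_directed_cover _
    (fun N => Metric.isOpen_thickening) hcov
    (Monotone.directed_le fun N M hNM => Metric.thickening_subset_of_subset _ (hmono hNM))
  refine ⟨N, fun M hM => ?_⟩
  rw [← ConvexBody.hausdorffDist_coe]
  refine (Metric.hausdorffDist_le_of_mem_dist hε2.le (fun x hx => ⟨x, hsub M hx, by simpa using hε2.le⟩)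
    fun x hx => ?_).trans_lt (half_lt_self hε)
  obtain ⟨y, hy, hxy⟩ := Metric.mem_thickening_iff.mp (hN hx)
  exact ⟨y, hmono hM hy, hxy.le⟩

/-- The closure of the cell that contains the `j`-th dense point. -/
noncomputable def cellBody (n : ℕ) (j : ℕ) (μ : Measure (Hyperplane n)) : ConvexBody (E n) :=
  limitBody n j {i | Joined μ j i}

theorem measurableSet_bounded (j : ℕ) :
    MeasurableSet {μ : Measure (Hyperplane n) | Bornology.IsBounded (dpt n '' {i | Joined μ j i})} := by
  have : {μ : Measure (Hyperplane n) | Bornology.IsBounded (dpt n '' {i | Joined μ j i})}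
      = ⋃ R : ℕ, ⋂ i, ({μ | Joined μ j i}ᶜ ∪ {_μ | ‖dpt n i‖ ≤ R}) := by
    ext μ
    simp only [Set.mem_ofPred_eq, Set.mem_iUnion, Set.mem_iInter, Set.mem_union, Set.mem_compl_iff,
      ← imp_iff_not_or]
    rw [isBounded_iff_forall_norm_le]
    constructor
    · rintro ⟨C, hC⟩
      obtain ⟨R, hR⟩ := exists_nat_ge C
      exact ⟨R, fun i hi => (hC _ ⟨i, hi, rfl⟩).trans hR⟩
    · rintro ⟨R, hR⟩
      refine ⟨R, ?_⟩
      rintro _ ⟨i, hi, rfl⟩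
      exact hR i hi
  rw [this]
  exact MeasurableSet.iUnion fun R => MeasurableSet.iInter fun i =>
    (measurableSet_joined j i).compl.union (MeasurableSet.const _)

theorem measurable_cellBody (j : ℕ) : Measurable (cellBody n j) := by
  classical
  have hfil : ∀ N, Measurable[_, ⊤] fun μ : Measure (Hyperplane n) =>
      (Finset.range N).filter (Joined μ j) := by
    intro N
    let _ : MeasurableSpace (Finset ℕ) := ⊤
    refine measurable_to_countable' fun s => ?_
    by_cases hsN : s ⊆ Finset.range N
    · have : (fun μ : Measure (Hyperplane n) => (Finset.range N).filter (Joined μ j)) ⁻¹' {s}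
          = ⋂ i ∈ Finset.range N, {μ | Joined μ j i ↔ i ∈ s} := by
        ext μ
        simp only [Set.mem_preimage, Set.mem_singleton_iff, Finset.ext_iff, Finset.mem_filter,
          Set.mem_iInter, Set.mem_ofPred_eq]
        refine forall_congr' fun i => ?_
        have := @hsN i
        tauto
      rw [this]
      refine Finset.measurableSet_biInter _ fun i _ => ?_
      exact (measurableSet_joined j i).iff (MeasurableSet.const _)
    · have : (fun μ : Measure (Hyperplane n) => (Finset.range N).filter (Joined μ j)) ⁻¹' {s} = ∅ := by
        ext μ
        simp only [Set.mem_preimage, Set.mem_singleton_iff, Set.mem_empty_iff_false, iff_false]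
        rintro rfl
        exact hsN (Finset.filter_subset _ _)
      rw [this]
      exact MeasurableSet.empty
  refine measurable_of_tendsto_metrizable (f := fun N μ =>
    if Bornology.IsBounded (dpt n '' {i | Joined μ j i}) then
      hullBody n j ((Finset.range N).filter (Joined μ j)) else hullBody n j ∅) (fun N => ?_) ?_
  · refine Measurable.ite (measurableSet_bounded j) ?_ measurable_const
    exact (@measurable_from_top _ _ _ (hullBody n j)).comp (hfil N)
  · rw [tendsto_pi_nhds]
    intro μ
    by_cases h : Bornology.IsBounded (dpt n '' {i | Joined μ j i})
    · simp only [h, if_true]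
      exact tendsto_hullBody h
    · simp only [h, if_false, cellBody, limitBody, dif_neg, not_false_eq_true]
      exact tendsto_const_nhds

/-- The `j`-th dense point is the first one in its cell, and this cell is bounded. -/
def firstIn (n : ℕ) (j : ℕ) : Set (Measure (Hyperplane n)) :=
  {μ | Joined μ j j ∧ Bornology.IsBounded (dpt n '' {i | Joined μ j i}) ∧ ∀ i < j, ¬ Joined μ i j}

theorem measurableSet_firstIn (j : ℕ) : MeasurableSet (firstIn n j) := by
  have : firstIn n j = {μ | Joined μ j j} ∩
      ({μ | Bornology.IsBounded (dpt n '' {i | Joined μ j i})} ∩ ⋂ i, ⋂ (_ : i < j), {μ | Joined μ i j}ᶜ) := by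
    ext μ; simp [firstIn]
  rw [this]
  exact (measurableSet_joined j j).inter ((measurableSet_bounded j).inter
    (MeasurableSet.iInter fun i => MeasurableSet.iInter fun _ => (measurableSet_joined i j).compl))

open Classical in
/-- The sum of `f` over the cells, through an enumeration of the cells. -/
noncomputable def cellSum (f : ConvexBody (E n) → ENNReal) (μ : Measure (Hyperplane n)) : ENNReal :=
  ∑' j, (firstIn n j).indicator (fun μ => f (cellBody n j μ)) μ

theorem measurable_cellSum {f : ConvexBody (E n) → ENNReal} (hf : Measurable f) :
    Measurable (cellSum f) :=
  Measurable.tsum fun j => (hf.comp (measurable_cellBody j)).indicator (measurableSet_firstIn j)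

theorem IsCountingMeasure.isSumDirac {μ : Measure (Hyperplane n)} (hμ : IsCountingMeasure μ) :
    IsSumDirac μ := hμ.1

theorem IsCountingMeasure.locFin {μ : Measure (Hyperplane n)} (hμ : IsCountingMeasure μ) :
    LocFin (atoms μ) := by
  intro R
  have hfin := hμ.2 (Metric.closedBall 0 R) (isCompact_closedBall _ _)
  have hsub : {H ∈ atoms μ | |height H 0| ≤ R} ⊆ atoms μ ∩ hitting (Metric.closedBall 0 R) :=
    fun H hH => ⟨hH.1, (mem_hitting_closedBall H 0).mpr hH.2⟩
  refine Set.Finite.subset ?_ hsub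
  by_contra hinf
  have hinf' : (atoms μ ∩ hitting (Metric.closedBall 0 R)).Infinite := hinf
  have hc : (atoms μ ∩ hitting (Metric.closedBall 0 R)).Countable :=
    hμ.isSumDirac.countable_atoms.mono Set.inter_subset_left
  -- Infinitely many atoms, each of mass at least one, would contradict local finiteness.
  have h1 : μ (atoms μ ∩ hitting (Metric.closedBall 0 R)) = ⊤ := by
    have h2 : atoms μ ∩ hitting (Metric.closedBall 0 R)
        = ⋃ H ∈ atoms μ ∩ hitting (Metric.closedBall 0 R), {H} := (Set.biUnion_of_singleton _).symm
    rw [h2, measure_biUnion hc (fun a _ b _ hab => by simpa [Function.onFun] using hab)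
      fun H _ => MeasurableSet.singleton H]
    have h3 : ((atoms μ ∩ hitting (Metric.closedBall (0 : E n) R)).encard : ENNReal) = ⊤ := by
      rw [hinf'.encard_eq, ENat.toENNReal_top]
    rw [← top_le_iff, ← h3, ← ENNReal.tsum_set_one]
    exact ENNReal.tsum_le_tsum fun H => hμ.isSumDirac.one_le H.2.1
  exact (((measure_mono Set.inter_subset_right).trans_lt hfin).ne h1).elim

theorem IsCountingMeasure.hitting_eq_zero_iff {μ : Measure (Hyperplane n)} (hμ : IsCountingMeasure μ)
    {C : Set (E n)} (hC : IsCompact C) : μ (hitting C) = 0 ↔ C ⊆ (unionOf (atoms μ))ᶜ := by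
  rw [hμ.isSumDirac.eq_zero_iff (measurableSet_hitting hC)]
  constructor
  · intro h x hx hxU
    obtain ⟨H, hH, h0⟩ := mem_unionOf.mp hxU
    exact h H hH ⟨x, (mem_iff_height H x).mpr h0, hx⟩
  · rintro h H hH ⟨x, hxH, hxC⟩
    exact h hxC (mem_unionOf.mpr ⟨H, hH, (mem_iff_height H x).mp hxH⟩)

theorem segment_subset_compl_iff {A : Set (Hyperplane n)} {x y : E n} :
    segment ℝ x y ⊆ (unionOf A)ᶜ ↔ x ∉ unionOf A ∧ y ∈ openCell A x := by
  constructor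
  · intro h
    have hx : x ∉ unionOf A := h (left_mem_segment ℝ x y)
    refine ⟨hx, ?_⟩
    rw [← connectedComponentIn_eq hx]
    exact (convex_segment x y).isPreconnected.subset_connectedComponentIn (left_mem_segment ℝ x y) h
      (right_mem_segment ℝ x y)
  · rintro ⟨hx, hy⟩
    exact ((convex_openCell A x).segment_subset (mem_openCell_self hx) hy).trans openCell_subset_compl

theorem IsCountingMeasure.joined_iff {μ : Measure (Hyperplane n)} (hμ : IsCountingMeasure μ) {j i : ℕ} :
    Joined μ j i ↔ dpt n j ∉ unionOf (atoms μ) ∧ dpt n i ∈ openCell (atoms μ) (dpt n j) := by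
  rw [Joined, hμ.hitting_eq_zero_iff, segment_subset_compl_iff]
  rw [← convexHull_pair]; exact (Set.toFinite _).isCompact_convexHull ℝ

theorem mem_cells_iff {μ : Measure (Hyperplane n)} {K : ConvexBody (E n)} :
    K ∈ cells μ ↔ ∃ x, x ∉ unionOf (atoms μ) ∧ (K : Set (E n)) = closedCell (atoms μ) x := by
  refine exists_congr fun x => and_congr_right fun hx => ?_
  have hx' : x ∉ unionOf (atoms μ) := hx
  rw [skeleton_eq, connectedComponentIn_eq hx', closure_openCell hx']

/-- The cell is open by local finiteness, so the dense points it contains are dense in it; by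
convexity their hull does not leave it. -/
theorem IsCountingMeasure.coe_cellBody {μ : Measure (Hyperplane n)} (hμ : IsCountingMeasure μ) {j : ℕ}
    (hj : dpt n j ∉ unionOf (atoms μ)) (hb : Bornology.IsBounded (dpt n '' {i | Joined μ j i})) :
    (cellBody n j μ : Set (E n)) = closedCell (atoms μ) (dpt n j) := by
  rw [cellBody, coe_limitBody hb, ← closure_openCell hj]
  have hI : dpt n '' {i | Joined μ j i} = openCell (atoms μ) (dpt n j) ∩ Set.range (dpt n) := by
    ext x
    constructor
    · rintro ⟨i, hi, rfl⟩
      exact ⟨(hμ.joined_iff.mp hi).2, ⟨i, rfl⟩⟩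
    · rintro ⟨hx, ⟨i, rfl⟩⟩
      exact ⟨i, hμ.joined_iff.mpr ⟨hj, hx⟩, rfl⟩
  apply Set.Subset.antisymm
  · refine closure_mono (convexHull_min ?_ (convex_openCell _ _))
    rw [hI]
    exact Set.insert_subset (mem_openCell_self hj) Set.inter_subset_left
  · refine closure_minimal ?_ isClosed_closure
    refine (dense_range_dpt.open_subset_closure_inter (hμ.locFin.isOpen_openCell _)).trans ?_
    rw [← hI]
    exact closure_mono ((Set.subset_insert _ _).trans (subset_convexHull ℝ _))

theorem mem_openCell_symm {A : Set (Hyperplane n)} {x y : E n} (h : y ∈ openCell A x) :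
    x ∈ openCell A y := fun H hH => by rw [mul_comm]; exact h H hH

theorem mem_openCell_trans {A : Set (Hyperplane n)} {x y z : E n} (h : y ∈ openCell A x)
    (h' : z ∈ openCell A y) : z ∈ openCell A x := fun H hH => by
  have h1 := h H hH
  have h2 := h' H hH
  rcases pos_and_pos_or_neg_and_neg_of_mul_pos h1 with ⟨ha, hb⟩ | ⟨ha, hb⟩
  · exact mul_pos ha (pos_of_mul_pos_right h2 hb.le)
  · exact mul_pos_of_neg_of_neg ha (by by_contra! hc; nlinarith)

theorem mem_openCell_of_mem_closedCell {A : Set (Hyperplane n)} {x y : E n} (hx : x ∉ unionOf A)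
    (hy : y ∉ unionOf A) (h : y ∈ closedCell A x) : y ∈ openCell A x := fun H hH =>
  lt_of_le_of_ne (h H hH) (mul_ne_zero (fun h0 => hx (mem_unionOf.mpr ⟨H, hH, h0⟩))
    fun h0 => hy (mem_unionOf.mpr ⟨H, hH, h0⟩)).symm

/-- Each bounded cell is represented exactly once, by the dense point of least index in its
interior. The sum over a random index set thereby becomes a series whose terms are measurable in
`μ`. -/
theorem IsCountingMeasure.tsum_cells {μ : Measure (Hyperplane n)} (hμ : IsCountingMeasure μ)
    (f : ConvexBody (E n) → ENNReal) : ∑' K : cells μ, f K.1 = cellSum f μ := by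
  have hbij : ∃ e : {j | μ ∈ firstIn n j} ≃ cells μ, ∀ j, (e j).1 = cellBody n j.1 μ := by
    have hcell : ∀ j : {j | μ ∈ firstIn n j}, cellBody n j.1 μ ∈ cells μ := fun j => by
      have h1 := (hμ.joined_iff.mp j.2.1).1
      exact mem_cells_iff.mpr ⟨_, h1, hμ.coe_cellBody h1 j.2.2.1⟩
    refine ⟨Equiv.ofBijective (fun j => ⟨cellBody n j.1 μ, hcell j⟩) ⟨?_, ?_⟩, fun j => rfl⟩
    · have key : ∀ i j : {j | μ ∈ firstIn n j}, cellBody n i.1 μ = cellBody n j.1 μ → ¬ i.1 < j.1 := by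
        intro i j hij hlt
        have hi := (hμ.joined_iff.mp i.2.1).1
        have hj := (hμ.joined_iff.mp j.2.1).1
        refine j.2.2.2 i.1 hlt (hμ.joined_iff.mpr ⟨hi, mem_openCell_of_mem_closedCell hi hj ?_⟩)
        rw [← hμ.coe_cellBody hi i.2.2.1, hij, hμ.coe_cellBody hj j.2.2.1, ← closure_openCell hj]
        exact subset_closure (mem_openCell_self hj)
      intro i j hij
      have h1 : cellBody n i.1 μ = cellBody n j.1 μ := congrArg Subtype.val hij
      exact Subtype.ext (le_antisymm (not_lt.mp (key j i h1.symm)) (not_lt.mp (key i j h1)))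
    · rintro ⟨K, hK⟩
      obtain ⟨x, hx, hKx⟩ := mem_cells_iff.mp hK
      have hex : ∃ j, dpt n j ∈ openCell (atoms μ) x := by
        obtain ⟨y, hy, ⟨j, rfl⟩⟩ := dense_range_dpt.inter_open_nonempty _
          (hμ.locFin.isOpen_openCell x) ⟨x, mem_openCell_self hx⟩
        exact ⟨j, hy⟩
      classical
      have hj := Nat.find_spec hex
      have hmin := fun i (hi : i < Nat.find hex) => Nat.find_min hex hi
      generalize Nat.find hex = j at hj hmin
      have hjU : dpt n j ∉ unionOf (atoms μ) := openCell_subset_compl hj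
      have hb : Bornology.IsBounded (dpt n '' {i | Joined μ j i}) := by
        refine K.isBounded.subset ?_
        rintro _ ⟨i, hi, rfl⟩
        rw [hKx, ← closure_openCell hx]
        exact subset_closure (mem_openCell_trans hj (hμ.joined_iff.mp hi).2)
      refine ⟨⟨j, hμ.joined_iff.mpr ⟨hjU, mem_openCell_self hjU⟩, hb, fun i hi hij => hmin i hi ?_⟩, ?_⟩
      · exact mem_openCell_trans hj (mem_openCell_symm (hμ.joined_iff.mp hij).2)
      · refine Subtype.ext (ConvexBody.ext ?_)
        change (cellBody n j μ : Set (E n)) = K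
        rw [hμ.coe_cellBody hjU hb, hKx, closedCell_eq_of_mem hj]
  obtain ⟨e, he⟩ := hbij
  have h1 : cellSum f μ = ∑' j, {j | μ ∈ firstIn n j}.indicator (fun j => f (cellBody n j μ)) j := by
    refine tsum_congr fun j => ?_
    by_cases h : μ ∈ firstIn n j <;> simp [h]
  rw [h1, ← tsum_subtype, ← e.tsum_eq]
  exact tsum_congr fun j => by rw [he]

theorem IsCountingMeasure.map_translate {μ : Measure (Hyperplane n)} (hμ : IsCountingMeasure μ)
    (t : E n) : IsCountingMeasure (μ.map (Hyperplane.translate t)) := by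
  obtain ⟨⟨ι, hι, h, rfl⟩, hfin⟩ := hμ
  have hm := Hyperplane.measurable_translate t
  refine ⟨⟨ι, hι, fun i => Hyperplane.translate t (h i), ?_⟩, fun C hC => ?_⟩
  · rw [Measure.map_sum hm.aemeasurable]
    congr 1
    funext i
    exact Measure.map_dirac' hm _
  · rw [Measure.map_apply hm (measurableSet_hitting hC)]
    refine lt_of_le_of_lt (measure_mono ?_) (hfin ((fun x => x + -t) '' C) (hC.image (by fun_prop)))
    rintro H ⟨_, ⟨y, hy, rfl⟩, hyC⟩
    exact ⟨y, hy, y + t, hyC, by simp⟩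

theorem translate_neg_translate (t : E n) (H : Hyperplane n) :
    Hyperplane.translate (-t) (Hyperplane.translate t H) = H := by
  apply Subtype.ext
  change (fun x => x + -t) '' ((fun x => x + t) '' H.1) = H.1
  rw [Set.image_image]
  simp

theorem skeleton_map_translate {μ : Measure (Hyperplane n)} (t : E n) :
    skeleton (μ.map (Hyperplane.translate t)) = (fun x => x + t) '' skeleton μ := by
  have hm := Hyperplane.measurable_translate t
  have hat : ∀ H, (μ.map (Hyperplane.translate t)) {H} = μ {Hyperplane.translate (-t) H} := fun H => by
    rw [Measure.map_apply hm (MeasurableSet.singleton H)]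
    congr 1
    ext G
    simp only [Set.mem_preimage, Set.mem_singleton_iff]
    constructor
    · rintro rfl; exact (translate_neg_translate t G).symm
    · rintro rfl; simpa using translate_neg_translate (-t) H
  ext x
  simp only [skeleton, Set.mem_iUnion, Set.mem_ofPred_eq, hat, exists_prop, Set.mem_image]
  constructor
  · rintro ⟨H, hH, hx⟩
    exact ⟨x + -t, ⟨_, hH, ⟨x, hx, rfl⟩⟩, by simp⟩
  · rintro ⟨y, ⟨H, hH, hy⟩, rfl⟩
    exact ⟨Hyperplane.translate t H, by rwa [translate_neg_translate], ⟨y, hy, rfl⟩⟩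

theorem translateBody_mem_cells {μ : Measure (Hyperplane n)} {K : ConvexBody (E n)} (hK : K ∈ cells μ)
    (t : E n) : translateBody t K ∈ cells (μ.map (Hyperplane.translate t)) := by
  obtain ⟨x, hx, hKx⟩ := hK
  have hcompl : (skeleton (μ.map (Hyperplane.translate t)))ᶜ = (Homeomorph.addRight t) '' (skeleton μ)ᶜ := by
    rw [skeleton_map_translate, Set.image_compl_eq (Homeomorph.addRight t).bijective]
    rfl
  refine ⟨x + t, ?_, ?_⟩
  · rw [hcompl]; exact ⟨x, hx, rfl⟩
  · have h1 := (Homeomorph.addRight t).image_connectedComponentIn hx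
    rw [hcompl]
    change _ = closure (connectedComponentIn _ (Homeomorph.addRight t x))
    rw [← h1, ← Homeomorph.image_closure, ← hKx]
    rfl

theorem translateBody_neg (t : E n) (K : ConvexBody (E n)) :
    translateBody (-t) (translateBody t K) = K := by
  apply ConvexBody.ext
  change (fun x => x + -t) '' ((fun x => x + t) '' (K : Set (E n))) = K
  rw [Set.image_image]
  simp

theorem IsCountingMeasure.cellSum_map_translate {μ : Measure (Hyperplane n)} (hμ : IsCountingMeasure μ)
    (f : ConvexBody (E n) → ENNReal) (t : E n) :
    cellSum f (μ.map (Hyperplane.translate t)) = cellSum (fun K => f (translateBody t K)) μ := by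
  rw [← hμ.tsum_cells, ← (hμ.map_translate t).tsum_cells]
  have hback : (μ.map (Hyperplane.translate t)).map (Hyperplane.translate (-t)) = μ := by
    rw [Measure.map_map (Hyperplane.measurable_translate _) (Hyperplane.measurable_translate _)]
    have : Hyperplane.translate (-t) ∘ Hyperplane.translate t = id :=
      funext (translate_neg_translate t)
    rw [this, Measure.map_id]
  let e : cells μ ≃ cells (μ.map (Hyperplane.translate t)) :=
    { toFun := fun K => ⟨translateBody t K.1, translateBody_mem_cells K.2 t⟩
      invFun := fun K => ⟨translateBody (-t) K.1, by
        have := translateBody_mem_cells K.2 (-t)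
        rwa [hback] at this⟩
      left_inv := fun K => Subtype.ext (translateBody_neg t K.1)
      right_inv := fun K => Subtype.ext (by simpa using translateBody_neg (-t) K.1) }
  exact (e.tsum_eq fun K => f K.1).symm

end Enumeration

/-! ### Mass transport: changing the center function -/

section MassTransport
variable {n : ℕ} {Ω : Type*} [MeasurableSpace Ω] {P : Measure Ω} {X : Ω → Measure (Hyperplane n)}

theorem measurable_cellSum_prod {f : E n → ConvexBody (E n) → ENNReal}
    (hf : Measurable (Function.uncurry f)) (hX : Measurable X) :
    Measurable fun p : E n × Ω => cellSum (f p.1) (X p.2) := by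
  unfold cellSum
  refine Measurable.tsum fun j => ?_
  have h1 : Measurable fun p : E n × Ω => f p.1 (cellBody n j (X p.2)) :=
    hf.comp (measurable_fst.prodMk ((measurable_cellBody j).comp (hX.comp measurable_snd)))
  exact h1.indicator ((hX.comp measurable_snd) (measurableSet_firstIn j))

theorem lintegral_cellSum {f : E n → ConvexBody (E n) → ENNReal}
    (hf : Measurable (Function.uncurry f)) (μ : Measure (Hyperplane n)) :
    ∫⁻ t, cellSum (f t) μ = cellSum (fun K => ∫⁻ t, f t K) μ := by
  unfold cellSum
  rw [lintegral_tsum]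
  · refine tsum_congr fun j => ?_
    by_cases h : μ ∈ firstIn n j <;> simp [h]
  · intro j
    by_cases h : μ ∈ firstIn n j
    · simp only [h, Set.indicator_of_mem]
      exact (hf.comp (measurable_id.prodMk measurable_const)).aemeasurable
    · simp [h]

theorem cellSum_const_mul (a : ENNReal) (f : ConvexBody (E n) → ENNReal) (μ : Measure (Hyperplane n)) :
    cellSum (fun K => a * f K) μ = a * cellSum f μ := by
  unfold cellSum
  rw [← ENNReal.tsum_mul_left]
  refine tsum_congr fun j => ?_
  by_cases h : μ ∈ firstIn n j <;> simp [h]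

theorem IsStationary.lintegral_cellSum (hX : IsHyperplaneProcess X) (hs : IsStationary P X)
    {f : ConvexBody (E n) → ENNReal} (hf : Measurable f) (t : E n) :
    ∫⁻ ω, cellSum (fun K => f (translateBody t K)) (X ω) ∂P = ∫⁻ ω, cellSum f (X ω) ∂P := by
  have hm : Measurable fun ω => (X ω).map (Hyperplane.translate t) :=
    (Measure.measurable_map _ (Hyperplane.measurable_translate t)).comp hX.measurable
  rw [← lintegral_map (measurable_cellSum hf) hX.measurable, ← hs t,
    lintegral_map (measurable_cellSum hf) hm]
  exact lintegral_congr fun ω => ((hX.counting ω).cellSum_map_translate f t).symm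

/-- Mean numbers of cells do not depend on the points that represent the cells. -/
theorem mass_transport [SFinite P] (hX : IsHyperplaneProcess X) (hs : IsStationary P X)
    {A : Set (ConvexBody (E n))} (hA : MeasurableSet A)
    (hAt : ∀ K t, translateBody t K ∈ A ↔ K ∈ A) {c₁ c₂ : ConvexBody (E n) → E n}
    (hc₁ : Measurable c₁) (hc₂ : Measurable c₂) (hct₁ : ∀ K ∈ A, ∀ t, c₁ (translateBody t K) = c₁ K + t)
    (hct₂ : ∀ K ∈ A, ∀ t, c₂ (translateBody t K) = c₂ K + t) {W₁ W₂ : Set (E n)}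
    (hW₁ : MeasurableSet W₁) (hW₂ : MeasurableSet W₂) :
    volume W₂ * ∫⁻ ω, cellSum ((A ∩ c₁ ⁻¹' W₁).indicator 1) (X ω) ∂P
      = volume W₁ * ∫⁻ ω, cellSum ((A ∩ c₂ ⁻¹' W₂).indicator 1) (X ω) ∂P := by
  classical
  -- Integrated over `t`, `f` produces `|W₂|` for each cell with `c₁` in `W₁`, and `g` produces
  -- `|W₁|` for each cell with `c₂` in `W₂`. Moreover `g t K` is `f t` evaluated at `K - t`, so
  -- stationarity equates the two means for each `t`.
  set f : E n → ConvexBody (E n) → ENNReal := fun t K =>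
    (A ∩ c₁ ⁻¹' W₁).indicator 1 K * W₂.indicator 1 (t + c₂ K) with hf
  set g : E n → ConvexBody (E n) → ENNReal := fun t K =>
    (A ∩ c₂ ⁻¹' W₂).indicator 1 K * W₁.indicator 1 (c₁ K - t) with hg
  have hfm : Measurable (Function.uncurry f) := by
    refine Measurable.mul ?_ ?_
    · exact (measurable_one.indicator (hA.inter (hc₁ hW₁))).comp measurable_snd
    · exact (measurable_one.indicator hW₂).comp (measurable_fst.add (hc₂.comp measurable_snd))
  have hgm : Measurable (Function.uncurry g) := by
    refine Measurable.mul ?_ ?_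
    · exact (measurable_one.indicator (hA.inter (hc₂ hW₂))).comp measurable_snd
    · exact (measurable_one.indicator hW₁).comp ((hc₁.comp measurable_snd).sub measurable_fst)
  have hm1 : Measurable fun ω => cellSum ((A ∩ c₁ ⁻¹' W₁).indicator 1) (X ω) :=
    (measurable_cellSum (measurable_one.indicator (hA.inter (hc₁ hW₁)))).comp hX.measurable
  have hm2 : Measurable fun ω => cellSum ((A ∩ c₂ ⁻¹' W₂).indicator 1) (X ω) :=
    (measurable_cellSum (measurable_one.indicator (hA.inter (hc₂ hW₂)))).comp hX.measurable
  have h1 : ∫⁻ t, ∫⁻ ω, cellSum (f t) (X ω) ∂P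
      = volume W₂ * ∫⁻ ω, cellSum ((A ∩ c₁ ⁻¹' W₁).indicator 1) (X ω) ∂P := by
    rw [lintegral_lintegral_swap (measurable_cellSum_prod hfm hX.measurable).aemeasurable,
      ← lintegral_const_mul _ hm1]
    refine lintegral_congr fun ω => ?_
    rw [HyperplaneTess.lintegral_cellSum hfm, ← cellSum_const_mul]
    congr 1
    funext K
    rw [hf]
    dsimp only
    rw [lintegral_const_mul' _ _ (by by_cases h : K ∈ A ∩ c₁ ⁻¹' W₁ <;> simp [h]), mul_comm]
    congr 1
    have : ∀ t : E n, W₂.indicator (1 : E n → ENNReal) (t + c₂ K)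
        = ((fun t => t + c₂ K) ⁻¹' W₂).indicator 1 t := fun t => rfl
    simp_rw [this]
    rw [lintegral_indicator_one (hW₂.preimage (measurable_add_const _)), measure_preimage_add_right]
  have h2 : ∫⁻ t, ∫⁻ ω, cellSum (g t) (X ω) ∂P
      = volume W₁ * ∫⁻ ω, cellSum ((A ∩ c₂ ⁻¹' W₂).indicator 1) (X ω) ∂P := by
    rw [lintegral_lintegral_swap (measurable_cellSum_prod hgm hX.measurable).aemeasurable,
      ← lintegral_const_mul _ hm2]
    refine lintegral_congr fun ω => ?_
    rw [HyperplaneTess.lintegral_cellSum hgm, ← cellSum_const_mul]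
    congr 1
    funext K
    have hsub : MeasurePreserving (fun t : E n => c₁ K - t) volume volume :=
      Measure.measurePreserving_sub_left volume (c₁ K)
    rw [hg]
    dsimp only
    rw [lintegral_const_mul' _ _ (by by_cases h : K ∈ A ∩ c₂ ⁻¹' W₂ <;> simp [h]), mul_comm]
    congr 1
    have : ∀ t : E n, W₁.indicator (1 : E n → ENNReal) (c₁ K - t)
        = ((fun t => c₁ K - t) ⁻¹' W₁).indicator 1 t := fun t => rfl
    simp_rw [this]
    rw [lintegral_indicator_one (hW₁.preimage hsub.measurable),
      hsub.measure_preimage hW₁.nullMeasurableSet]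
  rw [← h1, ← h2]
  refine lintegral_congr fun t => ?_
  have hft : Measurable (f t) := hfm.comp (measurable_const.prodMk measurable_id)
  rw [← hs.lintegral_cellSum hX hft (-t)]
  refine lintegral_congr fun ω => ?_
  congr 1
  funext K
  simp only [hf, hg]
  by_cases hK : K ∈ A
  · have hK' := (hAt K (-t)).mpr hK
    simp only [Set.indicator_apply, Set.mem_inter_iff, hK, hK', true_and, Set.mem_preimage,
      hct₁ K hK, hct₂ K hK, ← sub_eq_add_neg, add_sub_cancel, Pi.one_apply]
    split_ifs <;> simp
  · have hK' := mt (hAt K (-t)).mp hK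
    simp [hK, hK']

/-- For a translation invariant class of bodies, recentering the cell has no effect on membership.
-/
theorem expectedCells_eq (hX : IsHyperplaneProcess X) (c : ConvexBody (E n) → E n)
    {A : Set (ConvexBody (E n))} (hAt : ∀ K t, translateBody t K ∈ A ↔ K ∈ A) (B : Set (E n)) :
    expectedCells P X c A B = ∫⁻ ω, cellSum ((A ∩ c ⁻¹' B).indicator 1) (X ω) ∂P := by
  unfold expectedCells
  refine lintegral_congr fun ω => ?_
  rw [← (hX.counting ω).tsum_cells]
  refine tsum_congr fun K => ?_
  by_cases hK : K.1 ∈ A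
  · have hK' := (hAt K.1 (-c K.1)).mpr hK
    by_cases hB : c K.1 ∈ B <;> simp [hK, hK', hB]
  · have hK' := mt (hAt K.1 (-c K.1)).mp hK
    simp [hK, hK']

/-- Mass transport with both windows equal to `B`; the volume of `B` cancels. The new point `c'` has
to be equivariant only on `A`, which admits `lowPoint` on thick bodies. -/
theorem expectedCells_eq_encard [SFinite P] (hX : IsHyperplaneProcess X) (hs : IsStationary P X)
    {A : Set (ConvexBody (E n))} (hA : MeasurableSet A)
    (hAt : ∀ K t, translateBody t K ∈ A ↔ K ∈ A) {c c' : ConvexBody (E n) → E n}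
    (hc : IsCenterFunction c) (hc' : Measurable c')
    (hct' : ∀ K ∈ A, ∀ t, c' (translateBody t K) = c' K + t) {B : Set (E n)}
    (hB : MeasurableSet B) (hB0 : volume B ≠ 0) (hBt : volume B ≠ ⊤) :
    expectedCells P X c A B = ∫⁻ ω, ({K ∈ cells (X ω) | K ∈ A ∧ c' K ∈ B}.encard : ENNReal) ∂P := by
  have h := mass_transport hX hs hA hAt hc.measurable hc' (fun K _ => hc.translate K) hct' hB hB
  rw [ENNReal.mul_right_inj hB0 hBt] at h
  rw [expectedCells_eq hX c hAt, h]
  refine lintegral_congr fun ω => ?_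
  rw [← (hX.counting ω).tsum_cells, ← ENNReal.tsum_set_one, tsum_subtype (cells (X ω))
    ((A ∩ c' ⁻¹' B).indicator (1 : ConvexBody (E n) → ENNReal)),
    tsum_subtype {K ∈ cells (X ω) | K ∈ A ∧ c' K ∈ B} fun _ => (1 : ENNReal)]
  refine tsum_congr fun K => ?_
  by_cases h1 : K ∈ cells (X ω) <;> by_cases h2 : K ∈ A <;> by_cases h3 : c' K ∈ B <;>
    simp [h1, h2, h3]

end MassTransport

/-! ### The measure of vertex tuples and its independence of `r` -/

section Vertices
variable {n : ℕ}

theorem measurable_normal : Measurable (normal (n := n)) :=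
  measurable_subtype_coe.comp (measurable_fst.comp measurable_param)

/-- The matrix whose rows are the given vectors. -/
def rowMatrix (u : Fin n → E n) : Matrix (Fin n) (Fin n) ℝ := Matrix.of fun i j => u i j

/-- The coefficients of `v` with respect to the basis `u`. -/
noncomputable def coeffs (v : E n) (u : Fin n → E n) : Fin n → ℝ :=
  Matrix.vecMul (WithLp.ofLp v) (rowMatrix u)⁻¹

/-- The solution `x` of the linear system `⟨x, u i⟩ = b i`. -/
noncomputable def solution (u : Fin n → E n) (b : Fin n → ℝ) : E n :=
  WithLp.toLp 2 ((rowMatrix u)⁻¹.mulVec b)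

theorem continuous_rowMatrix : Continuous (rowMatrix (n := n)) :=
  continuous_matrix fun i j => by
    change Continuous fun u : Fin n → E n => u i j
    fun_prop

theorem measurable_det_rowMatrix : Measurable fun u : Fin n → E n => (rowMatrix u).det :=
  continuous_rowMatrix.matrix_det.measurable

theorem measurable_rowMatrix_inv (i j : Fin n) : Measurable fun u : Fin n → E n => (rowMatrix u)⁻¹ i j := by
  have : (fun u : Fin n → E n => (rowMatrix u)⁻¹ i j)
      = fun u => ((rowMatrix u).det)⁻¹ * (rowMatrix u).adjugate i j := by
    funext u
    rw [Matrix.inv_def, Ring.inverse_eq_inv', Matrix.smul_apply, smul_eq_mul]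
  rw [this]
  exact measurable_det_rowMatrix.inv.mul
    (continuous_rowMatrix.matrix_adjugate.matrix_elem i j).measurable

theorem measurable_coeffs (v : E n) (i : Fin n) : Measurable fun u : Fin n → E n => coeffs v u i := by
  change Measurable fun u : Fin n → E n => ∑ j, v j * (rowMatrix u)⁻¹ j i
  exact Finset.measurable_sum _ fun j _ => (measurable_rowMatrix_inv j i).const_mul _

theorem measurable_solution :
    Measurable fun p : (Fin n → E n) × (Fin n → ℝ) => solution p.1 p.2 := by
  refine (WithLp.measurable_toLp 2 (Fin n → ℝ)).comp (measurable_pi_lambda _ fun i => ?_)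
  change Measurable fun p : (Fin n → E n) × (Fin n → ℝ) => ∑ j, (rowMatrix p.1)⁻¹ i j * p.2 j
  exact Finset.measurable_sum _ fun j _ =>
    ((measurable_rowMatrix_inv i j).comp measurable_fst).mul ((measurable_pi_apply j).comp measurable_snd)

theorem measurable_real_sign : Measurable Real.sign := by
  unfold Real.sign
  exact Measurable.ite measurableSet_Iio measurable_const
    (Measurable.ite measurableSet_Ioi measurable_const measurable_const)

theorem linearIndependent_iff_det {u : Fin n → E n} :
    LinearIndependent ℝ u ↔ (rowMatrix u).det ≠ 0 := by
  rw [← isUnit_iff_ne_zero, ← Matrix.isUnit_iff_isUnit_det, ← Matrix.linearIndependent_rows_iff_isUnit]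
  exact (LinearMap.linearIndependent_iff (WithLp.linearEquiv 2 ℝ (Fin n → ℝ)).toLinearMap
    (LinearEquiv.ker _)).symm

theorem inner_eq_mulVec (u : Fin n → E n) (x : E n) (i : Fin n) :
    inner ℝ x (u i) = (rowMatrix u).mulVec (WithLp.ofLp x) i := by
  simp [Matrix.mulVec, dotProduct, rowMatrix, PiLp.inner_apply]

theorem sum_smul_eq_vecMul (u : Fin n → E n) (a : Fin n → ℝ) :
    WithLp.ofLp (∑ i, a i • u i) = Matrix.vecMul a (rowMatrix u) := by
  ext j
  simp [Matrix.vecMul, dotProduct, rowMatrix]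

/-- Solving the linear systems by the inverse matrix yields measurability, and shows that for fixed
normals the distances `τ` and the radius `r` enter only through the sums `τ i + sign (a i) * r`. -/
theorem isVertex_iff {v : E n} {r : ℝ} {h : Fin n → Hyperplane n} {x : E n} :
    IsVertex v r h x ↔ (rowMatrix fun i => normal (h i)).det ≠ 0 ∧
      (∀ i, coeffs v (fun i => normal (h i)) i ≠ 0) ∧
      solution (fun i => normal (h i))
        (fun i => (param (h i)).2 + Real.sign (coeffs v (fun i => normal (h i)) i) * r) = x := by
  set u := fun i => normal (h i) with hu
  have hcoef : (rowMatrix u).det ≠ 0 → ∀ a : Fin n → ℝ, v = ∑ i, a i • u i ↔ a = coeffs v u := by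
    intro hdet a
    have hunit : IsUnit (rowMatrix u).det := isUnit_iff_ne_zero.mpr hdet
    constructor
    · rintro rfl
      rw [coeffs, sum_smul_eq_vecMul, Matrix.vecMul_vecMul, Matrix.mul_nonsing_inv _ hunit,
        Matrix.vecMul_one]
    · rintro rfl
      apply WithLp.ofLp_injective 2
      rw [sum_smul_eq_vecMul, coeffs, Matrix.vecMul_vecMul, Matrix.nonsing_inv_mul _ hunit,
        Matrix.vecMul_one]
  have hsol : (rowMatrix u).det ≠ 0 → ∀ b : Fin n → ℝ, (∀ i, inner ℝ x (u i) = b i) ↔ solution u b = x := by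
    intro hdet b
    have hunit : IsUnit (rowMatrix u).det := isUnit_iff_ne_zero.mpr hdet
    constructor
    · intro hb
      have : b = (rowMatrix u).mulVec (WithLp.ofLp x) := funext fun i => by rw [← hb, inner_eq_mulVec]
      rw [solution, this, Matrix.mulVec_mulVec, Matrix.nonsing_inv_mul _ hunit, Matrix.one_mulVec]
    · rintro rfl i
      rw [inner_eq_mulVec, solution, Matrix.mulVec_mulVec, Matrix.mul_nonsing_inv _ hunit,
        Matrix.one_mulVec]
  constructor
  · rintro ⟨hli, a, ha, hva, hxa⟩
    have hdet := linearIndependent_iff_det.mp hli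
    obtain rfl := (hcoef hdet a).mp hva
    refine ⟨hdet, ha, (hsol hdet _).mp fun i => ?_⟩
    have := hxa i
    unfold height at this
    linarith
  · rintro ⟨hdet, ha, hx⟩
    refine ⟨linearIndependent_iff_det.mpr hdet, _, ha, (hcoef hdet _).mpr rfl, fun i => ?_⟩
    have := (hsol hdet _).mpr hx i
    unfold height
    change inner ℝ x (u i) - _ = _
    linarith

/-- The tuples of hyperplanes tangent to a ball of radius `r` that has a point of `B` as its center,
in the sense of `IsVertex`. -/
def vertexTuples (v : E n) (r : ℝ) (B : Set (E n)) : Set (Fin n → Hyperplane n) :=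
  {h | ∃ x ∈ B, IsVertex v r h x}

/-- The parameters of `vertexTuples`. -/
def vertexParams (v : E n) (r : ℝ) (B : Set (E n)) : Set (Fin n → Metric.sphere (0 : E n) 1 × ℝ) :=
  {p | (rowMatrix fun i => ((p i).1 : E n)).det ≠ 0 ∧
      (∀ i, coeffs v (fun i => ((p i).1 : E n)) i ≠ 0) ∧
      solution (fun i => ((p i).1 : E n))
        (fun i => (p i).2 + Real.sign (coeffs v (fun i => ((p i).1 : E n)) i) * r) ∈ B}

theorem vertexTuples_eq (v : E n) (r : ℝ) (B : Set (E n)) :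
    vertexTuples v r B = (fun h i => param (h i)) ⁻¹' vertexParams v r B := by
  ext h
  constructor
  · rintro ⟨x, hx, hv⟩
    obtain ⟨h1, h2, h3⟩ := isVertex_iff.mp hv
    exact ⟨h1, h2, by rw [← h3] at hx; exact hx⟩
  · rintro ⟨h1, h2, h3⟩
    exact ⟨_, h3, isVertex_iff.mpr ⟨h1, h2, rfl⟩⟩

theorem measurableSet_vertexParams (v : E n) (r : ℝ) {B : Set (E n)} (hB : MeasurableSet B) :
    MeasurableSet (vertexParams v r B) := by
  have hu : Measurable fun p : Fin n → Metric.sphere (0 : E n) 1 × ℝ => fun i => ((p i).1 : E n) :=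
    measurable_pi_lambda _ fun i =>
      measurable_subtype_coe.comp (measurable_fst.comp (measurable_pi_apply i))
  have hc : ∀ i, Measurable fun p : Fin n → Metric.sphere (0 : E n) 1 × ℝ =>
      coeffs v (fun i => ((p i).1 : E n)) i := fun i => (measurable_coeffs v i).comp hu
  refine ((measurable_det_rowMatrix.comp hu) (measurableSet_singleton 0).compl).inter
    (MeasurableSet.inter ?_ ?_)
  · have : {p : Fin n → Metric.sphere (0 : E n) 1 × ℝ | ∀ i, coeffs v (fun i => ((p i).1 : E n)) i ≠ 0}
        = ⋂ i, (fun p : Fin n → Metric.sphere (0 : E n) 1 × ℝ =>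
          coeffs v (fun i => ((p i).1 : E n)) i) ⁻¹' {0}ᶜ := by
      ext; simp
    have h2 : MeasurableSet {p : Fin n → Metric.sphere (0 : E n) 1 × ℝ |
        ∀ i, coeffs v (fun i => ((p i).1 : E n)) i ≠ 0} := by
      rw [this]
      exact MeasurableSet.iInter fun i => hc i (measurableSet_singleton 0).compl
    exact h2
  · refine (measurable_solution.comp (hu.prodMk (measurable_pi_lambda _ fun i => ?_))) hB
    exact (measurable_snd.comp (measurable_pi_apply i)).add
      ((measurable_real_sign.comp (hc i)).mul_const r)

theorem measurable_param_pi (m : ℕ) :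
    Measurable fun (h : Fin m → Hyperplane n) i => param (h i) :=
  measurable_pi_lambda _ fun i => measurable_param.comp (measurable_pi_apply i)

theorem measurableSet_vertexTuples (v : E n) (r : ℝ) {B : Set (E n)} (hB : MeasurableSet B) :
    MeasurableSet (vertexTuples v r B) := by
  rw [vertexTuples_eq]
  exact measurable_param_pi n (measurableSet_vertexParams v r hB)

variable {Θ : Measure (Hyperplane n)} {φ : Measure (Metric.sphere (0 : E n) 1)} {γ : ℝ}

theorem sigmaFinite_smul_volume (γ : ℝ) : SigmaFinite (ENNReal.ofReal γ • (volume : Measure ℝ)) :=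
  inferInstanceAs (SigmaFinite ((Real.toNNReal γ) • (volume : Measure ℝ)))

/-- The product of the intensity measure, in terms of the product of the directional distribution
and of the product of the Lebesgue measure. -/
theorem pi_intensity_preimage [IsProbabilityMeasure φ] [SigmaFinite Θ]
    (hΘ : Θ.map param = φ.prod (ENNReal.ofReal γ • volume)) {m : ℕ}
    {Q : Set (Fin m → Metric.sphere (0 : E n) 1 × ℝ)} (hQ : MeasurableSet Q) :
    Measure.pi (fun _ => Θ) ((fun h i => param (h i)) ⁻¹' Q)
      = (Measure.pi fun _ : Fin m => φ).prod
          (Measure.pi fun _ : Fin m => ENNReal.ofReal γ • (volume : Measure ℝ))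
          {p | (fun i => (p.1 i, p.2 i)) ∈ Q} := by
  have := sigmaFinite_smul_volume γ
  have hσ : ∀ _ : Fin m, SigmaFinite (Θ.map param) := fun _ => by rw [hΘ]; infer_instance
  have h1 := Measure.pi_map_pi (hμ := hσ) (μ := fun _ : Fin m => Θ) (f := fun _ => param)
    (fun _ => measurable_param.aemeasurable)
  rw [← Measure.map_apply (measurable_param_pi m) hQ, h1]
  simp_rw [hΘ]
  have h2 := (measurePreserving_arrowProdEquivProdArrow (Metric.sphere (0 : E n) 1) ℝ (Fin m)
    (fun _ => φ) (fun _ => ENNReal.ofReal γ • (volume : Measure ℝ))).symm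
  rw [← h2.measure_preimage hQ.nullMeasurableSet]
  rfl

theorem pi_smul_volume (g : ENNReal) (hg : SigmaFinite (g • (volume : Measure ℝ))) (m : ℕ) :
    Measure.pi (fun _ : Fin m => g • (volume : Measure ℝ)) = g ^ m • volume := by
  refine Measure.pi_eq fun s hs => ?_
  simp [Measure.smul_apply, volume_pi, Measure.pi_pi, Finset.prod_mul_distrib]

/-- With the normals fixed, the coefficients of `v` and their signs are fixed too. Passing from `r`
to `0` is then a translation of the vector of distances, under which Lebesgue measure is invariant.
-/
theorem pi_intensity_vertexTuples [IsProbabilityMeasure φ] [SigmaFinite Θ]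
    (hΘ : Θ.map param = φ.prod (ENNReal.ofReal γ • volume)) (v : E n) (r : ℝ) {B : Set (E n)}
    (hB : MeasurableSet B) :
    Measure.pi (fun _ => Θ) (vertexTuples v r B) = Measure.pi (fun _ => Θ) (vertexTuples v 0 B) := by
  have := sigmaFinite_smul_volume γ
  have hsplit : Measurable fun p : (Fin n → Metric.sphere (0 : E n) 1) × (Fin n → ℝ) =>
      fun i => (p.1 i, p.2 i) := by fun_prop
  have hm : ∀ r, MeasurableSet {p : (Fin n → Metric.sphere (0 : E n) 1) × (Fin n → ℝ) |
      (fun i => (p.1 i, p.2 i)) ∈ vertexParams v r B} :=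
    fun r => hsplit (measurableSet_vertexParams v r hB)
  rw [vertexTuples_eq, vertexTuples_eq, pi_intensity_preimage hΘ (measurableSet_vertexParams v r hB),
    pi_intensity_preimage hΘ (measurableSet_vertexParams v 0 hB),
    Measure.prod_apply (hm r), Measure.prod_apply (hm 0)]
  refine lintegral_congr fun u => ?_
  rw [pi_smul_volume _ this, Measure.smul_apply, Measure.smul_apply]
  congr 1
  symm
  rw [← measure_preimage_add_right volume
    (fun i => Real.sign (coeffs v (fun i => (u i : E n)) i) * r)]
  congr 1
  ext τ
  simp [vertexParams]

theorem measurableSet_injective (m : ℕ) :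
    MeasurableSet {h : Fin m → Hyperplane n | Function.Injective h} := by
  have : {h : Fin m → Hyperplane n | Function.Injective h}
      = ⋂ i, ⋂ j, ⋂ (_ : i ≠ j), {h | param (h i) = param (h j)}ᶜ := by
    ext h
    simp only [Set.mem_ofPred_eq, Set.mem_iInter, Set.mem_compl_iff, injective_param.eq_iff]
    exact ⟨fun hh i j hij he => hij (hh he), fun hh i j he => by_contra fun hij => hh i j hij he⟩
  rw [this]
  exact MeasurableSet.iInter fun i => MeasurableSet.iInter fun j => MeasurableSet.iInter fun _ =>
    (measurableSet_eq_fun (measurable_param.comp (measurable_pi_apply i))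
      (measurable_param.comp (measurable_pi_apply j))).compl

end Vertices

/-! ### General position holds almost surely -/

section NullSets
variable {n : ℕ}

/-- Projection along a compact space is closed; along a σ-compact space the image is a countable
union of closed sets. -/
theorem measurableSet_exists_of_isClosed {C Y : Type*} [TopologicalSpace C] [SigmaCompactSpace C]
    [TopologicalSpace Y] [MeasurableSpace Y] [OpensMeasurableSpace Y] {F : Set (C × Y)}
    (hF : IsClosed F) : MeasurableSet {y | ∃ c, (c, y) ∈ F} := by
  have : {y | ∃ c, (c, y) ∈ F} = ⋃ k, {y | ∃ c : compactCovering C k, ((c : C), y) ∈ F} := by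
    ext y
    simp only [Set.mem_ofPred_eq, Set.mem_iUnion]
    constructor
    · rintro ⟨c, hc⟩
      obtain ⟨k, hk⟩ := exists_mem_compactCovering c
      exact ⟨k, ⟨c, hk⟩, hc⟩
    · rintro ⟨k, c, hc⟩
      exact ⟨c, hc⟩
  rw [this]
  refine MeasurableSet.iUnion fun k => IsClosed.measurableSet ?_
  have : CompactSpace (compactCovering C k) := isCompact_iff_compactSpace.mp (isCompact_compactCovering C k)
  have hcl : IsClosed {p : compactCovering C k × Y | ((p.1 : C), p.2) ∈ F} :=
    hF.preimage (by fun_prop)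
  have himg := isClosedMap_snd_of_compactSpace _ hcl
  convert himg using 1
  ext y
  simp

/-- The parameters of tuples of hyperplanes at a common distance `r` from some point. -/
def tangentParams (n m : ℕ) (r : ℝ) : Set (Fin m → Metric.sphere (0 : E n) 1 × ℝ) :=
  {p | ∃ x : E n, ∀ i, |inner ℝ x ((p i).1 : E n) - (p i).2| = r}

theorem measurableSet_tangentParams (m : ℕ) (r : ℝ) : MeasurableSet (tangentParams n m r) := by
  have hF : IsClosed {q : E n × (Fin m → Metric.sphere (0 : E n) 1 × ℝ) |
      ∀ i, |inner ℝ q.1 ((q.2 i).1 : E n) - (q.2 i).2| = r} := by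
    rw [Set.ofPred_forall]
    exact isClosed_iInter fun i => isClosed_eq (by fun_prop) continuous_const
  exact measurableSet_exists_of_isClosed hF

/-- The vectors `(⟨x, u i⟩)` of `n + 1` products depend linearly on `x` in dimension `n`, so they
fill only a proper subspace. The set in question lies in finitely many translates of it, one for
each choice of signs. -/
theorem volume_tangent_eq_zero (u : Fin (n + 1) → E n) (r : ℝ) :
    volume {τ : Fin (n + 1) → ℝ | ∃ x : E n, ∀ i, |inner ℝ x (u i) - τ i| = r} = 0 := by
  let L : E n →ₗ[ℝ] (Fin (n + 1) → ℝ) := LinearMap.pi fun i => (innerₗ (E n)).flip (u i)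
  have hL : LinearMap.range L ≠ ⊤ := fun h => by
    have h1 := LinearMap.finrank_range_le L
    rw [h, finrank_top] at h1
    simp at h1
  have hsub : {τ : Fin (n + 1) → ℝ | ∃ x : E n, ∀ i, |inner ℝ x (u i) - τ i| = r} ⊆
      ⋃ s : Fin (n + 1) → Bool, (fun τ => τ + fun i => if s i then r else -r) ⁻¹'
        (LinearMap.range L : Set (Fin (n + 1) → ℝ)) := by
    rintro τ ⟨x, hx⟩
    refine Set.mem_iUnion.mpr ⟨fun i => decide (inner ℝ x (u i) - τ i = r), x, ?_⟩
    ext i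
    change inner ℝ x (u i) = τ i + if (decide (inner ℝ x (u i) - τ i = r)) = true then r else -r
    simp only [decide_eq_true_eq]
    split_ifs with h
    · linarith
    · rcases eq_or_eq_neg_of_abs_eq (hx i) with h' | h'
      · exact (h h').elim
      · linarith
  refine measure_mono_null hsub (measure_iUnion_null fun s => ?_)
  rw [measure_preimage_add_right]
  exact Measure.addHaar_submodule _ _ hL

variable {Θ : Measure (Hyperplane n)} {φ : Measure (Metric.sphere (0 : E n) 1)} {γ : ℝ}

theorem pi_intensity_tangent [IsProbabilityMeasure φ] [SigmaFinite Θ]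
    (hΘ : Θ.map param = φ.prod (ENNReal.ofReal γ • volume)) (r : ℝ) :
    Measure.pi (fun _ => Θ) {h : Fin (n + 1) → Hyperplane n | ∃ x, ∀ i, |height (h i) x| = r} = 0 := by
  have hs := sigmaFinite_smul_volume γ
  have hset : {h : Fin (n + 1) → Hyperplane n | ∃ x, ∀ i, |height (h i) x| = r}
      = (fun h i => param (h i)) ⁻¹' tangentParams n (n + 1) r := rfl
  have hm : MeasurableSet {p : (Fin (n + 1) → Metric.sphere (0 : E n) 1) × (Fin (n + 1) → ℝ) |
      (fun i => (p.1 i, p.2 i)) ∈ tangentParams n (n + 1) r} :=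
    (show Measurable fun p : (Fin (n + 1) → Metric.sphere (0 : E n) 1) × (Fin (n + 1) → ℝ) =>
      fun i => (p.1 i, p.2 i) by fun_prop) (measurableSet_tangentParams _ r)
  rw [hset, pi_intensity_preimage hΘ (measurableSet_tangentParams _ r), Measure.measure_prod_null hm]
  refine Eventually.of_forall fun u => ?_
  rw [pi_smul_volume _ hs]
  have := volume_tangent_eq_zero (fun i => (u i : E n)) r
  change ENNReal.ofReal γ ^ (n + 1) • volume {τ : Fin (n + 1) → ℝ | ∃ x : E n, ∀ i, |inner ℝ x (u i : E n) - τ i| = r} = 0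
  rw [this, smul_zero]

theorem measurableSet_tangent (m : ℕ) (r : ℝ) :
    MeasurableSet {h : Fin m → Hyperplane n | ∃ x, ∀ i, |height (h i) x| = r} :=
  measurable_param_pi m (measurableSet_tangentParams m r)

theorem measurableSet_mem_span (m : ℕ) :
    MeasurableSet {p : E n × (Fin m → Hyperplane n) |
      p.1 ∈ Submodule.span ℝ (Set.range fun i => normal (p.2 i))} := by
  have hF : IsClosed {q : (Fin m → ℝ) × (E n × (Fin m → E n)) | ∑ i, q.1 i • q.2.2 i = q.2.1} :=
    isClosed_eq (by fun_prop) (by fun_prop)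
  have hn : Measurable fun p : E n × (Fin m → Hyperplane n) => (p.1, fun i => normal (p.2 i)) :=
    measurable_fst.prodMk (measurable_pi_lambda _ fun i =>
      measurable_normal.comp ((measurable_pi_apply i).comp measurable_snd))
  convert hn (measurableSet_exists_of_isClosed hF) using 1
  ext p
  exact Submodule.mem_span_range_iff_exists_fun ℝ

/-- Fewer than `n` normals span a Lebesgue null set; by Fubini almost every `v` avoids the span for
almost all tuples. This fixes one deterministic `v` before the process is sampled. -/
theorem exists_generic_direction (Θ : Measure (Hyperplane n)) [SigmaFinite Θ] :
    ∃ v : E n, ∀ m < n, Measure.pi (fun _ => Θ)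
      {h : Fin m → Hyperplane n | v ∈ Submodule.span ℝ (Set.range fun i => normal (h i))} = 0 := by
  have hall : ∀ m : Fin n, ∀ᵐ v : E n, Measure.pi (fun _ => Θ)
      {h : Fin m → Hyperplane n | v ∈ Submodule.span ℝ (Set.range fun i => normal (h i))} = 0 := by
    intro m
    have hm := measurableSet_mem_span (n := n) m
    have h0 : (volume.prod (Measure.pi fun _ : Fin m => Θ)) {p : E n × (Fin m → Hyperplane n) |
      p.1 ∈ Submodule.span ℝ (Set.range fun i => normal (p.2 i))} = 0 := by
      rw [Measure.prod_apply_symm hm, lintegral_eq_zero_iff (measurable_measure_prodMk_right hm)]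
      refine Eventually.of_forall fun h => ?_
      refine Measure.addHaar_submodule volume (Submodule.span ℝ (Set.range fun i => normal (h i))) ?_
      intro htop
      have h1 := finrank_range_le_card (R := ℝ) fun i => normal (h i)
      rw [Set.finrank, htop, finrank_top] at h1
      simp only [finrank_euclideanSpace, Fintype.card_fin] at h1
      have := m.2
      omega
    exact (Measure.measure_prod_null hm).mp h0
  obtain ⟨v, hv⟩ := (ae_all_iff.mpr hall).exists
  exact ⟨v, fun m hm => hv ⟨m, hm⟩⟩

variable {Ω : Type*} [MeasurableSpace Ω] {P : Measure Ω}
  {X : Ω → Measure (Hyperplane n)} {S : ℕ → Set (Hyperplane n)}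

theorem IsPoissonProcess.ae_noCommonTangent [IsProbabilityMeasure φ]
    (hΘ : Θ.map param = φ.prod (ENNReal.ofReal γ • volume)) (hX : IsPoissonProcess P X Θ S) (r : ℝ) :
    ∀ᵐ ω ∂P, NoCommonTangent r (atoms (X ω)) := by
  have := hX.sigmaFinite
  have h := hX.ae_tuples_eq_empty (D := {h | Function.Injective h} ∩
      {h : Fin (n + 1) → Hyperplane n | ∃ x, ∀ i, |height (h i) x| = r})
    ((measurableSet_injective _).inter (measurableSet_tangent _ r)) (fun h hh => hh.1)
    (measure_mono_null Set.inter_subset_right (pi_intensity_tangent hΘ r))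
  filter_upwards [h] with ω hω h hinj hA x hx
  exact Set.eq_empty_iff_forall_notMem.mp hω h ⟨⟨hinj, x, hx⟩, hA⟩

theorem IsPoissonProcess.exists_ae_genericDirection (hX : IsPoissonProcess P X Θ S) :
    ∃ v : E n, ∀ᵐ ω ∂P, GenericDirection v (atoms (X ω)) := by
  have := hX.sigmaFinite
  obtain ⟨v, hv⟩ := exists_generic_direction Θ
  refine ⟨v, ?_⟩
  have h : ∀ m : Fin n, ∀ᵐ ω ∂P, tuples (X ω) ({h | Function.Injective h} ∩
      {h : Fin m → Hyperplane n | v ∈ Submodule.span ℝ (Set.range fun i => normal (h i))}) = ∅ := fun m =>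
    hX.ae_tuples_eq_empty
      ((measurableSet_injective _).inter (measurable_prodMk_left (x := v) (measurableSet_mem_span m)))
      (fun h hh => hh.1) (measure_mono_null Set.inter_subset_right (hv m m.2))
  filter_upwards [ae_all_iff.mpr h] with ω hω m hm h hinj hA hmem
  exact Set.eq_empty_iff_forall_notMem.mp (hω ⟨m, hm⟩) h ⟨⟨hinj, hmem⟩, hA⟩

end NullSets

/-! ### Simplicity of the process and boundedness of the cells -/

section Boundedness
variable {n : ℕ} {Ω : Type*} [MeasurableSpace Ω] {P : Measure Ω} {X : Ω → Measure (Hyperplane n)}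
  {γ : ℝ}

theorem IsStationaryIsotropicPoisson.isPoissonProcess (hX : IsStationaryIsotropicPoisson P X γ) :
    IsPoissonProcess P X (intensityMeasure P X) fun k : ℕ => hitting (Metric.closedBall 0 k) where
  measurable := hX.process.measurable
  counting ω := (hX.process.counting ω).isSumDirac
  joint := hX.poisson
  cover := by
    refine Set.eq_univ_of_forall fun H => Set.mem_iUnion.mpr ?_
    obtain ⟨k, hk⟩ := exists_nat_ge |height H 0|
    exact ⟨k, (mem_hitting_closedBall H 0).mpr hk⟩
  measurableSet k := measurableSet_hitting (isCompact_closedBall _ _)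
  finite ω k := (hX.process.counting ω).2 _ (isCompact_closedBall _ _)
  finite_intensity k := by
    obtain ⟨φ, hφ, hΘ⟩ := hX.intensity.exists_map_param
    rw [intensity_hitting_closedBall hΘ]
    exact ENNReal.mul_lt_top ENNReal.ofReal_lt_top ENNReal.ofReal_lt_top

theorem measurable_height (q : E n) : Measurable fun H => height H q := by
  unfold height
  exact (measurable_const.inner measurable_normal).sub (measurable_snd.comp measurable_param)

theorem IsStationaryIsotropicPoisson.ae_simple [IsProbabilityMeasure P]
    (hX : IsStationaryIsotropicPoisson P X γ) : ∀ᵐ ω ∂P, ∀ H, X ω {H} ≤ 1 := by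
  obtain ⟨φ, hφ, hΘ⟩ := hX.intensity.exists_map_param
  refine hX.isPoissonProcess.ae_simple fun k => ⟨ENNReal.ofReal γ * ENNReal.ofReal (2 * k + 1),
    ENNReal.mul_lt_top ENNReal.ofReal_lt_top ENNReal.ofReal_lt_top, fun M => ?_⟩
  have hM : (0 : ℝ) < ((M + 1 : ℕ) : ℝ) := by positivity
  -- The heights at the origin lie in `[-k, k]`, which is cut into `M + 1` intervals of this width.
  -- The extra `1` keeps the width positive for `k = 0` and the last index below `M + 1`.
  set d : ℝ := (2 * k + 1) / (M + 1 : ℕ) with hd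
  have hd0 : 0 < d := by positivity
  refine ⟨fun i => {H | height H 0 ∈ Set.Icc (-k + i * d) (-k + (i + 1) * d)},
    fun i => measurable_height 0 measurableSet_Icc, fun H hH => ?_, fun i => ?_⟩
  · rw [mem_hitting_closedBall, abs_le] at hH
    have h0 : 0 ≤ (height H 0 + k) / d := div_nonneg (by linarith) hd0.le
    have hlt : ⌊(height H 0 + k) / d⌋₊ < M + 1 := by
      rw [Nat.floor_lt h0, div_lt_iff₀ hd0, hd, mul_div_cancel₀ _ hM.ne']
      linarith
    refine Set.mem_iUnion.mpr ⟨⟨_, hlt⟩, ?_⟩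
    have h1 := Nat.floor_le h0
    have h2 := Nat.lt_floor_add_one ((height H 0 + k) / d)
    rw [le_div_iff₀ hd0] at h1
    rw [div_lt_iff₀ hd0] at h2
    exact ⟨by dsimp only; linarith, by dsimp only; linarith⟩
  · rw [intensity_height_preimage hΘ 0 measurableSet_Icc, Measure.measure_neg, Real.volume_Icc,
      mul_div_assoc]
    gcongr
    rw [← ENNReal.ofReal_natCast, ← ENNReal.ofReal_div_of_pos hM]
    refine ENNReal.ofReal_le_ofReal (le_of_eq ?_)
    rw [← hd]; ring

theorem intensity_param_preimage {Θ : Measure (Hyperplane n)} {φ : Measure (Metric.sphere (0 : E n) 1)}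
    [IsProbabilityMeasure φ] (hΘ : Θ.map param = φ.prod (ENNReal.ofReal γ • volume))
    {C : Set (Metric.sphere (0 : E n) 1)} (hC : MeasurableSet C) {J : Set ℝ} (hJ : MeasurableSet J) :
    Θ {H | (param H).1 ∈ C ∧ (param H).2 ∈ J} = φ C * (ENNReal.ofReal γ * volume J) := by
  have := sigmaFinite_smul_volume γ
  have h := Measure.map_apply (μ := Θ) measurable_param (hC.prod hJ)
  rw [hΘ, Measure.prod_prod] at h
  exact h.symm

/-- Each set of directions of positive measure contains normals of arbitrarily far hyperplanes. -/
theorem IsStationaryIsotropicPoisson.ae_exists_atom (hX : IsStationaryIsotropicPoisson P X γ)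
    {φ : Measure (Metric.sphere (0 : E n) 1)} [IsProbabilityMeasure φ]
    (hΘ : (intensityMeasure P X).map param = φ.prod (ENNReal.ofReal γ • volume))
    {C : Set (Metric.sphere (0 : E n) 1)} (hC : MeasurableSet C) (hφ : φ C ≠ 0) {J : ℕ → Set ℝ}
    (hJ : ∀ M, MeasurableSet (J M)) (hvol : ∀ M, volume (J M) = M) :
    ∀ᵐ ω ∂P, ∃ H ∈ atoms (X ω), (param H).1 ∈ C ∧ ∃ M, (param H).2 ∈ J M := by
  have hY := hX.isPoissonProcess
  set A : ℕ → Set (Hyperplane n) := fun M => {H | (param H).1 ∈ C ∧ (param H).2 ∈ J M}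
  have hA : ∀ M, MeasurableSet (A M) := fun M => measurable_param (hC.prod (hJ M))
  have hΘA : ∀ M : ℕ, intensityMeasure P X (A M) = φ C * (ENNReal.ofReal γ * M) := fun M => by
    rw [← hvol M]; exact intensity_param_preimage hΘ hC (hJ M)
  have hfin : ∀ M, intensityMeasure P X (A M) < ⊤ := fun M => by
    rw [hΘA]
    exact ENNReal.mul_lt_top (measure_lt_top φ C)
      (ENNReal.mul_lt_top ENNReal.ofReal_lt_top (ENNReal.natCast_lt_top M))
  have hγ := hX.intensity.1
  set κ : ℝ := (φ C).toReal * γ with hκ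
  have hκ0 : 0 < κ := mul_pos (ENNReal.toReal_pos hφ (measure_ne_top φ C)) hγ
  have hprob : ∀ M : ℕ, P {ω | ∀ M, X ω (A M) = 0} ≤ ENNReal.ofReal (Real.exp (-(κ * M))) := fun M => by
    have hsub : {ω | ∀ M, X ω (A M) = 0} ⊆ {ω | X ω (A M) = (0 : ℕ)} := fun ω hω => by
      simpa using Set.mem_ofPred_eq.mp hω M
    refine (measure_mono hsub).trans ?_
    · rw [hY.prob_eq (hA M) (hfin M) 0, hΘA]
      simp only [pow_zero, Nat.factorial_zero, Nat.cast_one, div_one, one_mul]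
      refine ENNReal.ofReal_le_ofReal (le_of_eq ?_)
      rw [ENNReal.toReal_mul, ENNReal.toReal_mul, ENNReal.toReal_ofReal hγ.le, ENNReal.toReal_natCast,
        hκ, mul_assoc]
  have hlim : Tendsto (fun M : ℕ => ENNReal.ofReal (Real.exp (-(κ * M)))) atTop (𝓝 0) := by
    rw [← ENNReal.ofReal_zero]
    refine ENNReal.tendsto_ofReal (Real.tendsto_exp_neg_atTop_nhds_zero.comp ?_)
    exact tendsto_natCast_atTop_atTop.const_mul_atTop hκ0
  have hzero : P {ω | ∀ M, X ω (A M) = 0} = 0 :=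
    le_antisymm (ge_of_tendsto' hlim hprob) zero_le
  have hae : ∀ᵐ ω ∂P, ¬ ∀ M, X ω (A M) = 0 := by
    rw [ae_iff]; simpa using hzero
  filter_upwards [hae] with ω hω
  obtain ⟨M, hM⟩ := not_forall.mp hω
  rw [((hX.process.counting ω).isSumDirac).eq_zero_iff (hA M)] at hM
  push Not at hM
  obtain ⟨H, hH, hHA⟩ := hM
  exact ⟨H, hH, hHA.1, M, hHA.2⟩

/-- An unbounded closed convex set contains a ray from each of its points, here from `x₀`. The
hypothesis provides a hyperplane that blocks this ray. -/
theorem isCompact_closedCell {A : Set (Hyperplane n)} {x₀ : E n}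
    (hA : ∀ w : E n, w ≠ 0 → ∃ H ∈ A, height H x₀ * inner ℝ w (normal H) < 0) :
    IsCompact (closedCell A x₀) := by
  refine Metric.isCompact_of_isClosed_isBounded (isClosed_closedCell A x₀) ?_
  by_contra hb
  obtain ⟨w, hw, hcone⟩ := not_bounded_iff_exists_ne_zero_mem_asymptoticCone.mp hb
  obtain ⟨H, hH, hneg⟩ := hA w hw
  have hmem : ∀ t : ℝ, 0 ≤ t → t • w + x₀ ∈ closedCell A x₀ := fun t ht =>
    (convex_closedCell A x₀).smul_vadd_mem_of_isClosed_of_mem_asymptoticCone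
      (isClosed_closedCell A x₀) ht hcone (fun G _ => mul_self_nonneg _)
  set b := height H x₀ * inner ℝ w (normal H) with hbdef
  have hx : 0 ≤ height H x₀ ^ 2 := sq_nonneg _
  -- At this time the product of the heights at `x₀` and at the moving point equals `-1`.
  have h1 := hmem ((height H x₀ ^ 2 + 1) / -b) (by apply div_nonneg <;> linarith) H hH
  rw [add_comm, height_add, real_inner_smul_left, mul_add] at h1
  have h2 : height H x₀ * ((height H x₀ ^ 2 + 1) / -b * inner ℝ w (normal H)) = -(height H x₀ ^ 2 + 1) := by
    calc _ = (height H x₀ ^ 2 + 1) / -b * b := by rw [hbdef]; ring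
      _ = _ := by rw [div_neg, neg_mul, div_mul_cancel₀ _ hneg.ne]
  rw [h2] at h1
  nlinarith

theorem not_mem_cells_of_inner_eq_zero {μ : Measure (Hyperplane n)} {w : E n} (hw : w ≠ 0)
    (h : ∀ H ∈ atoms μ, inner ℝ w (normal H) = 0) (K : ConvexBody (E n)) : K ∉ cells μ := by
  intro hK
  obtain ⟨x, hx, hKx⟩ := mem_cells_iff.mp hK
  obtain ⟨R, hR⟩ := K.isCompact.isBounded.exists_norm_le
  have hmem : x + ((R + ‖x‖ + 1) / ‖w‖) • w ∈ (K : Set (E n)) := by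
    rw [hKx]
    intro H hH
    rw [height_add, real_inner_smul_left, h H hH, mul_zero, add_zero]
    exact mul_self_nonneg _
  have hxK : x ∈ (K : Set (E n)) := by rw [hKx]; exact fun H _ => mul_self_nonneg _
  have h1 := hR _ hmem
  have h2 := norm_sub_le (x + ((R + ‖x‖ + 1) / ‖w‖) • w) x
  rw [add_sub_cancel_left, norm_smul, Real.norm_eq_abs, abs_div, abs_norm,
    div_mul_cancel₀ _ (norm_ne_zero_iff.mpr hw)] at h2
  have h3 := le_abs_self (R + ‖x‖ + 1)
  linarith

/-- If there are cells at all, then no direction is orthogonal to almost all normals. -/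
theorem IsStationaryIsotropicPoisson.measure_inner_ne_zero (hX : IsStationaryIsotropicPoisson P X γ)
    {φ : Measure (Metric.sphere (0 : E n) 1)} [IsProbabilityMeasure φ]
    (hΘ : (intensityMeasure P X).map param = φ.prod (ENNReal.ofReal γ • volume))
    {c : ConvexBody (E n) → E n} {A : Set (ConvexBody (E n))} {B : Set (E n)}
    (hne : expectedCells P X c A B ≠ 0) {w : E n} (hw : w ≠ 0) :
    φ {u | inner ℝ w (u : E n) ≠ 0} ≠ 0 := by
  intro h0
  have hC : MeasurableSet {u : Metric.sphere (0 : E n) 1 | inner ℝ w (u : E n) ≠ 0} :=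
    (show Measurable fun u : Metric.sphere (0 : E n) 1 => inner ℝ w (u : E n) by fun_prop)
      (measurableSet_singleton 0).compl
  have h1 := intensity_param_preimage hΘ hC MeasurableSet.univ
  rw [h0, zero_mul] at h1
  have hm : MeasurableSet {H : Hyperplane n | (param H).1 ∈
      {u : Metric.sphere (0 : E n) 1 | inner ℝ w (u : E n) ≠ 0} ∧ (param H).2 ∈ Set.univ} :=
    measurable_param (hC.prod MeasurableSet.univ)
  rw [intensityMeasure, Measure.bind_apply hm hX.process.measurable.aemeasurable,
    lintegral_eq_zero_iff (hX.isPoissonProcess.measurable_apply hm)] at h1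
  refine hne (lintegral_eq_zero_of_ae_eq_zero ?_)
  filter_upwards [h1] with ω hω
  have hat := ((hX.process.counting ω).isSumDirac.eq_zero_iff hm).mp hω
  have : IsEmpty (cells (X ω)) := ⟨fun K => not_mem_cells_of_inner_eq_zero hw
    (fun H hH => by_contra fun h => hat H hH ⟨h, trivial⟩) K.1 K.2⟩
  exact tsum_empty

/-- This replaces the uncountably many directions `w` by countably many sets of normals, so that a
single exceptional null set suffices. -/
theorem exists_inner_pos_near {φ : Measure (Metric.sphere (0 : E n) 1)} {w : E n}
    (hw : φ {u | 0 < inner ℝ w (u : E n)} ≠ 0) :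
    ∃ i k : ℕ, φ {u | 1 / ((k : ℝ) + 1) < inner ℝ (dpt n i) (u : E n)} ≠ 0 ∧
      ∀ u : E n, ‖u‖ = 1 → 1 / ((k : ℝ) + 1) < inner ℝ (dpt n i) u → 0 < inner ℝ w u := by
  have hU : {u : Metric.sphere (0 : E n) 1 | 0 < inner ℝ w (u : E n)}
      ⊆ ⋃ k : ℕ, {u | 2 * (1 / ((k : ℝ) + 1)) < inner ℝ w (u : E n)} := by
    intro u hu
    have hu' : 0 < inner ℝ w (u : E n) / 2 := half_pos hu
    obtain ⟨k, hk⟩ := exists_nat_one_div_lt hu'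
    exact Set.mem_iUnion.mpr ⟨k, show 2 * (1 / ((k : ℝ) + 1)) < inner ℝ w (u : E n) by linarith⟩
  have : ∃ k : ℕ, φ {u | 2 * (1 / ((k : ℝ) + 1)) < inner ℝ w (u : E n)} ≠ 0 := by
    by_contra! h
    exact hw (measure_mono_null hU (measure_iUnion_null h))
  obtain ⟨k, hk⟩ := this
  have hε : (0 : ℝ) < 1 / ((k : ℝ) + 1) := by positivity
  obtain ⟨_, ⟨i, rfl⟩, hi⟩ := dense_range_dpt.exists_dist_lt w hε
  have hclose : ∀ u : E n, ‖u‖ = 1 → |inner ℝ w u - inner ℝ (dpt n i) u| < 1 / ((k : ℝ) + 1) := fun u hu => by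
    rw [← inner_sub_left]
    calc _ ≤ ‖w - dpt n i‖ * ‖u‖ := abs_real_inner_le_norm _ _
      _ < _ := by rw [hu, mul_one, ← dist_eq_norm]; exact hi
  refine ⟨i, k, fun h0 => hk (measure_mono_null (fun u hu => ?_) h0), fun u hu h => ?_⟩
  · have h1 := abs_lt.mp (hclose u (norm_eq_of_mem_sphere u))
    have h2 : 2 * (1 / ((k : ℝ) + 1)) < inner ℝ w (u : E n) := hu
    change 1 / ((k : ℝ) + 1) < inner ℝ (dpt n i) (u : E n)
    linarith
  · have h1 := abs_lt.mp (hclose u hu)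
    linarith

/-- The existence of bounded cells prevents the directional distribution from being concentrated on
`w^⊥`. So normals with `⟨w, u⟩ > 0` or with `⟨w, u⟩ < 0` have positive mass, and hyperplanes with
such normals occur arbitrarily far out on either side, beyond `‖x₀‖`; one of them blocks the ray
from `x₀` in direction `w`. -/
theorem IsStationaryIsotropicPoisson.ae_isCompact (hX : IsStationaryIsotropicPoisson P X γ)
    {c : ConvexBody (E n) → E n} {A : Set (ConvexBody (E n))} {B : Set (E n)}
    (hne : expectedCells P X c A B ≠ 0) :
    ∀ᵐ ω ∂P, ∀ x₀, IsCompact (closedCell (atoms (X ω)) x₀) := by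
  obtain ⟨φ, hφ, hΘ⟩ := hX.intensity.exists_map_param
  have hC : ∀ i k : ℕ, MeasurableSet
      {u : Metric.sphere (0 : E n) 1 | 1 / ((k : ℝ) + 1) < inner ℝ (dpt n i) (u : E n)} := fun i k =>
    measurableSet_lt measurable_const (by fun_prop)
  have hae : ∀ᵐ ω ∂P, ∀ i k T : ℕ,
      φ {u | 1 / ((k : ℝ) + 1) < inner ℝ (dpt n i) (u : E n)} ≠ 0 →
      (∃ H ∈ atoms (X ω), 1 / ((k : ℝ) + 1) < inner ℝ (dpt n i) (normal H) ∧ (T : ℝ) < (param H).2) ∧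
      (∃ H ∈ atoms (X ω), 1 / ((k : ℝ) + 1) < inner ℝ (dpt n i) (normal H) ∧ (param H).2 < -T) := by
    simp only [ae_all_iff]
    intro i k T hpos
    have h1 := hX.ae_exists_atom hΘ (hC i k) hpos (J := fun M => Set.Ioo (T : ℝ) (T + M))
      (fun M => measurableSet_Ioo) (fun M => by simp [Real.volume_Ioo])
    have h2 := hX.ae_exists_atom hΘ (hC i k) hpos (J := fun M => Set.Ioo (-T - M : ℝ) (-T))
      (fun M => measurableSet_Ioo) (fun M => by simp [Real.volume_Ioo])
    filter_upwards [h1, h2] with ω ⟨H, hH, hn, M, hM⟩ ⟨G, hG, hn', M', hM'⟩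
    exact ⟨⟨H, hH, hn, hM.1⟩, ⟨G, hG, hn', hM'.2⟩⟩
  filter_upwards [hae] with ω hω x₀
  refine isCompact_closedCell fun w hw => ?_
  obtain ⟨T, hT⟩ := exists_nat_ge ‖x₀‖
  have hx₀ : ∀ H : Hyperplane n, |inner ℝ x₀ (normal H)| ≤ T := fun H => by
    refine le_trans ?_ hT
    simpa [norm_normal] using abs_real_inner_le_norm x₀ (normal H)
  have hsplit : φ {u | 0 < inner ℝ w (u : E n)} ≠ 0 ∨ φ {u | 0 < inner ℝ (-w) (u : E n)} ≠ 0 := by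
    by_contra! h
    refine hX.measure_inner_ne_zero hΘ hne hw (measure_mono_null ?_ (measure_union_null h.1 h.2))
    intro u hu
    rcases lt_or_gt_of_ne hu with h' | h'
    · exact Or.inr (show 0 < inner ℝ (-w) (u : E n) by rw [inner_neg_left]; linarith)
    · exact Or.inl h'
  rcases hsplit with h | h
  · obtain ⟨i, k, hpos, hik⟩ := exists_inner_pos_near h
    obtain ⟨H, hH, hn, hτ⟩ := (hω i k T hpos).1
    refine ⟨H, hH, mul_neg_of_neg_of_pos ?_ (hik _ (norm_normal H) hn)⟩
    have := abs_le.mp (hx₀ H)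
    unfold height
    linarith
  · obtain ⟨i, k, hpos, hik⟩ := exists_inner_pos_near h
    obtain ⟨H, hH, hn, hτ⟩ := (hω i k T hpos).2
    have h1 := hik _ (norm_normal H) hn
    rw [inner_neg_left] at h1
    refine ⟨H, hH, mul_neg_of_pos_of_neg ?_ (by linarith)⟩
    have := abs_le.mp (hx₀ H)
    unfold height
    linarith

end Boundedness

/-! ### Comparison of thick cells with all cells -/

section Comparison
variable {n : ℕ}

theorem encard_mul_factorial_le {α β : Type*} {s : Set α} {t : Set β}
    (f : s × Equiv.Perm (Fin n) → t) (hf : Function.Injective f) :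
    s.encard * (n.factorial : ℕ∞) ≤ t.encard := by
  have h := ENat.card_le_card_of_injective hf
  rwa [ENat.card_prod, ENat.card_eq_coe_fintype_card (α := Equiv.Perm (Fin n)), Fintype.card_perm,
    Fintype.card_fin] at h

theorem encard_le_mul_factorial {α β : Type*} {s : Set α} {t : Set β}
    (f : t → s × Equiv.Perm (Fin n)) (hf : Function.Injective f) :
    t.encard ≤ s.encard * (n.factorial : ℕ∞) := by
  have h := ENat.card_le_card_of_injective hf
  rwa [ENat.card_prod, ENat.card_eq_coe_fintype_card (α := Equiv.Perm (Fin n)), Fintype.card_perm,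
    Fintype.card_fin] at h

/-- The cells of inradius at least `r` with a lowest center in `B`. -/
def lowCells (μ : Measure (Hyperplane n)) (v : E n) (A : Set (ConvexBody (E n))) (r : ℝ) (B : Set (E n)) :
    Set (ConvexBody (E n)) :=
  {K ∈ cells μ | K ∈ A ∧ lowPoint v r K ∈ B}

theorem exists_isVertex_of_mem_cells {μ : Measure (Hyperplane n)} (hA : LocFin (atoms μ)) {v : E n}
    {r : ℝ} (hr : 0 < r) (hT : NoCommonTangent r (atoms μ)) (hG : GenericDirection v (atoms μ))
    {K : ConvexBody (E n)} (hK : K ∈ cells μ) (hKr : K ∈ thick n r) :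
    ∃ h : Fin n → Hyperplane n, (∀ i, h i ∈ atoms μ) ∧ IsVertex v r h (lowPoint v r K) ∧
      (K : Set (E n)) = closedCell (atoms μ) (lowPoint v r K) ∧
      ∀ H ∈ atoms μ, r ≤ |height H (lowPoint v r K)| := by
  obtain ⟨x₀, hx₀, hKx⟩ := mem_cells_iff.mp hK
  obtain ⟨y, hy⟩ := hKr
  obtain ⟨x, h, hh, hv, hlow⟩ := exists_isVertex hA hx₀ hr.le hT hG (hKx ▸ K.isCompact)
    ⟨y, hKx ▸ hy⟩
  have hx : lowPoint v r K = x := lowPoint_eq (hKx ▸ hlow)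
  have hball : Metric.closedBall x r ⊆ closedCell (atoms μ) x₀ := by
    have : x ∈ lowSet v r (closedCell (atoms μ) x₀) := by rw [hlow]; rfl
    exact this.1
  rw [hx]
  refine ⟨h, hh, hv, ?_, fun H hH => le_abs_height_of_ball hx₀ hr.le hball hH⟩
  rw [hKx, closedCell_eq_of_mem (mem_openCell_of_ball hx₀ hr hball)]

/-- The `n!` orderings of the touched hyperplanes are distinct tuples. The tuple determines the
lowest center, and for `r > 0` the center determines the cell. -/
theorem lowCells_mul_factorial_le {μ : Measure (Hyperplane n)} (hA : LocFin (atoms μ)) {v : E n}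
    {r : ℝ} (hr : 0 < r) (hT : NoCommonTangent r (atoms μ)) (hG : GenericDirection v (atoms μ))
    (B : Set (E n)) :
    (lowCells μ v (thick n r) r B).encard * (n.factorial : ℕ∞) ≤ (tuples μ (vertexTuples v r B)).encard := by
  have hex := fun K : lowCells μ v (thick n r) r B =>
    exists_isVertex_of_mem_cells hA hr hT hG K.2.1 K.2.2.1
  choose h hh hv hcell _ using hex
  refine encard_mul_factorial_le
    (fun p => ⟨h p.1 ∘ p.2, ⟨_, p.1.2.2.2, (hv p.1).comp_perm p.2⟩, fun i => hh p.1 _⟩) ?_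
  rintro ⟨K, σ⟩ ⟨L, τ⟩ hKL
  have hKL' : h K ∘ σ = h L ∘ τ := congrArg Subtype.val hKL
  have hx : lowPoint v r K.1 = lowPoint v r L.1 :=
    ((hv K).comp_perm σ).unique (hKL' ▸ (hv L).comp_perm τ)
  have hKL'' : K = L := Subtype.ext (ConvexBody.ext (by rw [hcell K, hcell L, hx]))
  subst hKL''
  congr 1
  ext i
  exact congrArg Fin.val ((hv K).injective (congrFun hKL' i))

theorem atoms_disjoint_hitting_of_mem_lowCells {μ : Measure (Hyperplane n)} (hA : LocFin (atoms μ))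
    {v : E n} {r : ℝ} (hr : 0 < r) (hT : NoCommonTangent r (atoms μ))
    (hG : GenericDirection v (atoms μ)) {B : Set (E n)} {q : E n} (hB : B ⊆ Metric.ball q (r / 2))
    {K : ConvexBody (E n)} (hK : K ∈ lowCells μ v (thick n r) r B) :
    ∀ H ∈ atoms μ, H ∉ hitting (Metric.closedBall q (r / 2)) := by
  intro H hH
  obtain ⟨h, -, -, -, hdist⟩ := exists_isVertex_of_mem_cells hA hr hT hG hK.1 hK.2.1
  rw [mem_hitting_closedBall, not_le]
  have h1 := hdist H hH
  have h2 := height_lipschitz H (lowPoint v r K) q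
  have h3 := abs_sub_abs_le_abs_sub (height H (lowPoint v r K)) (height H q)
  have h4 : dist (lowPoint v r K) q < r / 2 := hB hK.2.2
  linarith

/-- Each vertex tuple is assigned a cell with that lowest vertex. Tuples with the same cell share
the vertex, and since only `n` hyperplanes pass through it they differ by a permutation. Compactness
is needed because only bounded cells are counted. -/
theorem tuples_le_lowCells_mul_factorial {μ : Measure (Hyperplane n)} (hA : LocFin (atoms μ)) {v : E n}
    (hT : NoCommonTangent 0 (atoms μ)) (hcomp : ∀ x₀, IsCompact (closedCell (atoms μ) x₀))
    (B : Set (E n)) :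
    (tuples μ (vertexTuples v 0 B)).encard ≤ (lowCells μ v Set.univ 0 B).encard * (n.factorial : ℕ∞) := by
  have hex : ∀ h : tuples μ (vertexTuples v 0 B), ∃ K : lowCells μ v Set.univ 0 B,
      IsVertex v 0 h.1 (lowPoint v 0 K.1) := by
    rintro ⟨h, ⟨x, hxB, hx⟩, hh⟩
    obtain ⟨x₀, hx₀, hlow⟩ := hx.exists_cell hA hT hh
    let K : ConvexBody (E n) := ⟨closedCell (atoms μ) x₀, convex_closedCell _ _, hcomp x₀,
      ⟨x₀, fun H _ => mul_self_nonneg _⟩⟩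
    have hKx : lowPoint v 0 K = x := lowPoint_eq hlow
    exact ⟨⟨K, mem_cells_iff.mpr ⟨x₀, hx₀, rfl⟩, trivial, by rw [hKx]; exact hxB⟩, by rw [hKx]; exact hx⟩
  choose K hK using hex
  rcases isEmpty_or_nonempty (tuples μ (vertexTuples v 0 B)) with hemp | hne
  · rw [Set.isEmpty_coe_sort.mp hemp]; simp
  -- The permutation is taken relative to one representative tuple chosen for each cell, so the cell
  -- and the permutation together recover the tuple.
  have hperm : ∀ h : tuples μ (vertexTuples v 0 B), ∃ σ : Equiv.Perm (Fin n),
      h.1 = (Function.invFun K (K h)).1 ∘ σ := by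
    intro h
    set g := Function.invFun K (K h) with hg
    have hgK : K g = K h := Function.invFun_eq ⟨h, rfl⟩
    have hgv := hK g
    rw [hgK] at hgv
    have hmem : ∀ i, ∃ j, g.1 j = h.1 i := fun i =>
      hT.mem_range hgv.injective g.2.2 (hgv.abs_height le_rfl) (h.2.2 i) ((hK h).abs_height le_rfl i)
    choose σ hσ using hmem
    have hσinj : Function.Injective σ := fun i j hij =>
      (hK h).injective (by rw [← hσ i, ← hσ j, hij])
    exact ⟨Equiv.ofBijective σ (Finite.injective_iff_bijective.mp hσinj), funext fun i => (hσ i).symm⟩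
  choose σ hσ using hperm
  refine encard_le_mul_factorial (fun h => (K h, σ h)) fun h g hhg => ?_
  obtain ⟨h1, h2⟩ := Prod.ext_iff.mp hhg
  dsimp only at h1 h2
  exact Subtype.ext (by rw [hσ h, hσ g, h1, h2])

theorem lowCells_iUnion (μ : Measure (Hyperplane n)) (v : E n) (A : Set (ConvexBody (E n))) (r : ℝ)
    (B : ℕ → Set (E n)) : lowCells μ v A r (⋃ j, B j) = ⋃ j, lowCells μ v A r (B j) := by
  ext K
  simp [lowCells]

theorem vertexTuples_iUnion (v : E n) (r : ℝ) (B : ℕ → Set (E n)) :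
    vertexTuples v r (⋃ j, B j) = ⋃ j, vertexTuples v r (B j) := by
  ext h
  simp only [vertexTuples, Set.mem_iUnion, Set.mem_ofPred_eq]
  exact ⟨fun ⟨x, ⟨j, hj⟩, hx⟩ => ⟨j, x, hj, hx⟩, fun ⟨j, x, hj, hx⟩ => ⟨x, ⟨j, hj⟩, hx⟩⟩

variable {Ω : Type*} [MeasurableSpace Ω] {P : Measure Ω} {X : Ω → Measure (Hyperplane n)} {γ : ℝ}

/-- The mean number of cells with a lowest vertex in `B`, from below. -/
theorem IsStationaryIsotropicPoisson.vertexTuples_le [IsProbabilityMeasure P]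
    (hX : IsStationaryIsotropicPoisson P X γ) (v : E n) {B : Set (E n)} (hB : MeasurableSet B)
    (hcomp : ∀ᵐ ω ∂P, ∀ x₀, IsCompact (closedCell (atoms (X ω)) x₀)) :
    Measure.pi (fun _ => intensityMeasure P X) (vertexTuples v 0 B)
      ≤ (∫⁻ ω, ((lowCells (X ω) v Set.univ 0 B).encard : ENNReal) ∂P) * n.factorial := by
  have hY := hX.isPoissonProcess
  obtain ⟨φ, hφ, hΘ⟩ := hX.intensity.exists_map_param
  obtain ⟨F, -, -, hF, hint⟩ := hY.exists_tuple_count (measurableSet_vertexTuples v 0 hB)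
    (fun h hh => hh.choose_spec.2.injective) MeasurableSet.empty (by simp) (fun _ _ _ => id)
  simp only [measure_empty, Set.ofPred_true, Measure.restrict_univ, ENNReal.toReal_zero, neg_zero,
    Real.exp_zero, ENNReal.ofReal_one, one_mul] at hint
  rw [← hint, ← lintegral_mul_const' _ _ (ENNReal.natCast_ne_top _)]
  refine lintegral_mono_ae ?_
  filter_upwards [hcomp, hX.ae_simple, hY.ae_noCommonTangent hΘ 0] with ω h1 h2 h3
  refine (hF ω h2).trans ?_
  have := tuples_le_lowCells_mul_factorial (v := v) (hX.process.counting ω).locFin h3 h1 B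
  exact_mod_cast this

/-- The mean number of cells of inradius at least `r` with a lowest center in `B`, from above. -/
theorem IsStationaryIsotropicPoisson.le_vertexTuples [IsProbabilityMeasure P]
    (hX : IsStationaryIsotropicPoisson P X γ) {v : E n}
    (hG : ∀ᵐ ω ∂P, GenericDirection v (atoms (X ω))) {r : ℝ} (hr : 0 < r) {B : Set (E n)}
    (hB : MeasurableSet B) :
    (∫⁻ ω, ((lowCells (X ω) v (thick n r) r B).encard : ENNReal) ∂P) * n.factorial
      ≤ ENNReal.ofReal (Real.exp (-(γ * r))) *
        Measure.pi (fun _ => intensityMeasure P X) (vertexTuples v 0 B) := by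
  have hY := hX.isPoissonProcess
  have hσ := hY.sigmaFinite
  obtain ⟨φ, hφ, hΘ⟩ := hX.intensity.exists_map_param
  -- On each piece of `B` the random center is within `r / 2` of a fixed point, whose ball of radius
  -- `r / 2` serves as a deterministic void set of intensity `γ * 2 * (r / 2) = γ * r`.
  set Q : ℕ → Set (E n) := disjointed fun j => Metric.ball (dpt n j) (r / 2) with hQ
  have hQm : ∀ j, MeasurableSet (B ∩ Q j) := fun j =>
    hB.inter (MeasurableSet.disjointed (fun _ => measurableSet_ball) j)
  have hQball : ∀ j, B ∩ Q j ⊆ Metric.ball (dpt n j) (r / 2) := fun j =>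
    Set.inter_subset_right.trans (disjointed_subset _ j)
  have hQB : B = ⋃ j, B ∩ Q j := by
    rw [← Set.inter_iUnion, hQ, iUnion_disjointed]
    refine (Set.inter_eq_left.mpr fun x _ => ?_).symm
    obtain ⟨_, ⟨j, rfl⟩, hj⟩ := dense_range_dpt.exists_dist_lt x (half_pos hr)
    exact Set.mem_iUnion.mpr ⟨j, hj⟩
  set V : ℕ → Set (Hyperplane n) := fun j => hitting (Metric.closedBall (dpt n j) (r / 2)) with hV
  have hVm : ∀ j, MeasurableSet (V j) := fun j => measurableSet_hitting (isCompact_closedBall _ _)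
  have hΘV : ∀ j, intensityMeasure P X (V j) = ENNReal.ofReal (γ * r) := fun j => by
    rw [hV, intensity_hitting_closedBall hΘ, ← ENNReal.ofReal_mul hX.intensity.1.le]
    congr 1; ring
  -- The touching hyperplanes have distance exactly `r` from the center and so miss the smaller
  -- ball. Hence the void event contributes an independent factor.
  have hDV : ∀ j, ∀ h ∈ vertexTuples v r (B ∩ Q j), ∀ i, h i ∉ V j := by
    rintro j h ⟨x, hx, hv⟩ i
    rw [hV, mem_hitting_closedBall, not_le]
    have h1 := hv.abs_height hr.le i
    have h2 := height_lipschitz (h i) x (dpt n j)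
    have h3 := abs_sub_abs_le_abs_sub (height (h i) x) (height (h i) (dpt n j))
    have h4 : dist x (dpt n j) < r / 2 := hQball j hx
    linarith
  have hcount := fun j => hY.exists_tuple_count (measurableSet_vertexTuples v r (hQm j))
    (fun h hh => hh.choose_spec.2.injective) (hVm j) (by rw [hΘV]; exact ENNReal.ofReal_lt_top) (hDV j)
  choose F hFm hF _ hint using hcount
  have hvoid : ∀ j, MeasurableSet {ω | X ω (V j) = 0} := fun j =>
    hY.measurable_apply (hVm j) (measurableSet_singleton 0)
  calc (∫⁻ ω, ((lowCells (X ω) v (thick n r) r B).encard : ENNReal) ∂P) * n.factorial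
      ≤ ∫⁻ ω, ∑' j, {ω | X ω (V j) = 0}.indicator (F j) ω ∂P := by
        rw [← lintegral_mul_const' _ _ (ENNReal.natCast_ne_top _)]
        refine lintegral_mono_ae ?_
        filter_upwards [hG, hY.ae_noCommonTangent hΘ r] with ω h1 h2
        have hloc := (hX.process.counting ω).locFin
        rw [hQB, lowCells_iUnion]
        refine (mul_le_mul_left (a := (n.factorial : ENNReal))
          (le_of_eq (tsum_encard_of_partition rfl ?_).symm)).trans ?_
        · intro i j hij
          refine Set.disjoint_left.mpr fun K hi hj => ?_
          exact Set.disjoint_left.mp (disjoint_disjointed _ hij) hi.2.2.2 hj.2.2.2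
        rw [← ENNReal.tsum_mul_right]
        refine ENNReal.tsum_le_tsum fun j => ?_
        -- One thick cell with lowest center in the piece already forces `V j` to be void, so the
        -- void indicator costs nothing.
        rcases (lowCells (X ω) v (thick n r) r (B ∩ Q j)).eq_empty_or_nonempty with hemp | ⟨K, hK⟩
        · simp [hemp]
        · have h0 : X ω (V j) = 0 := ((hX.process.counting ω).isSumDirac.eq_zero_iff (hVm j)).mpr
            (atoms_disjoint_hitting_of_mem_lowCells hloc hr h2 h1 (hQball j) hK)
          rw [Set.indicator_of_mem (show ω ∈ {ω | X ω (V j) = 0} from h0)]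
          refine le_trans ?_ (hF j ω)
          exact_mod_cast lowCells_mul_factorial_le hloc hr h2 h1 (B ∩ Q j)
    _ = ∑' j, ENNReal.ofReal (Real.exp (-(γ * r))) *
          Measure.pi (fun _ => intensityMeasure P X) (vertexTuples v 0 (B ∩ Q j)) := by
        rw [lintegral_tsum fun j => ((hFm j).indicator (hvoid j)).aemeasurable]
        refine tsum_congr fun j => ?_
        rw [lintegral_indicator (hvoid j), hint, hΘV, pi_intensity_vertexTuples hΘ v r (hQm j),
          ENNReal.toReal_ofReal (mul_pos hX.intensity.1 hr).le]
    _ = _ := by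
        rw [ENNReal.tsum_mul_left]
        congr 1
        conv_rhs => rw [hQB, vertexTuples_iUnion]
        refine (measure_iUnion (fun i j hij => ?_) fun j => measurableSet_vertexTuples v 0 (hQm j)).symm
        refine Set.disjoint_left.mpr fun h ⟨x, hx, hv⟩ ⟨y, hy, hw⟩ => ?_
        rw [hw.unique hv] at hy
        exact Set.disjoint_left.mp (disjoint_disjointed _ hij) hx.2 hy.2

/-- The proportion of cells of inradius at least `r` is at most `exp (-γ r)`. -/
theorem IsStationaryIsotropicPoisson.expectedCells_thick_le [IsProbabilityMeasure P]
    (hX : IsStationaryIsotropicPoisson P X γ) {c : ConvexBody (E n) → E n} (hc : IsCenterFunction c)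
    {B : Set (E n)} (hB : MeasurableSet B) (hB0 : volume B ≠ 0) (hBt : volume B ≠ ⊤)
    (hne : expectedCells P X c Set.univ B ≠ 0) {r : ℝ} (hr : 0 < r) :
    expectedCells P X c (thick n r) B
      ≤ ENNReal.ofReal (Real.exp (-(γ * r))) * expectedCells P X c Set.univ B := by
  obtain ⟨v, hG⟩ := hX.isPoissonProcess.exists_ae_genericDirection
  have hthick : ∀ K : ConvexBody (E n), K ∈ thick n 0 := fun K => by
    obtain ⟨x, hx⟩ := K.nonempty
    exact ⟨x, by simpa using hx⟩
  have h1 := hX.le_vertexTuples hG hr hB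
  have h2 := hX.vertexTuples_le v hB (hX.ae_isCompact hne)
  rw [expectedCells_eq_encard hX.process hX.stationary (measurableSet_thick hr.le)
      (fun _ _ => translateBody_mem_thick) hc (measurable_lowPoint v hr.le)
      (fun K hK t => lowPoint_translateBody v hr.le hK t) hB hB0 hBt,
    expectedCells_eq_encard hX.process hX.stationary MeasurableSet.univ (fun _ _ => Iff.rfl) hc
      (measurable_lowPoint v le_rfl) (fun K _ t => lowPoint_translateBody v le_rfl (hthick K) t) hB hB0 hBt]
  -- Both bounds pass through the same measure of vertex tuples, whose value is never needed;
  -- afterwards `n!` cancels.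
  have h3 := h1.trans (mul_le_mul_right h2 _)
  rw [← mul_assoc] at h3
  exact (ENNReal.mul_le_mul_iff_left (Nat.cast_ne_zero.mpr n.factorial_ne_zero)
    (ENNReal.natCast_ne_top _)).mp h3

end Comparison

/-! ### The tail bound for the inradius and the limit -/

theorem mem_thick_of_lt_inradius {n : ℕ} {K : ConvexBody (E n)} {r : ℝ} (hr : 0 ≤ r)
    (h : r < inradius K) : K ∈ thick n r := by
  have hne : {ρ : ℝ | 0 ≤ ρ ∧ ∃ x : E n, Metric.closedBall x ρ ⊆ (K : Set (E n))}.Nonempty := by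
    by_contra hemp
    rw [inradius, Set.not_nonempty_iff_eq_empty.mp hemp, Real.sSup_empty] at h
    linarith
  obtain ⟨ρ, ⟨-, x, hx⟩, hlt⟩ := exists_lt_of_lt_csSup hne h
  exact ⟨x, (Metric.closedBall_subset_closedBall hlt.le).trans hx⟩

/-- The law of `Z` on the whole space says that the normalizing factor times the mean number of
cells with center in `B` equals one. This shows that there are cells, and it makes the factor cancel
in the comparison of thick cells with all cells. -/
theorem IsTypicalCell.prob_lt_inradius_le {n : ℕ} {Ω Ω' : Type*} [MeasurableSpace Ω]
    [MeasurableSpace Ω'] {P : Measure Ω} [IsProbabilityMeasure P] {P' : Measure Ω'}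
    [IsProbabilityMeasure P'] {X : Ω → Measure (Hyperplane n)} {γ : ℝ}
    (hX : IsStationaryIsotropicPoisson P X γ) {c : ConvexBody (E n) → E n} (hc : IsCenterFunction c)
    {B : Set (E n)} (hB : MeasurableSet B) (hBb : Bornology.IsBounded B) (hB0 : volume B ≠ 0)
    {Z : Ω' → ConvexBody (E n)} (hZ : IsTypicalCell P X c B P' Z) {r : ℝ} (hr : 0 < r) :
    P' {ω | r < inradius (Z ω)} ≤ ENNReal.ofReal (Real.exp (-(γ * r))) := by
  have huniv := hZ.law Set.univ MeasurableSet.univ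
  rw [Set.preimage_univ, measure_univ] at huniv
  have hne : expectedCells P X c Set.univ B ≠ 0 := fun h0 => by
    rw [h0, mul_zero] at huniv
    exact one_ne_zero huniv
  calc P' {ω | r < inradius (Z ω)} ≤ P' (Z ⁻¹' thick n r) :=
        measure_mono fun ω hω => mem_thick_of_lt_inradius hr.le hω
    _ = (cellIntensity P X c * volume B)⁻¹ * expectedCells P X c (thick n r) B :=
        hZ.law _ (measurableSet_thick hr.le)
    _ ≤ (cellIntensity P X c * volume B)⁻¹ *
          (ENNReal.ofReal (Real.exp (-(γ * r))) * expectedCells P X c Set.univ B) := by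
        gcongr
        exact hX.expectedCells_thick_le hc hB hB0 hBb.measure_lt_top.ne hne hr
    _ = ENNReal.ofReal (Real.exp (-(γ * r))) := by
        rw [mul_left_comm, ← huniv, mul_one]

end HyperplaneTess

theorem mainTheorem9
    {Ω Ω' : ℕ → Type*} [∀ n, MeasurableSpace (Ω n)] [∀ n, MeasurableSpace (Ω' n)]
    (P : ∀ n, Measure (Ω n)) [∀ n, IsProbabilityMeasure (P n)]
    (P' : ∀ n, Measure (Ω' n)) [∀ n, IsProbabilityMeasure (P' n)]
    (γ : ℕ → ℝ)
    (X : ∀ n, Ω n → Measure (HyperplaneTess.Hyperplane n))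
    (hX : ∀ n, 1 ≤ n → HyperplaneTess.IsStationaryIsotropicPoisson (P n) (X n) (γ n))
    (c : ∀ n, ConvexBody (HyperplaneTess.E n) → HyperplaneTess.E n)
    (hc : ∀ n, 1 ≤ n → HyperplaneTess.IsCenterFunction (c n))
    (B : ∀ n, Set (HyperplaneTess.E n))
    (hB : ∀ n, 1 ≤ n → MeasurableSet (B n) ∧ Bornology.IsBounded (B n) ∧ volume (B n) ≠ 0)
    (Z : ∀ n, Ω' n → ConvexBody (HyperplaneTess.E n))
    (hZ : ∀ n, 1 ≤ n → HyperplaneTess.IsTypicalCell (P n) (X n) (c n) (B n) (P' n) (Z n))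
    (hγ : Tendsto γ atTop atTop)
    (r : ℝ) (hr : 0 < r) :
    Tendsto (fun n => P' n {ω | r < HyperplaneTess.inradius (Z n ω)}) atTop (𝓝 0) := by
  have hlim : Tendsto (fun n => ENNReal.ofReal (Real.exp (-(γ n * r)))) atTop (𝓝 0) := by
    rw [← ENNReal.ofReal_zero]
    exact ENNReal.tendsto_ofReal
      (Real.tendsto_exp_neg_atTop_nhds_zero.comp (hγ.atTop_mul_const hr))
  refine tendsto_of_tendsto_of_tendsto_of_le_of_le' tendsto_const_nhds hlim
    (Eventually.of_forall fun n => zero_le) ?_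
  filter_upwards [eventually_ge_atTop 1] with n hn
  exact HyperplaneTess.IsTypicalCell.prob_lt_inradius_le (hX n hn) (hc n hn) (hB n hn).1 (hB n hn).2.1
    (hB n hn).2.2 (hZ n hn) hr
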